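/- Let ${\bf k}$ be a field, $E$ a finite-dimensional ${\bf k}$-vector space, $A=\operatorname{Sym}(E)$, and let $\Sigma$ be a smooth fan with rays $\varrho_1,\dots,\varrho_n$. Let $\mathcal B=(b_1,\dots,b_d)$ be a finite generating family of $A$ consisting of homogeneous elements of positive degree, with ideal of relations $I_{\mathcal B}\subset{\bf k}[y_1,\dots,y_d]$, and let $L_{\mathcal B}$ be the ideal of relations among the $b_j$ of degree one. The min convention is used for initial forms $\operatorname{in}_w$ and tropical varieties. *Diagrams.* $\operatorname{Trop}_\star(I_{\mathcal B})$ is the set of points $(\mathfrak v_u(b_1),\dots,\mathfrak v_u(b_d))$, where $u$ is an integral point of $\operatorname{Trop}(L_{\mathcal B})$ and $\mathfrak v_u(a)$ is the largest $r\in\mathbb Z$ such that $a$ is a linear combination of monomials of $u$-weight at least $r$ in the degree-one members of $\mathcal B$. A diagram is a matrix $D\in\mathbb Z^{n\times d}$ whose rows $w_1,\dots,w_n$ lie in $\operatorname{Trop}_\star(I_{\mathcal B})$ and which is adapted to $\Sigma$: for each $\sigma\in\Sigma$ the rows $w_i$ with $\varrho_i\subset\sigma$ lie in a common maximal face of the Gröbner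 fan of $I_{\mathcal B}$. The set of diagrams is $\Delta=\Delta(\Sigma,\operatorname{Trop}_\star(I_{\mathcal B}))$; a diagram $D$ defines a toric vector bundle $\mathcal E$ on the toric variety $Y(\Sigma)$ with general fiber $E$. Let $G^i_r\subseteq A$ be the span of the monomials in $\mathcal B$ of $w_i$-weight at least $r$. The total section ring of $\mathcal E$ (the Cox ring of $\mathbb P\mathcal E$) is $$\mathcal R(\mathcal E)=\bigoplus_{r\in\mathbb Z^n}\Big(\bigcap_{i=1}^n G^i_{r_i}\Big)t^r\ \subseteq\ A[t_1^{\pm1},\dots,t_n^{\pm1}].$$ *The ideal $\mathcal I_{\mathcal B}$ and the set $\mathcal F$.* Let $\mathcal I_{\mathcal B}$ be the kernel of ${\bf k}[X_1,\dots,X_n,Y_1,\dots,Y_d]\to A[t_1^{\pm1},\dots,t_n^{\pm1}]$, $X_i\mapsto t_i^{-1}$, $Y_j\mapsto b_j\prod_i t_i^{D_{ij}}$. The family $\mathcal B$ is a strong Khovanskii basis for $D$ if the image of this map is $\mathcal R(\mathcal E)$. For $w\in\mathbb Z^d$ let $s(w)$ be the weight that is $0$ on the $X_i$ and $w_j$ on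 $Y_j$. A finite generating set $\mathcal F$ of $\mathcal I_{\mathcal B}$ is called good for $D$ if for every $i$ the initial forms $\operatorname{in}_{s(w_i)}(f)$, $f\in\mathcal F$, generate $\operatorname{in}_{s(w_i)}(\mathcal I_{\mathcal B})$ and $\operatorname{in}_{s(w_i)}(f)=f|_{X_i=0}$ for all $f\in\mathcal F$. Let $C_{\mathcal F}\subseteq\Delta$ be the set of the $D'\in\Delta$, with rows $w_1',\dots,w_n'$, such that $\operatorname{in}_{s(w_i')}(f)=\operatorname{in}_{s(w_i)}(f)$ for all $f\in\mathcal F$ and all $i$. A polyhedral cone in $\mathbb Z^{n\times d}$ means the set of integral solutions of finitely many homogeneous linear equations and strict homogeneous linear inequalities with integer coefficients (the lattice points of a relatively open rational polyhedral cone). **Proposition.** 1. Let $D\in\Delta$ have finitely generated total section ring, let $\mathcal B$ be a strong Khovanskii basis for $D$, and let $\mathcal F$ be good for $D$. Then $C_{\mathcal F}$ is a polyhedral cone that contains $D$, and for every $D'\in C_{\mathcal F}$ the corresponding bundle $\mathcal E'$ has finitely generated total section ring $\mathcal R(\mathcal E')$. 2. The locus of those $D\in\Delta$ whose bundle has finitely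 generated total section ring is a union of polyhedral cones. Moreover each of these cones can be taken to be the image of a cone $C_{\mathcal F}$ as in part 1, formed for some finite generating family $\hat{\mathcal B}\supseteq\mathcal B$ of homogeneous elements of positive degree, some $\hat D\in\Delta(\Sigma,\operatorname{Trop}_\star(I_{\hat{\mathcal B}}))$ with finitely generated total section ring for which $\hat{\mathcal B}$ is a strong Khovanskii basis, and some $\mathcal F$ that is good for $\hat D$, under the map that forgets the columns belonging to $\hat{\mathcal B}\setminus\mathcal B$; this map does not change the total section rings of the diagrams in $C_{\mathcal F}$. -/

import Mathlib

open MvPolynomial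

/-! ### Initial forms, initial ideals, tropical varieties (min convention) -/

section Initial

variable {k : Type*} [Field k] {τ : Type*}

/-- The value `⟨w, α⟩` of the weight `w` on the exponent vector `α`. -/
noncomputable def expWeight (w : τ → ℤ) (α : τ →₀ ℕ) : ℤ := Finsupp.weight w α

open Classical in
/-- `in_w(p)`: the sum of the terms of `p` whose `w`-weight is minimal; `in_w(0) = 0`. -/
noncomputable def initialForm (w : τ → ℤ) (p : MvPolynomial τ k) : MvPolynomial τ k :=
  ∑ α ∈ p.support.filter (fun α => ∀ β ∈ p.support, expWeight w α ≤ expWeight w β),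
    monomial α (p.coeff α)

/-- `in_w(I)`: the ideal generated by the initial forms of the elements of `I`. -/
noncomputable def initialIdeal (w : τ → ℤ) (I : Ideal (MvPolynomial τ k)) :
    Ideal (MvPolynomial τ k) :=
  Ideal.span (initialForm w '' (I : Set (MvPolynomial τ k)))

/-- The ideal `I` is generated by monomials. -/
def IsMonomialIdeal (I : Ideal (MvPolynomial τ k)) : Prop :=
  ∃ S : Set (τ →₀ ℕ), I = Ideal.span ((fun α => monomial α (1 : k)) '' S)

/-- The lattice points of `Trop(I)`: for every polynomial in `I` and every monomial of it, some
other monomial of it has at most the same weight (so the minimum is attained at least twice). -/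
def tropicalVariety (I : Ideal (MvPolynomial τ k)) : Set (τ → ℤ) :=
  {w | ∀ p ∈ I, ∀ α ∈ p.support, ∃ β ∈ p.support, β ≠ α ∧ expWeight w β ≤ expWeight w α}

/-- The face of the Gröbner fan of `I` with `w₀` in its relative interior, as a closed cone:
`w` lies in it if and only if `in_{w₀}(in_w(I)) = in_{w₀}(I)`, that is,
`in_{w + ε w₀}(I) = in_{w₀}(I)` for all small `ε > 0`. -/
def groebnerFace (I : Ideal (MvPolynomial τ k)) (w₀ : τ → ℤ) : Set (τ → ℤ) :=
  {w | initialIdeal w₀ (initialIdeal w I) = initialIdeal w₀ I}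

end Initial

/-! ### Weight filtrations and multi-Rees algebras -/

section Rees

variable {k : Type*} [Field k] {A : Type*} [CommRing A] [Algebra k A] {τ : Type*}

/-- `G_r(𝔳_w) ⊆ A`, the `r`-th step of the filtration of the weight quasivaluation `𝔳_w` of the
weight `w` on the elements `c`: the span of the monomials in `c` of weight at least `r`. -/
noncomputable def weightFiltration (c : τ → A) (w : τ → ℤ) (r : ℤ) : Submodule k A :=
  Submodule.span k {a | ∃ α : τ →₀ ℕ, r ≤ expWeight w α ∧ a = α.prod fun j e => c j ^ e}

variable (k) in
/-- `𝔳_w(a) = r`, that is, `r` is the largest integer with `a ∈ G_r(𝔳_w)`. -/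
def HasWeightValue (c : τ → A) (w : τ → ℤ) (a : A) (r : ℤ) : Prop :=
  IsGreatest {s : ℤ | a ∈ weightFiltration (k := k) c w s} r

theorem one_mem_weightFiltration (c : τ → A) (w : τ → ℤ) :
    (1 : A) ∈ weightFiltration (k := k) c w 0 :=
  Submodule.subset_span ⟨0, by simp [expWeight], by simp⟩

theorem mul_mem_weightFiltration {c : τ → A} {w : τ → ℤ} {r s : ℤ} {x y : A}
    (hx : x ∈ weightFiltration (k := k) c w r) (hy : y ∈ weightFiltration (k := k) c w s) :
    x * y ∈ weightFiltration (k := k) c w (r + s) := by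
  have h : weightFiltration (k := k) c w r * weightFiltration (k := k) c w s
      ≤ weightFiltration (k := k) c w (r + s) := by
    unfold weightFiltration
    rw [Submodule.span_mul_span]
    apply Submodule.span_mono
    rintro _ ⟨a, ⟨α, hα, rfl⟩, b, ⟨β, hβ, rfl⟩, rfl⟩
    refine ⟨α + β, ?_, ?_⟩
    · simp only [expWeight, map_add] at *
      exact add_le_add hα hβ
    · exact (Finsupp.prod_add_index' (by simp) (by intros; rw [pow_add])).symm
  exact h (Submodule.mul_mem_mul hx hy)

variable {n : ℕ} {d : ℕ}

variable (k) in
/-- The total section ring `⨁_{r ∈ ℤⁿ} F_r`, where `F_r = ⋂ᵢ G_{rᵢ}(𝔳_{wᵢ})` and `w₁, …, wₙ` are the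
rows of `D`, as the subalgebra `∑_r F_r t^r` of `A[t₁^±, …, tₙ^±]`. -/
noncomputable def totalSectionRing (b : Fin d → A) (D : Matrix (Fin n) (Fin d) ℤ) :
    Subalgebra k (AddMonoidAlgebra A (Fin n → ℤ)) where
  carrier := {x | ∀ (r : Fin n → ℤ) (i : Fin n),
    x.coeff r ∈ weightFiltration (k := k) b (D i) (r i)}
  mul_mem' := by
    classical
    intro x y hx hy r i
    rw [AddMonoidAlgebra.coeff_mul]
    refine Submodule.sum_mem _ fun p _ => Submodule.sum_mem _ fun q _ => ?_
    dsimp only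
    split_ifs with h
    · have h2 := mul_mem_weightFiltration (hx p i) (hy q i)
      rwa [← Pi.add_apply, h] at h2
    · exact Submodule.zero_mem _
  add_mem' := by
    intro x y hx hy r i
    simpa using Submodule.add_mem _ (hx r i) (hy r i)
  algebraMap_mem' := by
    classical
    intro c r i
    have e : (algebraMap k (AddMonoidAlgebra A (Fin n → ℤ)) c)
        = AddMonoidAlgebra.single 0 (algebraMap k A c) := rfl
    rw [e, AddMonoidAlgebra.coeff_single, Finsupp.single_apply]
    split_ifs with h
    · subst h
      rw [Algebra.algebraMap_eq_smul_one]
      exact Submodule.smul_mem _ _ (one_mem_weightFiltration b (D i))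
    · exact Submodule.zero_mem _

variable (k) in
/-- The `k`-algebra map `φ : k[X₁, …, Xₙ, Y₁, …, Y_d] → A[t₁^±, …, tₙ^±]` with `φ(Xᵢ) = tᵢ⁻¹` and
`φ(Yⱼ) = bⱼ t^{Dⱼ}`, where `Dⱼ` is the `j`-th column of `D`. -/
noncomputable def coxPresentation (b : Fin d → A) (D : Matrix (Fin n) (Fin d) ℤ) :
    MvPolynomial (Fin n ⊕ Fin d) k →ₐ[k] AddMonoidAlgebra A (Fin n → ℤ) :=
  MvPolynomial.aeval (Sum.elim (fun i => AddMonoidAlgebra.single (-Pi.single i 1) 1)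
    (fun j => AddMonoidAlgebra.single (fun i => D i j) (b j)))

variable (k) in
/-- The ideal `𝓘_𝓑 ⊆ k[X, Y]`, the kernel of `φ`. -/
noncomputable def coxIdeal (b : Fin d → A) (D : Matrix (Fin n) (Fin d) ℤ) :
    Ideal (MvPolynomial (Fin n ⊕ Fin d) k) :=
  RingHom.ker (coxPresentation k b D)

variable (k) in
/-- `b` is a strong Khovanskii basis for `D`: the total section ring is generated by the elements
`tᵢ⁻¹` and `bⱼ t^{Dⱼ}`. -/
def IsStrongKhovanskiiBasis (b : Fin d → A) (D : Matrix (Fin n) (Fin d) ℤ) : Prop :=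
  (coxPresentation k b D).range = totalSectionRing k b D

variable (k) in
/-- The ideal `I_𝓑 ⊆ k[y₁, …, y_d]` of polynomial relations among the `bⱼ`. -/
noncomputable def relationIdeal {τ : Type*} (b : τ → A) : Ideal (MvPolynomial τ k) :=
  RingHom.ker (MvPolynomial.aeval b : MvPolynomial τ k →ₐ[k] A)

end Rees

/-! ### Good generating sets of the ideal `𝓘_𝓑`, and the polyhedral cones of diagrams -/

section Good

variable {k : Type*} [Field k] {n d : ℕ}

/-- `s(w) = (0, w)`: weight `0` on the variables `X`, weight `w` on the variables `Y`. -/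
def liftWeight (n : ℕ) {d : ℕ} (w : Fin d → ℤ) : Fin n ⊕ Fin d → ℤ :=
  Sum.elim (fun _ => 0) w

/-- The restriction `f|_{Xᵢ = 0}`. -/
noncomputable def setXZero (i : Fin n) (f : MvPolynomial (Fin n ⊕ Fin d) k) :
    MvPolynomial (Fin n ⊕ Fin d) k :=
  MvPolynomial.aeval (fun s => if s = Sum.inl i then 0 else X s) f

/-- `F` is a finite generating set of `𝓘_𝓑` such that, for each row `wᵢ` of `D`, the initial forms
of `F` generate `in_{s(wᵢ)}(𝓘_𝓑)`, and `in_{s(wᵢ)}(f) = f|_{Xᵢ = 0}` for all `f ∈ F`. -/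
structure IsGoodGeneratingSet {A : Type*} [CommRing A] [Algebra k A] (b : Fin d → A)
    (D : Matrix (Fin n) (Fin d) ℤ) (F : Finset (MvPolynomial (Fin n ⊕ Fin d) k)) : Prop where
  span_eq : Ideal.span (F : Set (MvPolynomial (Fin n ⊕ Fin d) k)) = coxIdeal k b D
  span_initial : ∀ i, Ideal.span (initialForm (liftWeight n (D i)) ''
      (F : Set (MvPolynomial (Fin n ⊕ Fin d) k))) =
    initialIdeal (liftWeight n (D i)) (coxIdeal k b D)
  initial_eq : ∀ i, ∀ f ∈ F, initialForm (liftWeight n (D i)) f = setXZero i f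

/-- `C` is the set of integral points of a (relatively open) rational polyhedral cone in
`ℚ^{n × d}`: it is cut out by finitely many homogeneous linear equations and finitely many
homogeneous strict linear inequalities. -/
def IsPolyhedralCone (C : Set (Matrix (Fin n) (Fin d) ℤ)) : Prop :=
  ∃ P Q : Finset (Matrix (Fin n) (Fin d) ℤ),
    C = {D | (∀ p ∈ P, ∑ i, ∑ j, p i j * D i j = 0) ∧ (∀ q ∈ Q, 0 < ∑ i, ∑ j, q i j * D i j)}

end Good

/-! ### Smooth fans -/

/-- A smooth fan in `ℤ^m` with `n` rays: `ray i` are the primitive ray generators and a cone is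
given by the set of the indices of its rays. -/
structure SmoothFan (m n : ℕ) where
  /-- The primitive ray generators. -/
  ray : Fin n → Fin m → ℤ
  /-- The cones, as sets of rays. -/
  cones : Set (Finset (Fin n))
  empty_mem : ∅ ∈ cones
  singleton_mem : ∀ i, {i} ∈ cones
  /-- Faces of cones are cones. -/
  face_mem : ∀ S ∈ cones, ∀ T ⊆ S, T ∈ cones
  /-- The ray generators of a cone are part of a basis of the lattice. -/
  smooth : ∀ S ∈ cones, Set.InjOn ray S ∧
    ∃ B : Module.Basis (Fin m) ℤ (Fin m → ℤ), ∀ i ∈ S, ray i ∈ Set.range B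
  /-- Two cones intersect in the cone spanned by their common rays. -/
  inter_eq : ∀ S ∈ cones, ∀ T ∈ cones, ∀ c c' : Fin n → ℚ,
    (∀ i, 0 ≤ c i) → (∀ i, 0 ≤ c' i) →
    (∑ i ∈ S, c i • (fun a => (ray i a : ℚ)) = ∑ i ∈ T, c' i • (fun a => (ray i a : ℚ))) →
    ∃ c'' : Fin n → ℚ, (∀ i, 0 ≤ c'' i) ∧
      ∑ i ∈ S, c i • (fun a => (ray i a : ℚ)) = ∑ i ∈ S ∩ T, c'' i • (fun a => (ray i a : ℚ))

/-! ### Diagrams of toric vector bundles -/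

section Diagrams

variable {k : Type*} [Field k] {E : Type*} [AddCommGroup E] [Module k E] {m n d : ℕ}

/-- `b` is a finite generating set of `Sym(E)` made of homogeneous elements of positive degree;
the degree-`e` part of `Sym(E)` is the `e`-th power of the image of `E`. -/
structure IsHomogeneousGenerating (b : Fin d → SymmetricAlgebra k E) : Prop where
  homogeneous : ∀ j, ∃ e : ℕ, 0 < e ∧ b j ∈ (LinearMap.range (SymmetricAlgebra.ι k E)) ^ e
  generates : Algebra.adjoin k (Set.range b) = ⊤

/-- The linear part of `b`: the members of `b` that lie in `E`. -/
def linearPart (b : Fin d → SymmetricAlgebra k E) :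
    {j : Fin d // b j ∈ LinearMap.range (SymmetricAlgebra.ι k E)} → SymmetricAlgebra k E :=
  fun j => b j

/-- `Trop_⋆(I_𝓑)`: the points `(𝔳_u(b₁), …, 𝔳_u(b_d))` for `u ∈ Trop(L_𝓑)`, where `L_𝓑` is the ideal of
relations among the linear part of `b`, and `𝔳_u` is the weight valuation of `u` on the linear
part. -/
def tropStar (b : Fin d → SymmetricAlgebra k E) : Set (Fin d → ℤ) :=
  {w | ∃ u ∈ tropicalVariety (relationIdeal k (linearPart b)),
    ∀ j, HasWeightValue k (linearPart b) u (b j) (w j)}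

/-- `D` is adapted to the fan: for each cone, the rows of `D` that belong to its rays lie in a common
maximal face of the Gröbner fan of `I_𝓑` (a face is maximal when its initial ideal is monomial). -/
def IsAdapted (fan : SmoothFan m n) (b : Fin d → SymmetricAlgebra k E)
    (D : Matrix (Fin n) (Fin d) ℤ) : Prop :=
  ∀ S ∈ fan.cones, ∃ w₀ : Fin d → ℤ, IsMonomialIdeal (initialIdeal w₀ (relationIdeal k b)) ∧
    ∀ i ∈ S, D i ∈ groebnerFace (relationIdeal k b) w₀

/-- `Δ(Σ, Trop_⋆(I_𝓑))`: the (integral) diagrams of toric vector bundles with general fiber `E`. -/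
def diagrams (fan : SmoothFan m n) (b : Fin d → SymmetricAlgebra k E) :
    Set (Matrix (Fin n) (Fin d) ℤ) :=
  {D | (∀ i, D i ∈ tropStar b) ∧ IsAdapted fan b D}

/-- The diagrams `D` whose bundle has a finitely generated total section ring. -/
def fgLocus (fan : SmoothFan m n) (b : Fin d → SymmetricAlgebra k E) :
    Set (Matrix (Fin n) (Fin d) ℤ) :=
  {D | D ∈ diagrams fan b ∧ (totalSectionRing k b D).FG}

/-- `C_F`: the diagrams `D'` with `in_{s(wᵢ')}(f) = in_{s(wᵢ)}(f)` for all `f ∈ F` and all rows. -/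
def goodCone (fan : SmoothFan m n) (b : Fin d → SymmetricAlgebra k E)
    (D : Matrix (Fin n) (Fin d) ℤ) (F : Finset (MvPolynomial (Fin n ⊕ Fin d) k)) :
    Set (Matrix (Fin n) (Fin d) ℤ) :=
  {D' | D' ∈ diagrams fan b ∧ ∀ i, ∀ f ∈ F,
    initialForm (liftWeight n (D' i)) f = initialForm (liftWeight n (D i)) f}

end Diagrams

/-! All conditions on a diagram in the statement turn out to depend on its rows `wᵢ` only through
the initial ideals `in_{wᵢ}(I)`, where `I = I_𝓑`. The ideal `I` is homogeneous for positive degrees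
of the variables, so each degree contains finitely many monomials. Monomials of one degree that form
a basis modulo `in_w(I)` also form a basis modulo `I`, and this basis is adapted to the filtration
of `𝔳_w`: an element of `G_r` expands in basis monomials of weight at least `r`
(`exists_standard_expGE`). Hence weights with the same initial ideal share adapted bases, and an
inclusion `in_w(I) ⊆ in_{w'}(I)` is an equality (`initialIdeal_eq_of_le`). It follows that being a
diagram (`mem_diagrams_of_initialIdeal_eq`) and having `𝓑` as a strong Khovanskii basis
(`IsStrongKhovanskiiBasis.of_initialIdeal_eq`, exchanging one row at a time) depend only on the
initial ideals of the rows.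

Part 1. The substitution `X = 1` carries `in_{s(wᵢ)}(𝓘_𝓑)` onto generators of `in_{wᵢ}(I)`. If `D'`
selects the same initial forms of a good `F`, then `in_{wᵢ}(I) ⊆ in_{wᵢ'}(I)`, so the two agree.
Therefore the diagram conditions in `C_F` are automatic, what remains are linear conditions saying
which terms of each `f` are minimal, and the strong Khovanskii property passes to all of `C_F`.

Part 2. Given `D` with finitely generated total section ring, append to `𝓑` the positive-degree
components of the coefficients of finitely many generators, with their values as new columns. The
filtrations do not change, and the larger family is a strong Khovanskii basis
(`exists_isStrongKhovanskiiBasis_append`). The larger matrix is again a diagram: it lies in `Trop_⋆`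
because `𝔳_u` is a minimal-weight valuation on a polynomial ring (`append_mem_tropStar`), and it is
adapted because the new variables can be given such low auxiliary weights that they become initial
terms (`isAdapted_append`). Homogenizations of relations give a good generating set
(`exists_isGoodGeneratingSet`). On the resulting cone the new columns are linear functions of the
old ones (`exists_weight_eq_expWeight`), so forgetting them maps the cone onto a polyhedral cone. -/

/-! ### Weight components of polynomials and of initial ideals. -/

section Restriction

variable {k : Type*} [Field k] {τ : Type*}

/-- The exponents of weight at least `q`. -/
def expGE (w : τ → ℤ) (q : ℤ) : Set (τ →₀ ℕ) := {α | q ≤ expWeight w α}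

/-- The exponents of weight `q`. -/
def expEQ (w : τ → ℤ) (q : ℤ) : Set (τ →₀ ℕ) := {α | expWeight w α = q}

/-- The exponents of degree `e`. -/
def expDeg (δ : τ → ℕ) (e : ℕ) : Set (τ →₀ ℕ) := {α | Finsupp.weight δ α = e}

@[simp] theorem mem_expGE {w : τ → ℤ} {q : ℤ} {α : τ →₀ ℕ} :
    α ∈ expGE w q ↔ q ≤ expWeight w α := Iff.rfl

@[simp] theorem mem_expEQ {w : τ → ℤ} {q : ℤ} {α : τ →₀ ℕ} :
    α ∈ expEQ w q ↔ expWeight w α = q := Iff.rfl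

@[simp] theorem mem_expDeg {δ : τ → ℕ} {e : ℕ} {α : τ →₀ ℕ} :
    α ∈ expDeg δ e ↔ Finsupp.weight δ α = e := Iff.rfl

theorem expWeight_add (w : τ → ℤ) (α β : τ →₀ ℕ) :
    expWeight w (α + β) = expWeight w α + expWeight w β := by simp [expWeight]

@[simp] theorem expWeight_zero (w : τ → ℤ) : expWeight w 0 = 0 := by simp [expWeight]

@[simp] theorem expWeight_single (w : τ → ℤ) (j : τ) (e : ℕ) :
    expWeight w (Finsupp.single j e) = e * w j := by
  simp [expWeight, Finsupp.weight_single]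

theorem expWeight_mapDomain {κ : Type*} (f : κ → τ) (w : τ → ℤ) (α : κ →₀ ℕ) :
    expWeight w (α.mapDomain f) = expWeight (w ∘ f) α := by
  induction α using Finsupp.induction_linear with
  | zero => simp
  | add a b ha hb => rw [Finsupp.mapDomain_add, expWeight_add, expWeight_add, ha, hb]
  | single j e => simp

theorem mem_restrictSupport' {T : Set (τ →₀ ℕ)} {p : MvPolynomial τ k} :
    p ∈ restrictSupport k T ↔ ∀ α, coeff α p ≠ 0 → α ∈ T := by
  rw [mem_restrictSupport_iff]
  constructor
  · intro h α hα
    exact h (mem_support_iff.2 hα)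
  · intro h α hα
    exact h α (mem_support_iff.1 hα)

open Classical in
/-- The sum of the terms of `p` whose exponents lie in `T`. -/
noncomputable def restr (T : Set (τ →₀ ℕ)) : MvPolynomial τ k →ₗ[k] MvPolynomial τ k where
  toFun p := AddMonoidAlgebra.ofCoeff ((AddMonoidAlgebra.coeff p).filter (· ∈ T))
  map_add' p q := by
    ext α
    simp [coeff, Finsupp.filter_apply]
  map_smul' c p := by
    ext α
    simp [coeff, Finsupp.filter_apply]

open Classical in
theorem coeff_restr (T : Set (τ →₀ ℕ)) (p : MvPolynomial τ k) (α : τ →₀ ℕ) :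
    coeff α (restr T p) = if α ∈ T then coeff α p else 0 := by
  simp [restr, coeff, Finsupp.filter_apply]

theorem restr_mem (T : Set (τ →₀ ℕ)) (p : MvPolynomial τ k) :
    restr T p ∈ restrictSupport k T := by
  classical
  rw [mem_restrictSupport']
  intro α hα
  rw [coeff_restr] at hα
  by_contra h
  exact hα (if_neg h)

theorem restr_mem_of_mem {S : Set (τ →₀ ℕ)} (T : Set (τ →₀ ℕ)) {p : MvPolynomial τ k}
    (hp : p ∈ restrictSupport k S) : restr T p ∈ restrictSupport k S := by
  classical
  rw [mem_restrictSupport'] at hp ⊢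
  intro α hα
  rw [coeff_restr] at hα
  exact hp α (by aesop)

theorem restr_mem_inter {S T : Set (τ →₀ ℕ)} {p : MvPolynomial τ k}
    (hp : p ∈ restrictSupport k S) : restr T p ∈ restrictSupport k (S ∩ T) := by
  have h1 := mem_restrictSupport'.1 (restr_mem_of_mem T hp)
  have h2 := mem_restrictSupport'.1 (restr_mem T p)
  exact mem_restrictSupport'.2 fun α hα => ⟨h1 α hα, h2 α hα⟩

theorem restr_eq_self {T : Set (τ →₀ ℕ)} {p : MvPolynomial τ k}
    (hp : p ∈ restrictSupport k T) : restr T p = p := by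
  classical
  rw [mem_restrictSupport'] at hp
  ext α
  rw [coeff_restr]
  by_cases h : coeff α p = 0
  · simp [h]
  · simp [hp α h]

theorem restr_restr (S T : Set (τ →₀ ℕ)) (p : MvPolynomial τ k) :
    restr S (restr T p) = restr (S ∩ T) p := by
  classical
  ext α
  simp only [coeff_restr, Set.mem_inter_iff]
  split_ifs <;> tauto

theorem restr_comm (S T : Set (τ →₀ ℕ)) (p : MvPolynomial τ k) :
    restr S (restr T p) = restr T (restr S p) := by
  rw [restr_restr, restr_restr, Set.inter_comm]

theorem restr_eq_zero {S T : Set (τ →₀ ℕ)} {p : MvPolynomial τ k}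
    (hp : p ∈ restrictSupport k S) (h : ∀ α ∈ S, α ∉ T) : restr T p = 0 := by
  classical
  rw [mem_restrictSupport'] at hp
  ext α
  rw [coeff_restr, coeff_zero]
  split_ifs with hα
  · by_contra h0
    exact h α (hp α h0) hα
  · rfl

theorem sub_restr_mem {S T U : Set (τ →₀ ℕ)} {p : MvPolynomial τ k}
    (hp : p ∈ restrictSupport k S) (h : ∀ α ∈ S, α ∉ T → α ∈ U) :
    p - restr T p ∈ restrictSupport k U := by
  classical
  rw [mem_restrictSupport'] at hp ⊢
  intro α hα
  rw [coeff_sub, coeff_restr] at hα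
  split_ifs at hα with h1
  · simp at hα
  · exact h α (hp α (by simpa using hα)) h1

/-- Weights are integers, so cancelling the components of weight `q` raises the bound by one. This
is the gain in each step of the descending inductions below. -/
theorem sub_mem_expGE_succ {w : τ → ℤ} {q : ℤ} {p g : MvPolynomial τ k}
    (hp : p ∈ restrictSupport k (expGE w q)) (hg : g ∈ restrictSupport k (expGE w q))
    (h : restr (expEQ w q) p = restr (expEQ w q) g) :
    p - g ∈ restrictSupport k (expGE w (q + 1)) := by
  have h2 : p - g = (p - g) - restr (expEQ w q) (p - g) := by
    rw [map_sub, h, sub_self, sub_zero]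
  rw [h2]
  refine sub_restr_mem (Submodule.sub_mem _ hp hg) fun α h1 h2 => ?_
  simp only [mem_expGE, mem_expEQ] at *
  omega

open Classical in
/-- A polynomial is the sum of its weighted components. -/
theorem eq_sum_restr_fiber {M : Type*} (v : (τ →₀ ℕ) → M) (p : MvPolynomial τ k) :
    p = ∑ m ∈ p.support.image v, restr {α | v α = m} p := by
  ext α
  simp only [coeff_sum, coeff_restr, Set.mem_ofPred_eq, Finset.sum_ite_eq, Finset.mem_image,
    mem_support_iff]
  by_cases h0 : coeff α p = 0
  · simp [h0]
  · rw [if_pos ⟨α, h0, rfl⟩]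

/-- The function `v` on exponents is arbitrary; it will be a weight, a degree or a multidegree. -/
theorem mem_of_restr_fiber_mem {M : Type*} (v : (τ →₀ ℕ) → M) {K : Ideal (MvPolynomial τ k)}
    {p : MvPolynomial τ k} (h : ∀ m, restr {α | v α = m} p ∈ K) : p ∈ K := by
  rw [eq_sum_restr_fiber v p]
  exact Ideal.sum_mem _ fun m _ => h m

theorem map_mem_of_restr_fiber_mem {M N : Type*} [AddCommGroup N] [Module k N]
    (v : (τ →₀ ℕ) → M) (φ : MvPolynomial τ k →ₗ[k] N) {Z : Submodule k N}
    {p : MvPolynomial τ k} (h : ∀ m, φ (restr {α | v α = m} p) ∈ Z) : φ p ∈ Z := by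
  rw [eq_sum_restr_fiber v p, map_sum]
  exact Submodule.sum_mem _ fun m _ => h m

theorem exists_expWeight_min (w : τ → ℤ) {p : MvPolynomial τ k} (hp : p ≠ 0) :
    ∃ q, p ∈ restrictSupport k (expGE w q) ∧ restr (expEQ w q) p ≠ 0 := by
  classical
  obtain ⟨α, hα, hmin⟩ := Finset.exists_min_image p.support (expWeight w)
    (MvPolynomial.support_nonempty.2 hp)
  refine ⟨expWeight w α, mem_restrictSupport'.2 fun β hβ => hmin β (mem_support_iff.2 hβ), ?_⟩
  intro h0
  have := congrArg (coeff α) h0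
  rw [coeff_restr, if_pos (by simp)] at this
  exact mem_support_iff.1 hα (by simpa using this)

theorem initialForm_eq_restr {w : τ → ℤ} {q : ℤ} {p : MvPolynomial τ k}
    (hp : p ∈ restrictSupport k (expGE w q)) (h0 : restr (expEQ w q) p ≠ 0) :
    initialForm w p = restr (expEQ w q) p := by
  classical
  obtain ⟨γ, hγ⟩ := MvPolynomial.ne_zero_iff.1 h0
  rw [coeff_restr] at hγ
  have hγq : expWeight w γ = q := by
    by_contra h
    exact hγ (by simp [h])
  have hγp : coeff γ p ≠ 0 := by
    intro h
    exact hγ (by simp [h])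
  rw [mem_restrictSupport'] at hp
  ext α
  simp only [initialForm, coeff_sum, coeff_monomial, coeff_restr, Finset.sum_ite_eq',
    Finset.mem_filter, mem_support_iff, mem_expEQ]
  by_cases hα : coeff α p = 0
  · simp [hα]
  · have h1 := hp α hα
    have : (∀ β, coeff β p ≠ 0 → expWeight w α ≤ expWeight w β) ↔ expWeight w α = q := by
      constructor
      · intro h
        have := h γ hγp
        simp only [mem_expGE] at h1
        omega
      · intro h β hβ
        rw [h]
        exact hp β hβ
    simp only [ne_eq, hα, not_false_eq_true, true_and, this]

theorem initialForm_zero (w : τ → ℤ) : initialForm w (0 : MvPolynomial τ k) = 0 := by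
  simp [initialForm]

/-- The linear operator `restr` replaces `initialForm`: the component of weight `q` may vanish, so
`q` need only be a lower bound for the weights of `p`. -/
theorem restr_mem_initialIdeal {w : τ → ℤ} {q : ℤ} {I : Ideal (MvPolynomial τ k)}
    {p : MvPolynomial τ k} (hp : p ∈ I) (hq : p ∈ restrictSupport k (expGE w q)) :
    restr (expEQ w q) p ∈ initialIdeal w I := by
  by_cases h0 : restr (expEQ w q) p = 0
  · rw [h0]
    exact Ideal.zero_mem _
  · rw [← initialForm_eq_restr hq h0]
    exact Ideal.subset_span ⟨p, hp, rfl⟩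

theorem restr_monomial_mul (w : τ → ℤ) (q : ℤ) (β : τ →₀ ℕ) (c : k) (p : MvPolynomial τ k) :
    restr (expEQ w q) (monomial β c * p) =
      monomial β c * restr (expEQ w (q - expWeight w β)) p := by
  classical
  ext α
  simp only [coeff_restr, coeff_monomial_mul', mem_expEQ]
  by_cases h : β ≤ α
  · have e : expWeight w α = expWeight w β + expWeight w (α - β) := by
      rw [← expWeight_add, add_tsub_cancel_of_le h]
    have : expWeight w α = q ↔ expWeight w (α - β) = q - expWeight w β := by omega
    simp [h, this]
  · simp [h]

theorem mul_mem_expGE {w : τ → ℤ} {q r : ℤ} {p g : MvPolynomial τ k}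
    (hp : p ∈ restrictSupport k (expGE w q)) (hg : g ∈ restrictSupport k (expGE w r)) :
    p * g ∈ restrictSupport k (expGE w (q + r)) := by
  have h := Submodule.mul_mem_mul hp hg
  rw [← restrictSupport_add] at h
  refine restrictSupport_mono k ?_ h
  rintro _ ⟨α, hα, β, hβ, rfl⟩
  simp only [mem_expGE, expWeight_add] at *
  omega

theorem monomial_mem_expGE (w : τ → ℤ) (β : τ →₀ ℕ) (c : k) :
    monomial β c ∈ restrictSupport k (expGE w (expWeight w β)) :=
  (monomial_mem_restrictSupport k).2 (Or.inl (by simp))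

/-- Elements of the initial ideal have components that lift to elements of the ideal. -/
theorem mem_initialIdeal_iff {w : τ → ℤ} {I : Ideal (MvPolynomial τ k)} {p : MvPolynomial τ k} :
    p ∈ initialIdeal w I ↔ ∀ q, ∃ g ∈ I, g ∈ restrictSupport k (expGE w q) ∧
      restr (expEQ w q) g = restr (expEQ w q) p := by
  constructor
  · intro hp
    induction hp using Submodule.span_induction with
    | mem x hx =>
      obtain ⟨f, hf, rfl⟩ := hx
      intro q
      by_cases hf0 : f = 0
      · exact ⟨0, I.zero_mem, Submodule.zero_mem _, by rw [hf0, initialForm_zero]⟩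
      obtain ⟨m, hm, hm0⟩ := exists_expWeight_min w hf0
      rw [initialForm_eq_restr hm hm0]
      by_cases hqm : q = m
      · subst hqm
        exact ⟨f, hf, hm, by rw [restr_restr, Set.inter_self]⟩
      · refine ⟨0, I.zero_mem, Submodule.zero_mem _, ?_⟩
        rw [map_zero]
        refine (restr_eq_zero (restr_mem _ _) ?_).symm
        intro α h1 h2
        simp only [mem_expEQ] at h1 h2
        omega
    | zero => exact fun q => ⟨0, I.zero_mem, Submodule.zero_mem _, rfl⟩
    | add x y _ _ hx hy =>
      intro q
      obtain ⟨g, hg, hg1, hg2⟩ := hx q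
      obtain ⟨g', hg', hg1', hg2'⟩ := hy q
      exact ⟨g + g', I.add_mem hg hg', Submodule.add_mem _ hg1 hg1', by
        rw [map_add, map_add, hg2, hg2']⟩
    | smul a x _ hx =>
      induction a using MvPolynomial.induction_on' with
      | monomial β c =>
        intro q
        -- Multiplication by the monomial shifts all weights by that of `β`.
        obtain ⟨g, hg, hg1, hg2⟩ := hx (q - expWeight w β)
        refine ⟨monomial β c * g, I.mul_mem_left _ hg, ?_, ?_⟩
        · have := mul_mem_expGE (monomial_mem_expGE w β c) hg1
          rwa [add_sub_cancel] at this
        · rw [smul_eq_mul, restr_monomial_mul, restr_monomial_mul, hg2]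
      | add a b ha hb =>
        intro q
        obtain ⟨g, hg, hg1, hg2⟩ := ha q
        obtain ⟨g', hg', hg1', hg2'⟩ := hb q
        exact ⟨g + g', I.add_mem hg hg', Submodule.add_mem _ hg1 hg1', by
          rw [map_add, add_smul, map_add, hg2, hg2']⟩
  · intro h
    refine mem_of_restr_fiber_mem (expWeight w) fun q => ?_
    obtain ⟨g, hg, hg1, hg2⟩ := h q
    change restr (expEQ w q) p ∈ _
    rw [← hg2]
    exact restr_mem_initialIdeal hg hg1

theorem restr_expEQ_mem_initialIdeal {w : τ → ℤ} {I : Ideal (MvPolynomial τ k)}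
    {p : MvPolynomial τ k} (hp : p ∈ initialIdeal w I) (q : ℤ) :
    restr (expEQ w q) p ∈ initialIdeal w I := by
  obtain ⟨g, hg, hg1, hg2⟩ := mem_initialIdeal_iff.1 hp q
  rw [← hg2]
  exact restr_mem_initialIdeal hg hg1

/-- The initial ideal is graded by the weight. In the exchange of rows, `R` will be the set of
weights below a bound. -/
theorem restr_preimage_mem_initialIdeal {w : τ → ℤ} {I : Ideal (MvPolynomial τ k)}
    {p : MvPolynomial τ k} (hp : p ∈ initialIdeal w I) (R : Set ℤ) :
    restr {α | expWeight w α ∈ R} p ∈ initialIdeal w I := by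
  classical
  refine mem_of_restr_fiber_mem (expWeight w) fun q => ?_
  change restr (expEQ w q) _ ∈ _
  by_cases hq : q ∈ R
  · rw [restr_restr, Set.inter_eq_left.2]
    · exact restr_expEQ_mem_initialIdeal hp q
    · intro α hα
      simp only [mem_expEQ] at hα
      simpa [hα] using hq
  · rw [restr_eq_zero (restr_mem _ _)]
    · exact Ideal.zero_mem _
    · intro α h1 h2
      simp only [mem_expEQ, Set.mem_ofPred_eq] at h1 h2
      exact hq (h2 ▸ h1)

/-- The ideal is homogeneous for the grading in which the `j`-th variable has degree `δ j`. -/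
def IsDegHomogeneous (δ : τ → ℕ) (I : Ideal (MvPolynomial τ k)) : Prop :=
  ∀ p ∈ I, ∀ e, restr (expDeg δ e) p ∈ I

theorem IsDegHomogeneous.initialIdeal {δ : τ → ℕ} {I : Ideal (MvPolynomial τ k)}
    (hI : IsDegHomogeneous δ I) (w : τ → ℤ) : IsDegHomogeneous δ (initialIdeal w I) := by
  intro p hp e
  rw [mem_initialIdeal_iff] at hp ⊢
  intro q
  obtain ⟨g, hg, hg1, hg2⟩ := hp q
  refine ⟨restr (expDeg δ e) g, hI g hg e, restr_mem_of_mem _ hg1, ?_⟩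
  rw [restr_comm, hg2, restr_comm]

/-- A component of an element of the initial ideal of a homogeneous ideal lifts to a
homogeneous element. -/
theorem exists_lift_of_mem_initialIdeal {δ : τ → ℕ} {I : Ideal (MvPolynomial τ k)}
    (hI : IsDegHomogeneous δ I) {w : τ → ℤ} {p : MvPolynomial τ k} (hp : p ∈ initialIdeal w I)
    {e : ℕ} (he : p ∈ restrictSupport k (expDeg δ e)) (q : ℤ) :
    ∃ g ∈ I, g ∈ restrictSupport k (expDeg δ e) ∧ g ∈ restrictSupport k (expGE w q) ∧
      restr (expEQ w q) g = restr (expEQ w q) p := by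
  obtain ⟨g, hg, hg1, hg2⟩ := mem_initialIdeal_iff.1 hp q
  refine ⟨restr (expDeg δ e) g, hI g hg e, restr_mem _ _, restr_mem_of_mem _ hg1, ?_⟩
  rw [restr_comm, hg2, restr_comm, restr_eq_self he]

end Restriction

/-! ### Standard monomials as bases adapted to weight filtrations. -/

section StandardMonomials

variable {k : Type*} [Field k] {τ : Type*}

/-- A descending induction. -/
theorem le_of_le_sup_succ {M : Type*} [AddCommGroup M] [Module k M] {V Z : ℤ → Submodule k M}
    (hV : ∃ Q, ∀ q ≥ Q, V q = ⊥) (hZ : Antitone Z) (h : ∀ q, V q ≤ Z q ⊔ V (q + 1)) (q : ℤ) :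
    V q ≤ Z q := by
  obtain ⟨Q, hQ⟩ := hV
  -- Induction on a bound `N` for the distance from `q` to the threshold `Q`, beyond which `V`
  -- vanishes.
  have key : ∀ (N : ℕ) (q : ℤ), Q - q ≤ N → V q ≤ Z q := by
    intro N
    induction N with
    | zero =>
      intro q hq
      rw [hQ q (by push_cast at hq; omega)]
      exact bot_le
    | succ N ih =>
      intro q hq
      exact (h q).trans (sup_le le_rfl ((ih (q + 1) (by push_cast at hq; omega)).trans
        (hZ (by omega))))
  exact key (Q - q).toNat q (Int.self_le_toNat _)

theorem expEQ_subset_expGE (w : τ → ℤ) (q : ℤ) : expEQ w q ⊆ expGE w q := by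
  intro α hα
  simp only [mem_expEQ, mem_expGE] at *
  omega

/-- Every set of monomials contains a subset that is a basis of its span modulo `K`. -/
theorem exists_standard_subset (K : Ideal (MvPolynomial τ k)) (T : Set (τ →₀ ℕ)) :
    ∃ B ⊆ T, (∀ p ∈ K, p ∈ restrictSupport k B → p = 0) ∧
      ∀ p ∈ restrictSupport k T, ∃ s ∈ restrictSupport k B, p - s ∈ K := by
  let v : (τ →₀ ℕ) → MvPolynomial τ k ⧸ K := fun α => Ideal.Quotient.mkₐ k K (monomial α 1)
  obtain ⟨B, hBT, -, hsp, hli⟩ := exists_linearIndepOn_extension (K := k) (v := v)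
    (linearIndepOn_empty k v) (Set.empty_subset T)
  refine ⟨B, hBT, ?_, ?_⟩
  · intro p hp hpB
    rw [linearIndepOn_iff] at hli
    have h0 := hli (AddMonoidAlgebra.coeff p) (by
      rw [Finsupp.mem_supported]
      exact (mem_restrictSupport_iff k).1 hpB) (by
      have : Finsupp.linearCombination k v (AddMonoidAlgebra.coeff p) =
          Ideal.Quotient.mkₐ k K p := by
        conv_rhs => rw [p.as_sum]
        rw [map_sum, Finsupp.linearCombination_apply, Finsupp.sum]
        refine Finset.sum_congr rfl fun α _ => ?_
        change coeff α p • Ideal.Quotient.mkₐ k K (monomial α 1) = _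
        rw [← map_smul, smul_monomial, smul_eq_mul, mul_one]
      rw [this]
      exact Ideal.Quotient.eq_zero_iff_mem.2 hp)
    ext α
    exact DFunLike.congr_fun h0 α
  · intro p hp
    have h1 : Ideal.Quotient.mkₐ k K p ∈ (restrictSupport k T).map
        (Ideal.Quotient.mkₐ k K).toLinearMap := ⟨p, hp, rfl⟩
    have h2 : (restrictSupport k T).map (Ideal.Quotient.mkₐ k K).toLinearMap ≤
        (restrictSupport k B).map (Ideal.Quotient.mkₐ k K).toLinearMap := by
      rw [restrictSupport_eq_span, restrictSupport_eq_span, Submodule.map_span,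
        Submodule.map_span, Submodule.span_le, ← Set.image_comp, ← Set.image_comp]
      exact hsp
    obtain ⟨s, hs, hs2⟩ := h2 h1
    refine ⟨s, hs, ?_⟩
    rw [← Ideal.Quotient.eq_zero_iff_mem, map_sub, sub_eq_zero]
    exact hs2.symm

/-- The lowest component of a relation supported on `B` is again supported on `B`, and it lies in
the initial ideal. -/
theorem eq_zero_of_initialIdeal {w : τ → ℤ} {I : Ideal (MvPolynomial τ k)} {B : Set (τ →₀ ℕ)}
    (h : ∀ p ∈ initialIdeal w I, p ∈ restrictSupport k B → p = 0) :
    ∀ p ∈ I, p ∈ restrictSupport k B → p = 0 := by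
  intro p hp hB
  by_contra h0
  obtain ⟨q, hq, hq0⟩ := exists_expWeight_min w h0
  exact hq0 (h _ (restr_mem_initialIdeal hp hq) (restr_mem_of_mem _ hB))

variable {δ : τ → ℕ}

/-- Positive degrees leave finitely many exponents in each degree. The bound makes the descending
inductions on the weight terminate. -/
theorem exists_expWeight_lt [Finite τ] (hδ : ∀ j, 0 < δ j) (w : τ → ℤ) (e : ℕ) :
    ∃ Q, ∀ α ∈ expDeg δ e, expWeight w α < Q := by
  have hfin : (expDeg δ e).Finite :=
    (Finsupp.finite_of_nat_weight_le δ (fun j => (hδ j).ne') e).subset fun α hα => by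
      simp only [mem_expDeg] at hα
      simp [hα]
  obtain ⟨Q, hQ⟩ := (hfin.image (expWeight w)).bddAbove
  exact ⟨Q + 1, fun α hα => Int.lt_add_one_of_le (hQ ⟨α, hα, rfl⟩)⟩

theorem exists_lt_expWeight [Finite τ] (hδ : ∀ j, 0 < δ j) (w : τ → ℤ) (e : ℕ) :
    ∃ Q, ∀ α ∈ expDeg δ e, Q < expWeight w α := by
  have hfin : (expDeg δ e).Finite :=
    (Finsupp.finite_of_nat_weight_le δ (fun j => (hδ j).ne') e).subset fun α hα => by
      simp only [mem_expDeg] at hα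
      simp [hα]
  obtain ⟨Q, hQ⟩ := (hfin.image (expWeight w)).bddBelow
  exact ⟨Q - 1, fun α hα => by
    have := hQ ⟨α, hα, rfl⟩
    omega⟩

theorem restrictSupport_eq_bot {T : Set (τ →₀ ℕ)} (h : ∀ α, α ∉ T) :
    restrictSupport k T = ⊥ := by
  rw [eq_bot_iff]
  intro p hp
  rw [mem_restrictSupport'] at hp
  rw [Submodule.mem_bot]
  ext α
  by_contra h0
  exact h α (hp α h0)

/-- Monomials that span modulo the initial ideal are adapted to the weight filtration
modulo the ideal. -/
theorem exists_standard_expGE [Finite τ] (hδ : ∀ j, 0 < δ j) {I : Ideal (MvPolynomial τ k)}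
    (hI : IsDegHomogeneous δ I) {w : τ → ℤ} {e : ℕ} {B : Set (τ →₀ ℕ)} (hB : B ⊆ expDeg δ e)
    (hsp : ∀ p ∈ restrictSupport k (expDeg δ e), ∃ s ∈ restrictSupport k B,
      p - s ∈ initialIdeal w I) (q : ℤ) {p : MvPolynomial τ k}
    (hp : p ∈ restrictSupport k (expDeg δ e)) (hq : p ∈ restrictSupport k (expGE w q)) :
    ∃ s ∈ restrictSupport k (B ∩ expGE w q), p - s ∈ I := by
  have key := le_of_le_sup_succ (k := k)
    (V := fun q => restrictSupport k (expDeg δ e) ⊓ restrictSupport k (expGE w q))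
    (Z := fun q => restrictSupport k (B ∩ expGE w q) ⊔ I.restrictScalars k) ?_ ?_ ?_ q
  · obtain ⟨s, hs, i, hi, rfl⟩ := Submodule.mem_sup.1 (key (Submodule.mem_inf.2 ⟨hp, hq⟩))
    exact ⟨s, hs, by simpa using hi⟩
  · obtain ⟨Q, hQ⟩ := exists_expWeight_lt hδ w e
    refine ⟨Q, fun q hq => ?_⟩
    rw [eq_bot_iff, ← restrictSupport_eq_bot (k := k) (T := expDeg δ e ∩ expGE w q)]
    · rintro p ⟨h1, h2⟩
      exact mem_restrictSupport'.2 fun α hα =>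
        Set.mem_inter (mem_restrictSupport'.1 h1 α hα) (mem_restrictSupport'.1 h2 α hα)
    · rintro α ⟨h1, h2⟩
      have := hQ α h1
      simp only [mem_expGE] at h2
      omega
  · intro q q' hqq
    refine sup_le_sup_right (restrictSupport_mono k ?_) _
    rintro α ⟨h1, h2⟩
    exact ⟨h1, by simp only [mem_expGE] at *; omega⟩
  · rintro q p ⟨hp, hq⟩
    -- Subduction: modulo the initial ideal the lowest component of `p` is a combination `s` of `B`,
    -- and the difference lifts to some `g ∈ I`. Since the initial ideal is graded by weight, only
    -- the weight-`q` part of `s` is needed; subtracting it and `g` leaves weights at least `q + 1`.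
    obtain ⟨s, hs, hsK⟩ := hsp _ (restr_mem_of_mem (expEQ w q) hp)
    have hd : restr (expEQ w q) p - s ∈ restrictSupport k (expDeg δ e) :=
      Submodule.sub_mem _ (restr_mem_of_mem _ hp) (restrictSupport_mono k hB hs)
    obtain ⟨g, hg, hgd, hgq, hg2⟩ := exists_lift_of_mem_initialIdeal hI hsK hd q
    have hs1 : restr (expEQ w q) s ∈ restrictSupport k (B ∩ expEQ w q) := restr_mem_inter hs
    have hs2 : restr (expEQ w q) s ∈ restrictSupport k (B ∩ expGE w q) :=
      restrictSupport_mono k (Set.inter_subset_inter_right _ (expEQ_subset_expGE w q)) hs1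
    have hs3 : restr (expEQ w q) s ∈ restrictSupport k (expGE w q) :=
      restrictSupport_mono k Set.inter_subset_right hs2
    have hs4 : restr (expEQ w q) s ∈ restrictSupport k (expDeg δ e) :=
      restrictSupport_mono k (fun α hα => hB hα.1) hs2
    have e1 : p = (restr (expEQ w q) s + g) + (p - (restr (expEQ w q) s + g)) := by ring
    rw [e1]
    refine Submodule.add_mem_sup (Submodule.add_mem_sup hs2 hg) (Submodule.mem_inf.2 ⟨?_, ?_⟩)
    · exact Submodule.sub_mem _ hp (Submodule.add_mem _ hs4 hgd)
    · refine sub_mem_expGE_succ hq (Submodule.add_mem _ hs3 hgq) ?_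
      rw [map_add, hg2, map_sub, restr_restr, restr_restr, Set.inter_self]
      ring

theorem exists_standard_of_initialIdeal [Finite τ] (hδ : ∀ j, 0 < δ j) {I : Ideal (MvPolynomial τ k)}
    (hI : IsDegHomogeneous δ I) {w : τ → ℤ} {e : ℕ} {B : Set (τ →₀ ℕ)} (hB : B ⊆ expDeg δ e)
    (hsp : ∀ p ∈ restrictSupport k (expDeg δ e), ∃ s ∈ restrictSupport k B,
      p - s ∈ initialIdeal w I) :
    ∀ p ∈ restrictSupport k (expDeg δ e), ∃ s ∈ restrictSupport k B, p - s ∈ I := by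
  intro p hp
  by_cases h0 : p = 0
  · exact ⟨0, Submodule.zero_mem _, by simp [h0]⟩
  obtain ⟨q, hq, -⟩ := exists_expWeight_min w h0
  obtain ⟨s, hs, hsI⟩ := exists_standard_expGE hδ hI hB hsp q hp hq
  exact ⟨s, restrictSupport_mono k Set.inter_subset_left hs, hsI⟩

/-- If monomials span modulo the initial ideal and are independent modulo the ideal, then they
are independent modulo the initial ideal. -/
theorem initialIdeal_eq_zero_of_span [Finite τ] (hδ : ∀ j, 0 < δ j) {I : Ideal (MvPolynomial τ k)}
    (hI : IsDegHomogeneous δ I) {w : τ → ℤ} {e : ℕ} {B : Set (τ →₀ ℕ)} (hB : B ⊆ expDeg δ e)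
    (hsp : ∀ p ∈ restrictSupport k (expDeg δ e), ∃ s ∈ restrictSupport k B,
      p - s ∈ initialIdeal w I)
    (hind : ∀ p ∈ I, p ∈ restrictSupport k B → p = 0) :
    ∀ p ∈ initialIdeal w I, p ∈ restrictSupport k B → p = 0 := by
  -- Shrink `B` to a basis `B'` modulo the initial ideal. It still spans modulo `I`, so a monomial
  -- of `B` outside `B'` would produce a nonzero element of `I` supported on `B`; hence nothing was
  -- removed.
  obtain ⟨B', hB', hind', hsp'⟩ := exists_standard_subset (initialIdeal w I) B
  have hsp2 : ∀ p ∈ restrictSupport k (expDeg δ e), ∃ s ∈ restrictSupport k B',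
      p - s ∈ initialIdeal w I := by
    intro p hp
    obtain ⟨s, hs, h1⟩ := hsp p hp
    obtain ⟨t, ht, h2⟩ := hsp' s hs
    refine ⟨t, ht, ?_⟩
    have := Ideal.add_mem _ h1 h2
    rwa [sub_add_sub_cancel] at this
  have hBB : B ⊆ B' := by
    intro β hβ
    obtain ⟨s, hs, h1⟩ := exists_standard_of_initialIdeal hδ hI (hB'.trans hB) hsp2
      (monomial β 1) ((monomial_mem_restrictSupport k).2 (Or.inl (hB hβ)))
    have h2 := hind _ h1 (Submodule.sub_mem _ ((monomial_mem_restrictSupport k).2 (Or.inl hβ))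
      (restrictSupport_mono k hB' hs))
    rw [← sub_eq_zero.1 h2] at hs
    exact ((monomial_mem_restrictSupport k).1 hs).resolve_right one_ne_zero
  intro p hp hpB
  exact hind' p hp (restrictSupport_mono k hBB hpB)

/-- A homogeneous ideal `K` contained in a homogeneous ideal `L` is equal to it if they have a
common set of standard monomials. -/
theorem eq_of_le_of_standard {K L : Ideal (MvPolynomial τ k)} (hKL : K ≤ L)
    (hL : IsDegHomogeneous δ L)
    (h : ∀ e, ∃ B : Set (τ →₀ ℕ), (∀ p ∈ restrictSupport k (expDeg δ e),
      ∃ s ∈ restrictSupport k B, p - s ∈ K) ∧ ∀ p ∈ L, p ∈ restrictSupport k B → p = 0) :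
    K = L := by
  refine le_antisymm hKL fun p hp => ?_
  refine mem_of_restr_fiber_mem (Finsupp.weight δ) fun e => ?_
  change restr (expDeg δ e) p ∈ K
  obtain ⟨B, h1, h2⟩ := h e
  obtain ⟨s, hs, hsK⟩ := h1 _ (restr_mem (expDeg δ e) p)
  have hsL : s ∈ L := by
    have := L.sub_mem (hL p hp e) (hKL hsK)
    rwa [sub_sub_cancel] at this
  rwa [h2 s hsL hs, sub_zero] at hsK

/-- This plays the role of equality of Hilbert functions. A standard set for the smaller initial
ideal spans modulo the larger one and is independent modulo `I`, hence is also independent modulo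
the larger one. -/
theorem initialIdeal_eq_of_le [Finite τ] (hδ : ∀ j, 0 < δ j) {I : Ideal (MvPolynomial τ k)}
    (hI : IsDegHomogeneous δ I) {w w' : τ → ℤ} (h : initialIdeal w I ≤ initialIdeal w' I) :
    initialIdeal w I = initialIdeal w' I := by
  refine eq_of_le_of_standard h (hI.initialIdeal w') fun e => ?_
  obtain ⟨B, hB, hind, hsp⟩ := exists_standard_subset (initialIdeal w I) (expDeg δ e)
  refine ⟨B, hsp, initialIdeal_eq_zero_of_span hδ hI hB (fun p hp => ?_)
    (eq_zero_of_initialIdeal hind)⟩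
  obtain ⟨s, hs, h1⟩ := hsp p hp
  exact ⟨s, hs, h h1⟩

/-- Two weights with the same initial ideal have a common adapted basis of monomials. -/
theorem exists_mem_inter_expGE [Finite τ] (hδ : ∀ j, 0 < δ j) {I : Ideal (MvPolynomial τ k)}
    (hI : IsDegHomogeneous δ I) {w w' : τ → ℤ} (h : initialIdeal w I = initialIdeal w' I) {e : ℕ}
    {q q' : ℤ} {p p' : MvPolynomial τ k}
    (hp : p ∈ restrictSupport k (expDeg δ e ∩ expGE w q))
    (hp' : p' ∈ restrictSupport k (expDeg δ e ∩ expGE w' q')) (hpp : p - p' ∈ I) :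
    ∃ s ∈ restrictSupport k (expDeg δ e ∩ (expGE w q ∩ expGE w' q')), p - s ∈ I := by
  -- One basis is adapted to both filtrations. Each bound yields an expansion in it, and the two
  -- expansions coincide by independence modulo `I`.
  obtain ⟨B, hB, hind, hsp⟩ := exists_standard_subset (initialIdeal w I) (expDeg δ e)
  obtain ⟨s, hs, h1⟩ := exists_standard_expGE hδ hI hB hsp q
    (restrictSupport_mono k Set.inter_subset_left hp)
    (restrictSupport_mono k Set.inter_subset_right hp)
  obtain ⟨s', hs', h2⟩ := exists_standard_expGE hδ hI hB (h ▸ hsp) q'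
    (restrictSupport_mono k Set.inter_subset_left hp')
    (restrictSupport_mono k Set.inter_subset_right hp')
  have h3 : s - s' ∈ I := by
    have := I.add_mem (I.sub_mem hpp h1) h2
    have e1 : p - p' - (p - s) + (p' - s') = s - s' := by ring
    rwa [e1] at this
  have h4 := eq_zero_of_initialIdeal hind _ h3 (Submodule.sub_mem _
    (restrictSupport_mono k Set.inter_subset_left hs)
    (restrictSupport_mono k Set.inter_subset_left hs'))
  rw [sub_eq_zero] at h4
  refine ⟨s, mem_restrictSupport'.2 fun α hα => ?_, h1⟩
  have m1 := mem_restrictSupport'.1 hs α hα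
  have m2 := mem_restrictSupport'.1 (h4 ▸ hs') α hα
  exact ⟨hB m1.1, m1.2, m2.2⟩

theorem rename_mem_range {κ : Type*} (f : κ → τ) (h : MvPolynomial κ k) :
    rename f h ∈ restrictSupport k (Set.range (Finsupp.mapDomain (M := ℕ) f)) := by
  refine mem_restrictSupport'.2 fun α hα => ?_
  obtain ⟨u, hu, -⟩ := coeff_rename_ne_zero f h α hα
  exact ⟨u, hu⟩

/-- If every variable is congruent modulo `K` to a polynomial in a subfamily of the variables,
then there are standard monomials in this subfamily. -/
theorem exists_standard_subfamily {κ : Type*} (f : κ → τ) {K : Ideal (MvPolynomial τ k)}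
    (hK : IsDegHomogeneous δ K)
    (h : ∀ j, ∃ p : MvPolynomial κ k, X j - rename f p ∈ K) (e : ℕ) :
    ∃ B ⊆ expDeg δ e ∩ Set.range (Finsupp.mapDomain (M := ℕ) f),
      (∀ p ∈ K, p ∈ restrictSupport k B → p = 0) ∧
      ∀ p ∈ restrictSupport k (expDeg δ e), ∃ s ∈ restrictSupport k B, p - s ∈ K := by
  have h1 : ∀ p : MvPolynomial τ k, ∃ g : MvPolynomial κ k, p - rename f g ∈ K := by
    intro p
    induction p using MvPolynomial.induction_on with
    | C a => exact ⟨C a, by simp⟩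
    | add p q hp hq =>
      obtain ⟨g, hg⟩ := hp
      obtain ⟨g', hg'⟩ := hq
      refine ⟨g + g', ?_⟩
      have := K.add_mem hg hg'
      rw [map_add]
      ring_nf at this ⊢
      exact this
    | mul_X p j hp =>
      obtain ⟨g, hg⟩ := hp
      obtain ⟨g', hg'⟩ := h j
      refine ⟨g * g', ?_⟩
      have := K.add_mem (K.mul_mem_right (X j) hg) (K.mul_mem_left (rename f g) hg')
      rw [map_mul]
      ring_nf at this ⊢
      exact this
  obtain ⟨B, hB, hind, hsp⟩ := exists_standard_subset K
    (expDeg δ e ∩ Set.range (Finsupp.mapDomain (M := ℕ) f))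
  refine ⟨B, hB, hind, fun p hp => ?_⟩
  obtain ⟨g, hg⟩ := h1 p
  have h2 := hK _ hg e
  rw [map_sub, restr_eq_self hp] at h2
  obtain ⟨s, hs, h3⟩ := hsp (restr (expDeg δ e) (rename f g)) (by
    rw [Set.inter_comm]
    exact restr_mem_inter (rename_mem_range f g))
  refine ⟨s, hs, ?_⟩
  have := K.add_mem h2 h3
  rwa [sub_add_sub_cancel] at this

end StandardMonomials

/-! ### Initial ideals under inclusions of variables. -/

section Rename

variable {k : Type*} [Field k] {τ κ : Type*}

theorem restr_monomial_of_mem {T : Set (τ →₀ ℕ)} {α : τ →₀ ℕ} (h : α ∈ T) (c : k) :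
    restr T (monomial α c) = monomial α c :=
  restr_eq_self ((monomial_mem_restrictSupport k).2 (Or.inl h))

theorem restr_monomial_of_notMem {T : Set (τ →₀ ℕ)} {α : τ →₀ ℕ} (h : α ∉ T) (c : k) :
    restr T (monomial α c) = 0 :=
  restr_eq_zero (S := {α}) ((monomial_mem_restrictSupport k).2 (Or.inl rfl)) (by simpa using h)

theorem restr_rename (f : κ → τ) (T : Set (τ →₀ ℕ)) (p : MvPolynomial κ k) :
    restr T (rename f p) = rename f (restr (Finsupp.mapDomain f ⁻¹' T) p) := by
  induction p using MvPolynomial.induction_on' with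
  | monomial α c =>
    rw [rename_monomial]
    by_cases h : α.mapDomain f ∈ T
    · rw [restr_monomial_of_mem h, restr_monomial_of_mem (T := Finsupp.mapDomain f ⁻¹' T) h,
        rename_monomial]
    · rw [restr_monomial_of_notMem h,
        restr_monomial_of_notMem (T := Finsupp.mapDomain f ⁻¹' T) h, map_zero]
  | add p q hp hq => rw [map_add, map_add, map_add, map_add, hp, hq]

theorem restr_expEQ_rename (f : κ → τ) (w : τ → ℤ) (q : ℤ) (p : MvPolynomial κ k) :
    restr (expEQ w q) (rename f p) = rename f (restr (expEQ (w ∘ f) q) p) := by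
  have h : Finsupp.mapDomain f ⁻¹' expEQ w q = expEQ (w ∘ f) q := by
    ext α
    simp [expWeight_mapDomain]
  rw [restr_rename, h]

theorem rename_mem_expGE {f : κ → τ} {w : τ → ℤ} {q : ℤ} {p : MvPolynomial κ k}
    (hp : p ∈ restrictSupport k (expGE (w ∘ f) q)) :
    rename f p ∈ restrictSupport k (expGE w q) := by
  refine mem_restrictSupport'.2 fun α hα => ?_
  obtain ⟨u, rfl, hu⟩ := coeff_rename_ne_zero f p α hα
  have := mem_restrictSupport'.1 hp u hu
  simpa [expWeight_mapDomain] using this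

theorem rename_mem_initialIdeal {f : κ → τ} {I : Ideal (MvPolynomial κ k)}
    {J : Ideal (MvPolynomial τ k)} (hIJ : ∀ p ∈ I, rename f p ∈ J) {w : τ → ℤ}
    {p : MvPolynomial κ k} (hp : p ∈ initialIdeal (w ∘ f) I) :
    rename f p ∈ initialIdeal w J := by
  rw [mem_initialIdeal_iff] at hp ⊢
  intro q
  obtain ⟨g, hg, hgq, hg2⟩ := hp q
  exact ⟨rename f g, hIJ g hg, rename_mem_expGE hgq, by
    rw [restr_expEQ_rename, hg2, restr_expEQ_rename]⟩

end Rename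

/-! ### Weight filtrations, their initial ideals, and redundant generators. -/

section Filtrations

variable {k : Type*} [Field k] {A : Type*} [CommRing A] [Algebra k A] {τ κ : Type*}

theorem mem_relationIdeal {b : τ → A} {p : MvPolynomial τ k} :
    p ∈ relationIdeal k b ↔ aeval b p = 0 := Iff.rfl

theorem rename_mem_relationIdeal {b : τ → A} {f : κ → τ} {p : MvPolynomial κ k} :
    rename f p ∈ relationIdeal k b ↔ p ∈ relationIdeal k (b ∘ f) := by
  rw [mem_relationIdeal, mem_relationIdeal, aeval_rename]

theorem aeval_monomial_one (b : τ → A) (α : τ →₀ ℕ) :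
    aeval b (monomial α (1 : k)) = α.prod fun j e => b j ^ e := by
  rw [aeval_monomial, map_one, one_mul]

variable (k) in
/-- The span of the monomials in the elements `b` whose exponents lie in `T`. -/
noncomputable def monSpan (b : τ → A) (T : Set (τ →₀ ℕ)) : Submodule k A :=
  (restrictSupport k T).map (aeval b : MvPolynomial τ k →ₐ[k] A).toLinearMap

theorem mem_monSpan {b : τ → A} {T : Set (τ →₀ ℕ)} {a : A} :
    a ∈ monSpan k b T ↔ ∃ p ∈ restrictSupport k T, aeval b p = a := Iff.rfl

theorem aeval_mem_monSpan {b : τ → A} {T : Set (τ →₀ ℕ)} {p : MvPolynomial τ k}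
    (hp : p ∈ restrictSupport k T) : aeval b p ∈ monSpan k b T := ⟨p, hp, rfl⟩

theorem monSpan_mono (b : τ → A) {S T : Set (τ →₀ ℕ)} (h : S ⊆ T) :
    monSpan k b S ≤ monSpan k b T := Submodule.map_mono (restrictSupport_mono k h)

theorem weightFiltration_eq (b : τ → A) (w : τ → ℤ) (q : ℤ) :
    weightFiltration b w q = monSpan k b (expGE w q) := by
  rw [monSpan, restrictSupport_eq_span, Submodule.map_span, weightFiltration]
  congr 1
  ext a
  simp only [Set.mem_image, exists_exists_and_eq_and, mem_expGE]
  constructor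
  · rintro ⟨α, hα, rfl⟩
    exact ⟨α, hα, aeval_monomial_one b α⟩
  · rintro ⟨α, hα, rfl⟩
    exact ⟨α, hα, aeval_monomial_one b α⟩

theorem mem_weightFiltration {b : τ → A} {w : τ → ℤ} {q : ℤ} {a : A} :
    a ∈ weightFiltration (k := k) b w q ↔
      ∃ p ∈ restrictSupport k (expGE w q), aeval b p = a := by
  rw [weightFiltration_eq, mem_monSpan]

theorem expGE_anti (w : τ → ℤ) {q q' : ℤ} (h : q ≤ q') : expGE w q' ⊆ expGE w q := by
  intro α hα
  simp only [mem_expGE] at *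
  omega

theorem weightFiltration_anti (b : τ → A) (w : τ → ℤ) {q q' : ℤ} (h : q ≤ q') :
    weightFiltration (k := k) b w q' ≤ weightFiltration b w q := by
  rw [weightFiltration_eq, weightFiltration_eq]
  exact monSpan_mono b (expGE_anti w h)

theorem prod_mem_weightFiltration {b : τ → A} {w : τ → ℤ} {c : κ → A} {u : κ → ℤ}
    (h : ∀ j, c j ∈ weightFiltration (k := k) b w (u j)) (α : κ →₀ ℕ) :
    (α.prod fun j e => c j ^ e) ∈ weightFiltration (k := k) b w (expWeight u α) := by
  classical
  induction α using Finsupp.induction_linear with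
  | zero => simpa using one_mem_weightFiltration b w
  | add α β hα hβ =>
    rw [Finsupp.prod_add_index' (by simp) (by intros; rw [pow_add]), expWeight_add]
    exact mul_mem_weightFiltration hα hβ
  | single j e =>
    rw [Finsupp.prod_single_index (by simp), expWeight_single]
    induction e with
    | zero => simpa using one_mem_weightFiltration b w
    | succ e ih =>
      have := mul_mem_weightFiltration ih (h j)
      rwa [pow_succ, Nat.cast_add_one, add_one_mul]

theorem weightFiltration_le {b : τ → A} {w : τ → ℤ} {c : κ → A} {u : κ → ℤ}
    (h : ∀ j, c j ∈ weightFiltration (k := k) b w (u j)) (q : ℤ) :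
    weightFiltration (k := k) c u q ≤ weightFiltration b w q := by
  rw [weightFiltration, Submodule.span_le]
  rintro _ ⟨α, hα, rfl⟩
  exact weightFiltration_anti b w hα (prod_mem_weightFiltration h α)

theorem self_mem_weightFiltration (b : τ → A) (w : τ → ℤ) (j : τ) :
    b j ∈ weightFiltration (k := k) b w (w j) :=
  mem_weightFiltration.2 ⟨X j, (monomial_mem_restrictSupport k).2 (Or.inl (by simp)), aeval_X _ _⟩

theorem weightFiltration_comp_le (b : τ → A) (w : τ → ℤ) (f : κ → τ) (q : ℤ) :
    weightFiltration (k := k) (b ∘ f) (w ∘ f) q ≤ weightFiltration b w q :=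
  weightFiltration_le (fun j => self_mem_weightFiltration b w (f j)) q

theorem weightFiltration_comp_eq {b : τ → A} {w : τ → ℤ} {f : κ → τ}
    (h : ∀ j, b j ∈ weightFiltration (k := k) (b ∘ f) (w ∘ f) (w j)) (q : ℤ) :
    weightFiltration (k := k) b w q = weightFiltration (b ∘ f) (w ∘ f) q :=
  le_antisymm (weightFiltration_le h q) (weightFiltration_comp_le b w f q)

/-- A polynomial whose class has larger weight than the polynomial itself. -/
theorem restr_mem_initialIdeal_of_aeval_mem {b : τ → A} {w : τ → ℤ} {q : ℤ}
    {p : MvPolynomial τ k} (hp : p ∈ restrictSupport k (expGE w q))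
    (h : aeval b p ∈ weightFiltration (k := k) b w (q + 1)) :
    restr (expEQ w q) p ∈ initialIdeal w (relationIdeal k b) := by
  -- Subtracting a representative of weight at least `q + 1` gives a relation whose component of
  -- weight `q` is that of `p`.
  obtain ⟨g, hg, hge⟩ := mem_weightFiltration.1 h
  have h1 : p - g ∈ relationIdeal k b := by
    rw [mem_relationIdeal, map_sub, hge, sub_self]
  have h2 := restr_mem_initialIdeal (w := w) (q := q) h1
    (Submodule.sub_mem _ hp (restrictSupport_mono k (expGE_anti w (by omega)) hg))
  rwa [map_sub, restr_eq_zero hg, sub_zero] at h2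
  intro α h3 h4
  simp only [mem_expGE, mem_expEQ] at *
  omega

/-- Converse to `restr_mem_initialIdeal_of_aeval_mem`: the weight-homogeneous elements of the
initial ideal are exactly those whose value exceeds their weight, so the initial ideal is the ideal
of relations of the associated graded ring. -/
theorem aeval_mem_of_mem_initialIdeal {b : τ → A} {w : τ → ℤ} {q : ℤ}
    {p : MvPolynomial τ k} (hp : p ∈ initialIdeal w (relationIdeal k b))
    (hq : p ∈ restrictSupport k (expEQ w q)) :
    aeval b p ∈ weightFiltration (k := k) b w (q + 1) := by
  obtain ⟨g, hg, hgq, hg2⟩ := mem_initialIdeal_iff.1 hp q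
  refine mem_weightFiltration.2 ⟨p - g, ?_, ?_⟩
  · exact sub_mem_expGE_succ (restrictSupport_mono k (expEQ_subset_expGE w q) hq) hgq hg2.symm
  · rw [map_sub, mem_relationIdeal.1 hg, sub_zero]

theorem X_mem_expEQ (w : τ → ℤ) (j : τ) : (X j : MvPolynomial τ k) ∈
    restrictSupport k (expEQ w (w j)) :=
  (monomial_mem_restrictSupport k).2 (Or.inl (by simp))

/-- Redundancy of `b j` for the filtration becomes a congruence modulo the initial ideal: take the
component of weight `w j` of the relation that expresses `b j` through the subfamily. -/
theorem exists_X_sub_rename_mem_initialIdeal {b : τ → A} {w : τ → ℤ} {f : κ → τ} {j : τ}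
    (h : b j ∈ weightFiltration (k := k) (b ∘ f) (w ∘ f) (w j)) :
    ∃ p : MvPolynomial κ k, X j - rename f p ∈ initialIdeal w (relationIdeal k b) := by
  obtain ⟨p, hp, hpe⟩ := mem_weightFiltration.1 h
  refine ⟨restr (expEQ (w ∘ f) (w j)) p, ?_⟩
  have h1 : X j - rename f p ∈ relationIdeal k b := by
    rw [mem_relationIdeal, map_sub, aeval_X, aeval_rename, hpe, sub_self]
  have h2 := restr_mem_initialIdeal (w := w) (q := w j) h1 (Submodule.sub_mem _
    (restrictSupport_mono k (expEQ_subset_expGE _ _) (X_mem_expEQ w j)) (rename_mem_expGE hp))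
  rwa [map_sub, restr_expEQ_rename, restr_eq_self (X_mem_expEQ w j)] at h2

/-- Whether the filtration is generated by a subfamily depends only on the initial ideal. -/
theorem mem_weightFiltration_comp_of_initialIdeal_eq [Finite τ] {δ : τ → ℕ} (hδ : ∀ j, 0 < δ j)
    {b : τ → A} (hI : IsDegHomogeneous δ (relationIdeal k b)) {w w' : τ → ℤ}
    (hw : initialIdeal w (relationIdeal k b) = initialIdeal w' (relationIdeal k b)) {f : κ → τ}
    (h : ∀ j, b j ∈ weightFiltration (k := k) (b ∘ f) (w ∘ f) (w j)) (j : τ) :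
    b j ∈ weightFiltration (k := k) (b ∘ f) (w' ∘ f) (w' j) := by
  -- Standard monomials can be chosen in the variables of the subfamily. They serve `w'` as well,
  -- and expanding `X j` in them gives the required expression of `b j`.
  obtain ⟨B, hB, -, hsp⟩ := exists_standard_subfamily f (hI.initialIdeal w)
    (fun j => exists_X_sub_rename_mem_initialIdeal (h j)) (δ j)
  rw [hw] at hsp
  obtain ⟨s, hs, hsI⟩ := exists_standard_expGE hδ hI (hB.trans Set.inter_subset_left) hsp (w' j)
    (p := X j) ((monomial_mem_restrictSupport k).2 (Or.inl (by simp [Finsupp.weight_single])))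
    (restrictSupport_mono k (expEQ_subset_expGE _ _) (X_mem_expEQ w' j))
  rw [mem_relationIdeal, map_sub, aeval_X, sub_eq_zero] at hsI
  have h1 : b j ∈ monSpan k b (B ∩ expGE w' (w' j)) := ⟨s, hs, hsI.symm⟩
  have h2 : monSpan k b (B ∩ expGE w' (w' j)) ≤
      weightFiltration (b ∘ f) (w' ∘ f) (w' j) := by
    rw [monSpan, restrictSupport_eq_span, Submodule.map_span, Submodule.span_le]
    rintro _ ⟨_, ⟨α, ⟨hα1, hα2⟩, rfl⟩, rfl⟩
    obtain ⟨γ, rfl⟩ := (hB hα1).2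
    refine mem_weightFiltration.2 ⟨monomial γ 1,
      (monomial_mem_restrictSupport k).2 (Or.inl ?_), ?_⟩
    · simpa [expWeight_mapDomain] using hα2
    · change _ = aeval b (monomial _ _)
      rw [← rename_monomial, aeval_rename]
  exact h2 h1

/-- Elimination of variables that do not contribute to the filtration. -/
theorem mem_initialIdeal_of_rename_mem {b : τ → A} {w : τ → ℤ} {f : κ → τ}
    (h : ∀ j, b j ∈ weightFiltration (k := k) (b ∘ f) (w ∘ f) (w j)) {p : MvPolynomial κ k}
    (hp : rename f p ∈ initialIdeal w (relationIdeal k b)) :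
    p ∈ initialIdeal (w ∘ f) (relationIdeal k (b ∘ f)) := by
  refine mem_of_restr_fiber_mem (expWeight (w ∘ f)) fun q => ?_
  change restr (expEQ (w ∘ f) q) p ∈ _
  have h1 := restr_expEQ_mem_initialIdeal hp q
  -- The detour through values eliminates the extra variables: the gain in value is the same in both
  -- filtrations, since these coincide.
  have h2 := aeval_mem_of_mem_initialIdeal h1 (restr_mem _ _)
  rw [restr_expEQ_rename, aeval_rename, weightFiltration_comp_eq h] at h2
  have h3 := restr_mem_initialIdeal_of_aeval_mem
    (restrictSupport_mono k (expEQ_subset_expGE _ _) (restr_mem (expEQ (w ∘ f) q) p)) h2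
  rwa [restr_restr, Set.inter_self] at h3

end Filtrations

/-! ### The grading of the symmetric algebra and homogeneity of the relations. -/

section SymmetricAlgebra

variable {k : Type*} [Field k] {E : Type*} [AddCommGroup E] [Module k E] {τ : Type*}

variable (k E) in
/-- The homomorphism `a ↦ a T^e` on elements of degree `e`. -/
noncomputable def gradingHom : SymmetricAlgebra k E →ₐ[k] Polynomial (SymmetricAlgebra k E) :=
  SymmetricAlgebra.lift
    ((Polynomial.monomial 1).restrictScalars k ∘ₗ SymmetricAlgebra.ι k E)

theorem gradingHom_of_mem {e : ℕ} {a : SymmetricAlgebra k E}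
    (ha : a ∈ (LinearMap.range (SymmetricAlgebra.ι k E)) ^ e) :
    gradingHom k E a = Polynomial.monomial e a := by
  induction e generalizing a with
  | zero =>
    rw [pow_zero, Submodule.mem_one] at ha
    obtain ⟨c, rfl⟩ := ha
    rw [AlgHom.commutes, Polynomial.monomial_zero_left]
    rfl
  | succ e ih =>
    rw [pow_succ] at ha
    induction ha using Submodule.mul_induction_on' with
    | mem_mul_mem x hx y hy =>
      obtain ⟨z, rfl⟩ := hy
      rw [map_mul, ih hx, gradingHom, SymmetricAlgebra.lift_ι_apply]
      simp [Polynomial.monomial_mul_monomial]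
    | add x _ y _ hx hy => rw [map_add, map_add, hx, hy]

theorem prod_mem_pow_range {b : τ → SymmetricAlgebra k E} {δ : τ → ℕ}
    (hb : ∀ j, b j ∈ (LinearMap.range (SymmetricAlgebra.ι k E)) ^ δ j) (α : τ →₀ ℕ) :
    (α.prod fun j e => b j ^ e) ∈
      (LinearMap.range (SymmetricAlgebra.ι k E)) ^ (Finsupp.weight δ α) := by
  classical
  induction α using Finsupp.induction_linear with
  | zero => simp
  | add α β hα hβ =>
    rw [Finsupp.prod_add_index' (by simp) (by intros; rw [pow_add]), map_add, pow_add]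
    exact Submodule.mul_mem_mul hα hβ
  | single j e =>
    rw [Finsupp.prod_single_index (by simp), Finsupp.weight_single, smul_eq_mul, mul_comm,
      pow_mul]
    exact Submodule.pow_mem_pow _ (hb j) e

theorem aeval_mem_pow_range {b : τ → SymmetricAlgebra k E} {δ : τ → ℕ}
    (hb : ∀ j, b j ∈ (LinearMap.range (SymmetricAlgebra.ι k E)) ^ δ j) {e : ℕ}
    {p : MvPolynomial τ k} (hp : p ∈ restrictSupport k (expDeg δ e)) :
    aeval b p ∈ (LinearMap.range (SymmetricAlgebra.ι k E)) ^ e := by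
  rw [p.as_sum, map_sum]
  refine Submodule.sum_mem _ fun α hα => ?_
  have h1 := mem_restrictSupport'.1 hp α (mem_support_iff.1 hα)
  rw [mem_expDeg] at h1
  rw [aeval_monomial, ← Algebra.smul_def, ← h1]
  exact Submodule.smul_mem _ _ (prod_mem_pow_range hb α)

/-- The left side depends only on the element, so the components of an element of `Sym(E)` can be
computed from any polynomial representing it. This substitutes for a direct sum decomposition. -/
theorem coeff_gradingHom_aeval {b : τ → SymmetricAlgebra k E} {δ : τ → ℕ}
    (hb : ∀ j, b j ∈ (LinearMap.range (SymmetricAlgebra.ι k E)) ^ δ j) (e : ℕ)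
    (p : MvPolynomial τ k) :
    (gradingHom k E (aeval b p)).coeff e = aeval b (restr (expDeg δ e) p) := by
  induction p using MvPolynomial.induction_on' with
  | monomial α c =>
    have h1 : (monomial α c : MvPolynomial τ k) ∈
        restrictSupport k (expDeg δ (Finsupp.weight δ α)) :=
      (monomial_mem_restrictSupport k).2 (Or.inl (by simp))
    rw [gradingHom_of_mem (aeval_mem_pow_range hb h1), Polynomial.coeff_monomial]
    by_cases h : Finsupp.weight δ α = e
    · rw [if_pos h, restr_monomial_of_mem (by simpa using h)]
    · rw [if_neg h, restr_monomial_of_notMem (by simpa using h), map_zero]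
  | add p q hp hq => simp only [map_add, Polynomial.coeff_add, hp, hq]

theorem isDegHomogeneous_relationIdeal {b : τ → SymmetricAlgebra k E} {δ : τ → ℕ}
    (hb : ∀ j, b j ∈ (LinearMap.range (SymmetricAlgebra.ι k E)) ^ δ j) :
    IsDegHomogeneous δ (relationIdeal k b) := by
  intro p hp e
  rw [mem_relationIdeal] at *
  rw [← coeff_gradingHom_aeval hb, hp, map_zero, Polynomial.coeff_zero]

theorem aeval_restr_of_mem_pow {b : τ → SymmetricAlgebra k E} {δ : τ → ℕ}
    (hb : ∀ j, b j ∈ (LinearMap.range (SymmetricAlgebra.ι k E)) ^ δ j) {e : ℕ}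
    {p : MvPolynomial τ k}
    (hp : aeval b p ∈ (LinearMap.range (SymmetricAlgebra.ι k E)) ^ e) :
    aeval b (restr (expDeg δ e) p) = aeval b p := by
  rw [← coeff_gradingHom_aeval hb, gradingHom_of_mem hp, Polynomial.coeff_monomial, if_pos rfl]

end SymmetricAlgebra

/-! ### Tropical points and diagrams in terms of initial ideals. -/

section Tropical

variable {k : Type*} [Field k] {A : Type*} [CommRing A] [Algebra k A] {τ : Type*}

theorem monomial_mem_initialIdeal_iff {b : τ → A} {w : τ → ℤ} {α : τ →₀ ℕ} :
    monomial α (1 : k) ∈ initialIdeal w (relationIdeal k b) ↔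
      (α.prod fun j e => b j ^ e) ∈ weightFiltration (k := k) b w (expWeight w α + 1) := by
  rw [← aeval_monomial_one (k := k)]
  have h : monomial α (1 : k) ∈ restrictSupport k (expEQ w (expWeight w α)) :=
    (monomial_mem_restrictSupport k).2 (Or.inl (by simp))
  constructor
  · exact fun h1 => aeval_mem_of_mem_initialIdeal h1 h
  · intro h1
    have := restr_mem_initialIdeal_of_aeval_mem
      (restrictSupport_mono k (expEQ_subset_expGE _ _) h) h1
    rwa [restr_eq_self h] at this

/-- A monomial whose value exceeds its weight yields a relation in which that monomial is the unique
minimal term. Conversely, dividing a relation with a unique minimal term by its coefficient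
expresses that monomial through larger weights. -/
theorem mem_tropicalVariety_iff {c : τ → A} {u : τ → ℤ} :
    u ∈ tropicalVariety (relationIdeal k c) ↔
      ∀ α : τ →₀ ℕ, (α.prod fun j e => c j ^ e) ∉
        weightFiltration (k := k) c u (expWeight u α + 1) := by
  classical
  constructor
  · intro hu α hα
    obtain ⟨p, hp, hpe⟩ := mem_weightFiltration.1 hα
    have hp' := mem_restrictSupport'.1 hp
    have h1 : monomial α 1 - p ∈ relationIdeal k c := by
      rw [mem_relationIdeal, map_sub, aeval_monomial_one, hpe, sub_self]
    have h2 : coeff α p = 0 := by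
      by_contra h
      have := hp' α h
      simp only [mem_expGE] at this
      omega
    obtain ⟨β, hβ, hne, hle⟩ := hu _ h1 α (by
      rw [mem_support_iff, coeff_sub, coeff_monomial, if_pos rfl, h2, sub_zero]
      exact one_ne_zero)
    rw [mem_support_iff, coeff_sub, coeff_monomial, if_neg hne.symm, zero_sub, neg_ne_zero] at hβ
    have := hp' β hβ
    simp only [mem_expGE] at this
    omega
  · intro h p hp α hα
    by_contra hc
    push Not at hc
    apply h α
    rw [mem_support_iff] at hα
    refine mem_weightFiltration.2 ⟨monomial α 1 - (coeff α p)⁻¹ • p, ?_, ?_⟩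
    · refine mem_restrictSupport'.2 fun β hβ => ?_
      rw [coeff_sub, coeff_smul, coeff_monomial, smul_eq_mul] at hβ
      have hne : β ≠ α := by
        rintro rfl
        rw [if_pos rfl, inv_mul_cancel₀ hα, sub_self] at hβ
        exact hβ rfl
      rw [if_neg hne.symm, zero_sub, neg_ne_zero] at hβ
      have := hc β (mem_support_iff.2 (right_ne_zero_of_mul hβ)) hne
      simp only [mem_expGE]
      omega
    · rw [map_sub, map_smul, mem_relationIdeal.1 hp, smul_zero, sub_zero, aeval_monomial_one]

variable {E : Type*} [AddCommGroup E] [Module k E] {d : ℕ}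

/-- The index set of the linear part of `b`. -/
abbrev LinearIndex (b : Fin d → SymmetricAlgebra k E) : Type :=
  {j : Fin d // b j ∈ LinearMap.range (SymmetricAlgebra.ι k E)}

/-- Removes the existential over `u`: tropicality forces `u` to be the restriction of `w` to the
linear part. -/
theorem mem_tropStar_iff {b : Fin d → SymmetricAlgebra k E} {w : Fin d → ℤ} :
    w ∈ tropStar b ↔
      (∀ j, b j ∈ weightFiltration (k := k) (linearPart b) (w ∘ Subtype.val) (w j)) ∧
      (∀ j, b j ∉ weightFiltration (k := k) (linearPart b) (w ∘ Subtype.val) (w j + 1)) ∧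
      ∀ α : LinearIndex b →₀ ℕ, (α.prod fun j e => linearPart b j ^ e) ∉
        weightFiltration (k := k) (linearPart b) (w ∘ Subtype.val)
          (expWeight (w ∘ Subtype.val) α + 1) := by
  constructor
  · rintro ⟨u, hu, hw⟩
    have hu' := mem_tropicalVariety_iff.1 hu
    -- The value of a linear generator is at least its weight, and tropicality applied to a single
    -- variable excludes a strict gain.
    have e : u = w ∘ Subtype.val := by
      funext j
      have h1 : u j ≤ w j := (hw j).2 (self_mem_weightFiltration (linearPart b) u j)
      by_contra hne
      have h2 : u j + 1 ≤ w j := by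
        have : u j ≠ w j := hne
        omega
      have h3 := hu' (Finsupp.single j 1)
      rw [Finsupp.prod_single_index (by simp), pow_one, expWeight_single, Nat.cast_one,
        one_mul] at h3
      exact h3 (weightFiltration_anti _ _ h2 (hw j).1)
    subst e
    refine ⟨fun j => (hw j).1, fun j hj => ?_, hu'⟩
    have := (hw j).2 hj
    omega
  · rintro ⟨h1, h2, h3⟩
    refine ⟨w ∘ Subtype.val, mem_tropicalVariety_iff.2 h3, fun j => ⟨h1 j, fun s hs => ?_⟩⟩
    by_contra hlt
    exact h2 j (weightFiltration_anti _ _ (by omega) hs)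

theorem weightFiltration_linearPart {b : Fin d → SymmetricAlgebra k E} {w : Fin d → ℤ}
    (hw : w ∈ tropStar b) (q : ℤ) :
    weightFiltration (k := k) b w q =
      weightFiltration (linearPart b) (w ∘ Subtype.val) q :=
  weightFiltration_comp_eq (f := (Subtype.val : LinearIndex b → Fin d))
    (mem_tropStar_iff.1 hw).1 q

theorem prod_mapDomain_val (b : Fin d → SymmetricAlgebra k E) (α : LinearIndex b →₀ ℕ) :
    ((α.mapDomain Subtype.val).prod fun j e => b j ^ e) =
      α.prod fun j e => linearPart b j ^ e :=
  Finsupp.prod_mapDomain_index (by simp) (by intros; rw [pow_add])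

/-- Membership in `Trop_⋆` depends only on the initial ideal. -/
theorem mem_tropStar_of_initialIdeal_eq {b : Fin d → SymmetricAlgebra k E} {δ : Fin d → ℕ}
    (hδ : ∀ j, 0 < δ j) (hb : ∀ j, b j ∈ (LinearMap.range (SymmetricAlgebra.ι k E)) ^ δ j)
    {w w' : Fin d → ℤ} (hw : w ∈ tropStar b)
    (h : initialIdeal w (relationIdeal k b) = initialIdeal w' (relationIdeal k b)) :
    w' ∈ tropStar b := by
  have hw2 := mem_tropStar_iff.1 hw
  -- A gain in value of a monomial for `w'` puts the monomial into the common initial ideal, so it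
  -- also gains value for `w`. Both negative conditions for `w'` follow by contraposition; the
  -- linear filtration and the full one agree for `w`, while for `w'` only an inclusion is needed.
  have key : ∀ α : Fin d →₀ ℕ,
      (α.prod fun j e => b j ^ e) ∈ weightFiltration (k := k) (linearPart b)
        (w' ∘ Subtype.val) (expWeight w' α + 1) →
      (α.prod fun j e => b j ^ e) ∈ weightFiltration (k := k) (linearPart b)
        (w ∘ Subtype.val) (expWeight w α + 1) := by
    intro α hα
    rw [← weightFiltration_linearPart hw, ← monomial_mem_initialIdeal_iff, h,
      monomial_mem_initialIdeal_iff]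
    exact weightFiltration_comp_le b w' (Subtype.val : LinearIndex b → Fin d) _ hα
  refine mem_tropStar_iff.2 ⟨?_, ?_, ?_⟩
  · exact mem_weightFiltration_comp_of_initialIdeal_eq
      (f := (Subtype.val : LinearIndex b → Fin d)) hδ (isDegHomogeneous_relationIdeal hb) h hw2.1
  · intro j hj
    have := key (Finsupp.single j 1) (by simpa using hj)
    exact hw2.2.1 j (by simpa using this)
  · intro α hα
    have := key (α.mapDomain Subtype.val) (by
      rw [prod_mapDomain_val, expWeight_mapDomain]
      exact hα)
    rw [prod_mapDomain_val, expWeight_mapDomain] at this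
    exact hw2.2.2 α this

/-- Whether a matrix is a diagram depends only on the initial ideals of its rows. -/
theorem mem_diagrams_of_initialIdeal_eq {m n : ℕ} {fan : SmoothFan m n}
    {b : Fin d → SymmetricAlgebra k E} {δ : Fin d → ℕ}
    (hδ : ∀ j, 0 < δ j) (hb : ∀ j, b j ∈ (LinearMap.range (SymmetricAlgebra.ι k E)) ^ δ j)
    {D D' : Matrix (Fin n) (Fin d) ℤ} (hD : D ∈ diagrams fan b)
    (h : ∀ i, initialIdeal (D i) (relationIdeal k b) = initialIdeal (D' i) (relationIdeal k b)) :
    D' ∈ diagrams fan b := by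
  refine ⟨fun i => mem_tropStar_of_initialIdeal_eq hδ hb (hD.1 i) (h i), fun S hS => ?_⟩
  obtain ⟨w₀, hw₀, hf⟩ := hD.2 S hS
  refine ⟨w₀, hw₀, fun i hi => ?_⟩
  have := hf i hi
  simp only [groebnerFace, Set.mem_ofPred_eq] at this ⊢
  rwa [← h i]

end Tropical

/-! ### Multihomogenization, and dependence of the strong Khovanskii property on initial ideals. -/

section StrongKhovanskii

variable {k : Type*} [Field k] {A : Type*} [CommRing A] [Algebra k A] {n d : ℕ}

/-- The exponents whose weight with respect to the `i`-th row is at least `r i` for all `i`. -/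
def expRows (D : Matrix (Fin n) (Fin d) ℤ) (r : Fin n → ℤ) : Set (Fin d →₀ ℕ) :=
  {α | ∀ i, r i ≤ expWeight (D i) α}

/-- The exponent of the variables `Y`. -/
noncomputable def yPart (γ : Fin n ⊕ Fin d →₀ ℕ) : Fin d →₀ ℕ :=
  (Finsupp.sumFinsuppAddEquivProdFinsupp γ).2

theorem yPart_add (γ γ' : Fin n ⊕ Fin d →₀ ℕ) : yPart (γ + γ') = yPart γ + yPart γ' := by
  ext j
  rfl

@[simp] theorem yPart_apply (γ : Fin n ⊕ Fin d →₀ ℕ) (j : Fin d) : yPart γ j = γ (Sum.inr j) :=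
  rfl

@[simp] theorem yPart_sumElim (a : Fin n →₀ ℕ) (α : Fin d →₀ ℕ) :
    yPart (Finsupp.sumElim a α) = α := by
  ext j
  simp

/-- The multidegree of a monomial in `k[X, Y]`. -/
noncomputable def multiDeg (D : Matrix (Fin n) (Fin d) ℤ) (γ : Fin n ⊕ Fin d →₀ ℕ) :
    Fin n → ℤ :=
  fun i => expWeight (D i) (yPart γ) - γ (Sum.inl i)

theorem multiDeg_add (D : Matrix (Fin n) (Fin d) ℤ) (γ γ' : Fin n ⊕ Fin d →₀ ℕ) :
    multiDeg D (γ + γ') = multiDeg D γ + multiDeg D γ' := by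
  funext i
  simp only [multiDeg, yPart_add, expWeight_add, Finsupp.add_apply, Pi.add_apply]
  push_cast
  ring

variable (k n d) in
/-- The substitution `X = 1`. -/
noncomputable def setXOne : MvPolynomial (Fin n ⊕ Fin d) k →ₐ[k] MvPolynomial (Fin d) k :=
  aeval (Sum.elim (fun _ => 1) X)

theorem setXOne_monomial (γ : Fin n ⊕ Fin d →₀ ℕ) (c : k) :
    setXOne k n d (monomial γ c) = monomial (yPart γ) c := by
  rw [setXOne, aeval_monomial, MvPolynomial.algebraMap_eq, monomial_eq (s := yPart γ)]
  congr 1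
  rw [Finsupp.prod_fintype _ _ (by simp), Finsupp.prod_fintype _ _ (by simp)]
  simp

theorem coxPresentation_monomial (b : Fin d → A) (D : Matrix (Fin n) (Fin d) ℤ)
    (γ : Fin n ⊕ Fin d →₀ ℕ) (c : k) :
    coxPresentation k b D (monomial γ c) =
      AddMonoidAlgebra.single (multiDeg D γ) (aeval b (monomial (yPart γ) c)) := by
  have h1 : ∀ γ : Fin n ⊕ Fin d →₀ ℕ, coxPresentation k b D (monomial γ 1) =
      AddMonoidAlgebra.single (multiDeg D γ) (aeval b (monomial (yPart γ) (1 : k))) := by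
    intro γ
    induction γ using Finsupp.induction_linear with
    | zero =>
      have e1 : multiDeg D 0 = 0 := by
        funext i
        simp [multiDeg, yPart]
      have e2 : yPart (0 : Fin n ⊕ Fin d →₀ ℕ) = 0 := by simp [yPart]
      rw [e1, e2, monomial_zero', monomial_zero', C_1, C_1, map_one, map_one]
      rfl
    | add γ γ' h h' =>
      have e3 : ∀ (σ : Type) (α β : σ →₀ ℕ),
          monomial (α + β) (1 : k) = monomial α 1 * monomial β 1 := by
        intro σ α β
        rw [monomial_mul, one_mul]
      rw [e3, map_mul, h, h', multiDeg_add, yPart_add, e3, map_mul,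
        AddMonoidAlgebra.single_mul_single]
    | single s e =>
      have e0 : coxPresentation k b D (X s) = _ := aeval_X _ _
      rw [← X_pow_eq_monomial, map_pow, e0]
      have e4 : ∀ (r : Fin n → ℤ) (a : A), (AddMonoidAlgebra.single r a) ^ e =
          AddMonoidAlgebra.single (e • r) (a ^ e) := by
        intro r a
        rw [AddMonoidAlgebra.single_pow]
      rcases s with i | j
      · have e5 : yPart (Finsupp.single (Sum.inl i : Fin n ⊕ Fin d) e) = 0 := by
          ext j
          simp
        rw [e5, Sum.elim_inl, e4, one_pow, monomial_zero', C_1, map_one]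
        congr 1
        funext i'
        simp only [multiDeg, e5, expWeight_zero]
        by_cases h : i = i'
        · subst h
          simp
        · have h2 : (Sum.inl i : Fin n ⊕ Fin d) ≠ Sum.inl i' := by simpa using h
          simp [Ne.symm h, Finsupp.single_eq_of_ne' h2]
      · have e5 : yPart (Finsupp.single (Sum.inr j : Fin n ⊕ Fin d) e) = Finsupp.single j e := by
          ext j'
          simp [Finsupp.single_apply]
        rw [e5, Sum.elim_inr, e4, ← X_pow_eq_monomial, map_pow, aeval_X]
        congr 1
        funext i'
        simp [multiDeg, e5]
  have h2 : ∀ (σ : Type) (α : σ →₀ ℕ), monomial α c = c • monomial α (1 : k) := by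
    intro σ α
    rw [smul_monomial, smul_eq_mul, mul_one]
  rw [h2, map_smul, h1, h2 _ (yPart γ), map_smul, AddMonoidAlgebra.smul_single]

theorem coeff_coxPresentation (b : Fin d → A) (D : Matrix (Fin n) (Fin d) ℤ)
    (f : MvPolynomial (Fin n ⊕ Fin d) k) (r : Fin n → ℤ) :
    (coxPresentation k b D f).coeff r =
      aeval b (setXOne k n d (restr {γ | multiDeg D γ = r} f)) := by
  induction f using MvPolynomial.induction_on' with
  | monomial γ c =>
    rw [coxPresentation_monomial, AddMonoidAlgebra.coeff_single]
    by_cases h : multiDeg D γ = r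
    · rw [restr_monomial_of_mem (by simpa using h), setXOne_monomial, h, Finsupp.single_eq_same]
    · rw [restr_monomial_of_notMem (by simpa using h), map_zero, map_zero,
        Finsupp.single_eq_of_ne' h]
  | add p q hp hq =>
    simp only [map_add, AddMonoidAlgebra.coeff_add, Finsupp.add_apply, hp, hq]

theorem mem_coxIdeal_iff {b : Fin d → A} {D : Matrix (Fin n) (Fin d) ℤ}
    {f : MvPolynomial (Fin n ⊕ Fin d) k} :
    f ∈ coxIdeal k b D ↔
      ∀ r, setXOne k n d (restr {γ | multiDeg D γ = r} f) ∈ relationIdeal k b := by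
  have h0 : f ∈ coxIdeal k b D ↔ coxPresentation k b D f = 0 := Iff.rfl
  rw [h0]
  constructor
  · intro h r
    rw [mem_relationIdeal, ← coeff_coxPresentation, h, AddMonoidAlgebra.coeff_zero]
    rfl
  · intro h
    ext r
    rw [coeff_coxPresentation, mem_relationIdeal.1 (h r), AddMonoidAlgebra.coeff_zero]
    rfl

/-- The exponent of the monomial of multidegree `r` with `Y`-exponent `α`. -/
noncomputable def homogExp (D : Matrix (Fin n) (Fin d) ℤ) (r : Fin n → ℤ) (α : Fin d →₀ ℕ) :
    Fin n ⊕ Fin d →₀ ℕ :=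
  Finsupp.sumElim (Finsupp.equivFunOnFinite.symm fun i => (expWeight (D i) α - r i).toNat) α

@[simp] theorem yPart_homogExp (D : Matrix (Fin n) (Fin d) ℤ) (r : Fin n → ℤ)
    (α : Fin d →₀ ℕ) : yPart (homogExp D r α) = α := by
  simp [homogExp]

@[simp] theorem homogExp_inl (D : Matrix (Fin n) (Fin d) ℤ) (r : Fin n → ℤ)
    (α : Fin d →₀ ℕ) (i : Fin n) :
    homogExp D r α (Sum.inl i) = (expWeight (D i) α - r i).toNat := by
  simp [homogExp]

/-- The hypothesis makes the truncation in `homogExp` harmless: the differences of weights and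
bounds are nonnegative. -/
theorem multiDeg_homogExp {D : Matrix (Fin n) (Fin d) ℤ} {r : Fin n → ℤ} {α : Fin d →₀ ℕ}
    (h : α ∈ expRows D r) : multiDeg D (homogExp D r α) = r := by
  funext i
  have := h i
  simp only [multiDeg, yPart_homogExp, homogExp_inl]
  omega

/-- The homogenization of multidegree `r` of a polynomial in the variables `Y`. -/
noncomputable def homog (D : Matrix (Fin n) (Fin d) ℤ) (r : Fin n → ℤ) :
    MvPolynomial (Fin d) k →ₗ[k] MvPolynomial (Fin n ⊕ Fin d) k :=
  (basisMonomials (Fin d) k).constr k fun α => monomial (homogExp D r α) 1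

theorem homog_monomial (D : Matrix (Fin n) (Fin d) ℤ) (r : Fin n → ℤ) (α : Fin d →₀ ℕ) (c : k) :
    homog D r (monomial α c) = monomial (homogExp D r α) c := by
  have h := (basisMonomials (Fin d) k).constr_basis k
    (fun α => monomial (homogExp D r α) (1 : k)) α
  rw [coe_basisMonomials] at h
  have h1 : monomial α c = c • monomial α (1 : k) := by rw [smul_monomial, smul_eq_mul, mul_one]
  rw [h1, map_smul, homog, h, smul_monomial, smul_eq_mul, mul_one]

theorem homog_apply (D : Matrix (Fin n) (Fin d) ℤ) (r : Fin n → ℤ) (p : MvPolynomial (Fin d) k) :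
    homog D r p = ∑ α ∈ p.support, monomial (homogExp D r α) (coeff α p) := by
  conv_lhs => rw [p.as_sum, map_sum]
  exact Finset.sum_congr rfl fun α _ => homog_monomial D r α _

theorem coxPresentation_homog (b : Fin d → A) {D : Matrix (Fin n) (Fin d) ℤ} {r : Fin n → ℤ}
    {p : MvPolynomial (Fin d) k} (hp : p ∈ restrictSupport k (expRows D r)) :
    coxPresentation k b D (homog D r p) = AddMonoidAlgebra.single r (aeval b p) := by
  conv_rhs => rw [p.as_sum]
  rw [homog_apply, map_sum, map_sum]
  change _ = AddMonoidAlgebra.singleAddHom r _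
  rw [map_sum]
  refine Finset.sum_congr rfl fun α hα => ?_
  rw [coxPresentation_monomial, yPart_homogExp,
    multiDeg_homogExp (mem_restrictSupport'.1 hp α (mem_support_iff.1 hα))]
  rfl

theorem setXOne_homog (D : Matrix (Fin n) (Fin d) ℤ) (r : Fin n → ℤ)
    (p : MvPolynomial (Fin d) k) : setXOne k n d (homog D r p) = p := by
  conv_rhs => rw [p.as_sum]
  rw [homog_apply, map_sum]
  refine Finset.sum_congr rfl fun α _ => ?_
  rw [setXOne_monomial, yPart_homogExp]

theorem coxPresentation_range_le (b : Fin d → A) (D : Matrix (Fin n) (Fin d) ℤ) :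
    (coxPresentation k b D).range ≤ totalSectionRing k b D := by
  rintro _ ⟨f, rfl⟩ r i
  change (coxPresentation k b D f).coeff r ∈ _
  rw [coeff_coxPresentation]
  refine mem_weightFiltration.2 ⟨_, ?_, rfl⟩
  have : ∀ g : MvPolynomial (Fin n ⊕ Fin d) k,
      g ∈ restrictSupport k {γ | multiDeg D γ = r} →
      setXOne k n d g ∈ restrictSupport k (expGE (D i) (r i)) := by
    intro g hg
    rw [g.as_sum, map_sum]
    refine Submodule.sum_mem _ fun γ hγ => ?_
    have h1 := mem_restrictSupport'.1 hg γ (mem_support_iff.1 hγ)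
    rw [setXOne_monomial]
    refine (monomial_mem_restrictSupport k).2 (Or.inl ?_)
    have h2 : multiDeg D γ i = r i := congrFun h1 i
    simp only [multiDeg] at h2
    simp only [mem_expGE]
    omega
  exact this _ (restr_mem _ _)

/-- Separate bounds on the values for the rows must be witnessed by one polynomial whose monomials
satisfy all of them. Such a polynomial homogenizes to a preimage of `a t^r`, and conversely the
multidegree-`r` component of a preimage is of this kind. -/
theorem isStrongKhovanskiiBasis_iff {b : Fin d → A} {D : Matrix (Fin n) (Fin d) ℤ} :
    IsStrongKhovanskiiBasis k b D ↔
      ∀ (r : Fin n → ℤ) (a : A), (∀ i, a ∈ weightFiltration (k := k) b (D i) (r i)) →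
        a ∈ monSpan k b (expRows D r) := by
  constructor
  · intro h r a ha
    have h1 : AddMonoidAlgebra.single r a ∈ totalSectionRing k b D := by
      intro r' i
      rw [AddMonoidAlgebra.coeff_single, Finsupp.single_apply]
      split_ifs with hr
      · subst hr
        exact ha i
      · exact Submodule.zero_mem _
    rw [← h] at h1
    obtain ⟨f, hf⟩ := h1
    have h2 : a = aeval b (setXOne k n d (restr {γ | multiDeg D γ = r} f)) := by
      rw [← coeff_coxPresentation]
      have hf' : coxPresentation k b D f = AddMonoidAlgebra.single r a := hf
      rw [hf', AddMonoidAlgebra.coeff_single, Finsupp.single_eq_same]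
    rw [h2]
    refine aeval_mem_monSpan ?_
    have : ∀ g : MvPolynomial (Fin n ⊕ Fin d) k,
        g ∈ restrictSupport k {γ | multiDeg D γ = r} →
        setXOne k n d g ∈ restrictSupport k (expRows D r) := by
      intro g hg
      rw [g.as_sum, map_sum]
      refine Submodule.sum_mem _ fun γ hγ => ?_
      have h1 := mem_restrictSupport'.1 hg γ (mem_support_iff.1 hγ)
      rw [setXOne_monomial]
      refine (monomial_mem_restrictSupport k).2 (Or.inl fun i => ?_)
      have h2 : multiDeg D γ i = r i := congrFun h1 i
      simp only [multiDeg] at h2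
      omega
    exact this _ (restr_mem _ _)
  · intro h
    refine le_antisymm (coxPresentation_range_le b D) fun x hx => ?_
    rw [← AddMonoidAlgebra.sum_coeff_single x]
    refine Subalgebra.sum_mem _ fun r _ => ?_
    obtain ⟨p, hp, hpe⟩ := mem_monSpan.1 (h r _ (hx r))
    exact ⟨homog D r p, by
      rw [← hpe]
      exact coxPresentation_homog b hp⟩

variable {δ : Fin d → ℕ}

variable (k) in
/-- The property of a strong Khovanskii basis in each degree. -/
def IsStrongKhovanskiiInDegrees (δ : Fin d → ℕ) (b : Fin d → A) (D : Matrix (Fin n) (Fin d) ℤ) :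
    Prop :=
  ∀ (e : ℕ) (r : Fin n → ℤ) (a : A), (∀ i, a ∈ monSpan k b (expDeg δ e ∩ expGE (D i) (r i))) →
    a ∈ monSpan k b (expDeg δ e ∩ expRows D r)

/-- The row `i₀` is needed: without rows the degreewise hypothesis on `a` is empty and does not
force `a` into degree `e`. -/
theorem isStrongKhovanskiiBasis_iff_inDegrees {b : Fin d → A}
    (hI : IsDegHomogeneous δ (relationIdeal k b)) {D : Matrix (Fin n) (Fin d) ℤ} (i₀ : Fin n) :
    IsStrongKhovanskiiBasis k b D ↔ IsStrongKhovanskiiInDegrees k δ b D := by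
  rw [isStrongKhovanskiiBasis_iff]
  have hrestr : ∀ {p g : MvPolynomial (Fin d) k}, aeval b p = aeval b g → ∀ e,
      aeval b (restr (expDeg δ e) p) = aeval b (restr (expDeg δ e) g) := by
    intro p g hpg e
    have := hI (p - g) (by rw [mem_relationIdeal, map_sub, hpg, sub_self]) e
    rwa [map_sub, mem_relationIdeal, map_sub, sub_eq_zero] at this
  constructor
  · intro h e r a ha
    obtain ⟨p, hp, hpe⟩ := mem_monSpan.1 (h r a fun i => by
      rw [weightFiltration_eq]
      exact monSpan_mono b Set.inter_subset_right (ha i))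
    obtain ⟨g, hg, hge⟩ := mem_monSpan.1 (ha i₀)
    have h1 := hrestr (hpe.trans hge.symm) e
    rw [restr_eq_self (restrictSupport_mono k Set.inter_subset_left hg), hge] at h1
    rw [← h1, Set.inter_comm]
    exact aeval_mem_monSpan (restr_mem_inter hp)
  · intro h r a ha
    obtain ⟨p, hp, rfl⟩ := mem_weightFiltration.1 (ha i₀)
    refine map_mem_of_restr_fiber_mem (Finsupp.weight δ) (aeval b).toLinearMap fun e => ?_
    refine monSpan_mono b Set.inter_subset_right (h e r _ fun i => ?_)
    obtain ⟨g, hg, hge⟩ := mem_weightFiltration.1 (ha i)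
    change aeval b (restr (expDeg δ e) p) ∈ _
    rw [hrestr hge.symm e, Set.inter_comm]
    exact aeval_mem_monSpan (restr_mem_inter hg)

/-- The element is corrected step by step along the old filtration of row `i₀`: its lowest part that
obeys the new bound is split off, and the part that violates it is a relation up to higher weight,
because both rows have the same initial ideal. -/
theorem IsStrongKhovanskiiInDegrees.replace_row (hδ : ∀ j, 0 < δ j) {b : Fin d → A}
    (hI : IsDegHomogeneous δ (relationIdeal k b)) {D D' : Matrix (Fin n) (Fin d) ℤ} {i₀ : Fin n}
    (hne : ∀ i, i ≠ i₀ → D' i = D i)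
    (h : initialIdeal (D i₀) (relationIdeal k b) = initialIdeal (D' i₀) (relationIdeal k b))
    (hD : IsStrongKhovanskiiInDegrees k δ b D) : IsStrongKhovanskiiInDegrees k δ b D' := by
  classical
  intro e r a ha
  have key := le_of_le_sup_succ (k := k)
    (V := fun q => monSpan k b (expDeg δ e ∩ expGE (D i₀) q) ⊓
      ⨅ i, monSpan k b (expDeg δ e ∩ expGE (D' i) (r i)))
    (Z := fun _ => monSpan k b (expDeg δ e ∩ expRows D' r)) ?_ (fun _ _ _ => le_rfl) ?_
  -- The induction starts at a lower bound for all old weights in degree `e`, where the extra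
  -- condition on `a` is void.
  · obtain ⟨Q, hQ⟩ := exists_lt_expWeight hδ (D i₀) e
    refine key Q (Submodule.mem_inf.2 ⟨?_, Submodule.mem_iInf _ |>.2 ha⟩)
    refine monSpan_mono b ?_ (ha i₀)
    rintro α ⟨h1, -⟩
    exact ⟨h1, (hQ α h1).le⟩
  · obtain ⟨Q, hQ⟩ := exists_expWeight_lt hδ (D i₀) e
    refine ⟨Q, fun q hq => ?_⟩
    rw [eq_bot_iff]
    refine inf_le_left.trans ?_
    rw [monSpan, restrictSupport_eq_bot, Submodule.map_bot]
    rintro α ⟨h1, h2⟩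
    have := hQ α h1
    simp only [mem_expGE] at h2
    omega
  · intro q a ha
    obtain ⟨ha1, ha2⟩ := Submodule.mem_inf.1 ha
    rw [Submodule.mem_iInf] at ha2
    -- The property of `D` is used with the bound of row `i₀` replaced by the current old weight
    -- `q`.
    obtain ⟨p, hp, hpa⟩ := mem_monSpan.1 (hD e (Function.update r i₀ q) a fun i => by
      by_cases hi : i = i₀
      · subst hi
        simpa using ha1
      · rw [Function.update_of_ne hi, ← hne i hi]
        exact ha2 i)
    have hpq : p ∈ restrictSupport k (expDeg δ e ∩ expGE (D i₀) q) := by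
      refine restrictSupport_mono k ?_ hp
      rintro α ⟨h1, h2⟩
      exact ⟨h1, by simpa using h2 i₀⟩
    have hpd := restrictSupport_mono k Set.inter_subset_left hpq
    have hpq' := restrictSupport_mono k Set.inter_subset_right hpq
    obtain ⟨p', hp', hpa'⟩ := mem_monSpan.1 (ha2 i₀)
    obtain ⟨s, hs, hsI⟩ := exists_mem_inter_expGE hδ hI h hpq hp'
      (by rw [mem_relationIdeal, map_sub, hpa, hpa', sub_self])
    have hsq : s ∈ restrictSupport k (expGE (D i₀) q) :=
      restrictSupport_mono k (fun α hα => hα.2.1) hs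
    have hsq' : s ∈ restrictSupport k {α | r i₀ ≤ expWeight (D' i₀) α} :=
      restrictSupport_mono k (fun α hα => hα.2.2) hs
    -- The component of old weight `q` of `p - s` lies in the common initial ideal, which is graded
    -- by the new weight too. Since `s` has no terms below the new bound, the part of this component
    -- below it comes from `p` alone, and it lifts to an element `g` of the ideal.
    have h1 := restr_mem_initialIdeal hsI (Submodule.sub_mem _ hpq' hsq)
    rw [h] at h1
    have h2 := restr_preimage_mem_initialIdeal h1 {t | t < r i₀}
    rw [map_sub, map_sub, restr_eq_zero (restr_mem_of_mem (expEQ (D i₀) q) hsq') (by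
      intro α h1 h2
      simp only [Set.mem_ofPred_eq] at h1 h2
      omega), sub_zero, ← h] at h2
    obtain ⟨g, hg, hgd, hgq, hg2⟩ := exists_lift_of_mem_initialIdeal hI h2
      (restr_mem_of_mem _ (restr_mem_of_mem _ hpd)) q
    -- The part of lowest old weight that meets the new bound. The remainder, after subtracting `g`,
    -- has old weight at least `q + 1`.
    set p₁ := restr (expEQ (D i₀) q ∩ expGE (D' i₀) (r i₀)) p with hp₁
    have hp₁mem : p₁ ∈ restrictSupport k (expDeg δ e ∩ expRows D' r) := by
      refine restrictSupport_mono k ?_ (restr_mem_inter hp)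
      rintro α ⟨⟨h1, h2⟩, -, h3⟩
      refine ⟨h1, fun i => ?_⟩
      by_cases hi : i = i₀
      · subst hi
        exact h3
      · have := h2 i
        rwa [Function.update_of_ne hi, ← hne i hi] at this
    have e1 : aeval b p₁ + (a - aeval b p₁) = a := by ring
    rw [← e1]
    refine Submodule.add_mem_sup (aeval_mem_monSpan hp₁mem) (Submodule.mem_inf.2 ⟨?_, ?_⟩)
    · refine mem_monSpan.2 ⟨p - p₁ - g, ?_, ?_⟩
      · have h3 : p - p₁ - g ∈ restrictSupport k (expDeg δ e) :=
          Submodule.sub_mem _ (Submodule.sub_mem _ hpd (restr_mem_of_mem _ hpd)) hgd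
        have h4 : p - p₁ - g ∈ restrictSupport k (expGE (D i₀) (q + 1)) := by
          refine sub_mem_expGE_succ
            (Submodule.sub_mem _ hpq' (restr_mem_of_mem _ hpq')) hgq ?_
          rw [hg2]
          ext α
          simp only [hp₁, map_sub, coeff_sub, coeff_restr, Set.mem_inter_iff, mem_expEQ,
            mem_expGE, Set.mem_ofPred_eq]
          by_cases h5 : expWeight (D i₀) α = q
          · by_cases h6 : expWeight (D' i₀) α < r i₀
            · simp [h5, h6, not_le.2 h6]
            · simp [h5, h6, not_lt.1 h6]
          · simp [h5]
        exact mem_restrictSupport'.2 fun α hα =>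
          ⟨mem_restrictSupport'.1 h3 α hα, mem_restrictSupport'.1 h4 α hα⟩
      · rw [map_sub, map_sub, hpa, mem_relationIdeal.1 hg, sub_zero]
    · refine (Submodule.mem_iInf _).2 fun i => Submodule.sub_mem _ (ha2 i) ?_
      refine monSpan_mono b ?_ (aeval_mem_monSpan hp₁mem)
      rintro α ⟨h1, h2⟩
      exact ⟨h1, h2 i⟩

/-- Whether `b` is a strong Khovanskii basis depends only on the initial ideals of the rows. -/
theorem IsStrongKhovanskiiBasis.of_initialIdeal_eq (hδ : ∀ j, 0 < δ j) {b : Fin d → A}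
    (hI : IsDegHomogeneous δ (relationIdeal k b)) {D D' : Matrix (Fin n) (Fin d) ℤ}
    (h : ∀ i, initialIdeal (D i) (relationIdeal k b) = initialIdeal (D' i) (relationIdeal k b))
    (hD : IsStrongKhovanskiiBasis k b D) : IsStrongKhovanskiiBasis k b D' := by
  classical
  rcases isEmpty_or_nonempty (Fin n) with hn | ⟨⟨i₀⟩⟩
  · have : D' = D := by
      funext i
      exact hn.elim i
    rwa [this]
  rw [isStrongKhovanskiiBasis_iff_inDegrees hI i₀] at hD ⊢
  -- The rows are exchanged one at a time.
  have key : ∀ S : Finset (Fin n),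
      IsStrongKhovanskiiInDegrees k δ b (fun i => if i ∈ S then D' i else D i) := by
    intro S
    induction S using Finset.induction_on with
    | empty => simpa using hD
    | insert i S hi ih =>
      refine ih.replace_row (i₀ := i) hδ hI (fun i' hi' => ?_) ?_
      · simp [hi']
      · simpa [hi] using h i
  simpa using key Finset.univ

end StrongKhovanskii

/-! ### Good cones are polyhedral, and initial ideals are constant on them. -/

section GoodCones

variable {k : Type*} [Field k] {n d : ℕ}

theorem expWeight_liftWeight (w : Fin d → ℤ) (γ : Fin n ⊕ Fin d →₀ ℕ) :
    expWeight (liftWeight n w) γ = expWeight w (yPart γ) := by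
  simp only [expWeight, Finsupp.weight_apply]
  rw [Finsupp.sum_fintype _ _ (by simp), Finsupp.sum_fintype _ _ (by simp)]
  simp [liftWeight]

theorem setXOne_restr (w : Fin d → ℤ) (q : ℤ) (f : MvPolynomial (Fin n ⊕ Fin d) k) :
    setXOne k n d (restr (expEQ (liftWeight n w) q) f) = restr (expEQ w q) (setXOne k n d f) := by
  induction f using MvPolynomial.induction_on' with
  | monomial γ c =>
    rw [setXOne_monomial]
    by_cases h : expWeight w (yPart γ) = q
    · rw [restr_monomial_of_mem (by simpa [expWeight_liftWeight] using h),
        restr_monomial_of_mem (by simpa using h), setXOne_monomial]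
    · rw [restr_monomial_of_notMem (by simpa [expWeight_liftWeight] using h),
        restr_monomial_of_notMem (by simpa using h), map_zero]
  | add p q hp hq => simp only [map_add, hp, hq]

theorem setXOne_mem_expGE {w : Fin d → ℤ} {q : ℤ} {f : MvPolynomial (Fin n ⊕ Fin d) k}
    (hf : f ∈ restrictSupport k (expGE (liftWeight n w) q)) :
    setXOne k n d f ∈ restrictSupport k (expGE w q) := by
  rw [f.as_sum, map_sum]
  refine Submodule.sum_mem _ fun γ hγ => ?_
  have h1 := mem_restrictSupport'.1 hf γ (mem_support_iff.1 hγ)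
  rw [mem_expGE, expWeight_liftWeight] at h1
  rw [setXOne_monomial]
  exact (monomial_mem_restrictSupport k).2 (Or.inl h1)

theorem coeff_homog {D : Matrix (Fin n) (Fin d) ℤ} {r : Fin n → ℤ} {p : MvPolynomial (Fin d) k}
    {γ : Fin n ⊕ Fin d →₀ ℕ} (h : coeff γ (homog D r p) ≠ 0) :
    coeff (yPart γ) p ≠ 0 ∧ γ = homogExp D r (yPart γ) := by
  classical
  rw [homog_apply, coeff_sum] at h
  obtain ⟨α, hα, h1⟩ := Finset.exists_ne_zero_of_sum_ne_zero h
  rw [coeff_monomial] at h1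
  have h2 : homogExp D r α = γ := by
    by_contra hc
    exact h1 (if_neg hc)
  subst h2
  rw [yPart_homogExp]
  exact ⟨mem_support_iff.1 hα, rfl⟩

theorem homog_mem_expGE {D : Matrix (Fin n) (Fin d) ℤ} (r : Fin n → ℤ) {w : Fin d → ℤ} {q : ℤ}
    {p : MvPolynomial (Fin d) k} (hp : p ∈ restrictSupport k (expGE w q)) :
    homog D r p ∈ restrictSupport k (expGE (liftWeight n w) q) := by
  refine mem_restrictSupport'.2 fun γ hγ => ?_
  rw [mem_expGE, expWeight_liftWeight]
  exact mem_restrictSupport'.1 hp _ (coeff_homog hγ).1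

variable {A : Type*} [CommRing A] [Algebra k A]

theorem homog_mem_coxIdeal {b : Fin d → A} {D : Matrix (Fin n) (Fin d) ℤ} {r : Fin n → ℤ}
    {p : MvPolynomial (Fin d) k} (hp : p ∈ restrictSupport k (expRows D r))
    (hI : p ∈ relationIdeal k b) : homog D r p ∈ coxIdeal k b D := by
  change coxPresentation k b D (homog D r p) = 0
  rw [coxPresentation_homog b hp, mem_relationIdeal.1 hI, AddMonoidAlgebra.single_zero]

theorem setXOne_mem_relationIdeal {b : Fin d → A} {D : Matrix (Fin n) (Fin d) ℤ}
    {f : MvPolynomial (Fin n ⊕ Fin d) k} (hf : f ∈ coxIdeal k b D) :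
    setXOne k n d f ∈ relationIdeal k b :=
  map_mem_of_restr_fiber_mem (multiDeg D) (setXOne k n d).toLinearMap
    (Z := (relationIdeal k b).restrictScalars k) (mem_coxIdeal_iff.1 hf)

/-- The weight `s(w)` ignores the variables `X`, so `X = 1` commutes with taking weight components.
Only initial forms of `F` have to be compared, since those at `D` generate the whole initial ideal
of `𝓘_𝓑`. Equality follows later from `initialIdeal_eq_of_le`. -/
theorem IsGoodGeneratingSet.initialIdeal_le {b : Fin d → A} {D D' : Matrix (Fin n) (Fin d) ℤ}
    {F : Finset (MvPolynomial (Fin n ⊕ Fin d) k)} (hF : IsGoodGeneratingSet b D F) {i : Fin n}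
    (h : ∀ f ∈ F, initialForm (liftWeight n (D' i)) f = initialForm (liftWeight n (D i)) f) :
    initialIdeal (D i) (relationIdeal k b) ≤ initialIdeal (D' i) (relationIdeal k b) := by
  have h1 : initialIdeal (liftWeight n (D i)) (coxIdeal k b D) ≤
      (initialIdeal (D' i) (relationIdeal k b)).comap (setXOne k n d) := by
    rw [← hF.span_initial i, Ideal.span_le]
    rintro _ ⟨f, hf, rfl⟩
    change setXOne k n d _ ∈ initialIdeal (D' i) (relationIdeal k b)
    rw [← h f hf]
    have hfJ : f ∈ coxIdeal k b D := by
      rw [← hF.span_eq]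
      exact Ideal.subset_span hf
    by_cases h0 : f = 0
    · rw [h0, initialForm_zero, map_zero]
      exact Ideal.zero_mem _
    obtain ⟨q, hq, hq0⟩ := exists_expWeight_min (liftWeight n (D' i)) h0
    rw [initialForm_eq_restr hq hq0, setXOne_restr]
    exact restr_mem_initialIdeal (setXOne_mem_relationIdeal hfJ) (setXOne_mem_expGE hq)
  rw [initialIdeal, Ideal.span_le]
  rintro _ ⟨p, hp, rfl⟩
  by_cases h0 : p = 0
  · rw [h0, initialForm_zero]
    exact Ideal.zero_mem _
  obtain ⟨q, hq, hq0⟩ := exists_expWeight_min (D i) h0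
  have h2 : ∀ i', ∃ r, p ∈ restrictSupport k (expGE (D i') r) := fun i' => by
    obtain ⟨r, hr, -⟩ := exists_expWeight_min (D i') h0
    exact ⟨r, hr⟩
  choose r hr using h2
  have h3 : p ∈ restrictSupport k (expRows D r) :=
    mem_restrictSupport'.2 fun α hα i' => mem_restrictSupport'.1 (hr i') α hα
  -- Every initial form of a relation is reached, since the relation is the dehomogenization of an
  -- element of `𝓘_𝓑`.
  have h4 := h1 (restr_mem_initialIdeal (homog_mem_coxIdeal h3 hp) (homog_mem_expGE r hq))
  rw [Ideal.mem_comap] at h4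
  rw [setXOne_restr, setXOne_homog] at h4
  rw [initialForm_eq_restr hq hq0]
  exact h4

theorem isPolyhedralCone_univ : IsPolyhedralCone (Set.univ : Set (Matrix (Fin n) (Fin d) ℤ)) :=
  ⟨∅, ∅, by simp⟩

theorem IsPolyhedralCone.inter {C C' : Set (Matrix (Fin n) (Fin d) ℤ)} (h : IsPolyhedralCone C)
    (h' : IsPolyhedralCone C') : IsPolyhedralCone (C ∩ C') := by
  classical
  obtain ⟨P, Q, rfl⟩ := h
  obtain ⟨P', Q', rfl⟩ := h'
  refine ⟨P ∪ P', Q ∪ Q', ?_⟩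
  ext D
  simp only [Set.mem_inter_iff, Set.mem_ofPred_eq, Finset.mem_union, or_imp, forall_and]
  tauto

theorem IsPolyhedralCone.forall_mem {ι : Type*} (s : Finset ι)
    {C : ι → Set (Matrix (Fin n) (Fin d) ℤ)} (h : ∀ x ∈ s, IsPolyhedralCone (C x)) :
    IsPolyhedralCone {D | ∀ x ∈ s, D ∈ C x} := by
  classical
  induction s using Finset.induction_on with
  | empty =>
    convert isPolyhedralCone_univ (n := n) (d := d)
    simp
  | insert x s hx ih =>
    convert (h x (by simp)).inter (ih fun y hy => h y (by simp [hy])) using 1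
    ext D
    simp

theorem expWeight_eq_sum (w : Fin d → ℤ) (α : Fin d →₀ ℕ) :
    expWeight w α = ∑ j, (α j : ℤ) * w j := by
  rw [expWeight, Finsupp.weight_apply, Finsupp.sum_fintype _ _ (by simp)]
  simp

/-- The linear form `D ↦ ⟨Dᵢ, α - β⟩`. -/
def rowForm (i : Fin n) (α β : Fin d →₀ ℕ) : Matrix (Fin n) (Fin d) ℤ :=
  fun i' j => if i' = i then (α j : ℤ) - β j else 0

theorem sum_rowForm (i : Fin n) (α β : Fin d →₀ ℕ) (D : Matrix (Fin n) (Fin d) ℤ) :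
    ∑ i', ∑ j, rowForm i α β i' j * D i' j = expWeight (D i) α - expWeight (D i) β := by
  rw [Finset.sum_eq_single i]
  · simp [rowForm, expWeight_eq_sum, sub_mul]
  · intro i' _ hi'
    simp [rowForm, hi']
  · simp

/-- Prescribing the initial form means that its terms all have the same weight and that the
remaining terms of `f` have strictly larger weight. -/
theorem isPolyhedralCone_initialForm (f : MvPolynomial (Fin n ⊕ Fin d) k)
    (D : Matrix (Fin n) (Fin d) ℤ) (i : Fin n) :
    IsPolyhedralCone {D' : Matrix (Fin n) (Fin d) ℤ |
      initialForm (liftWeight n (D' i)) f = initialForm (liftWeight n (D i)) f} := by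
  classical
  by_cases h0 : f = 0
  · subst h0
    convert isPolyhedralCone_univ (n := n) (d := d)
    simp [initialForm_zero]
  obtain ⟨m, hm, hm0⟩ := exists_expWeight_min (liftWeight n (D i)) h0
  rw [initialForm_eq_restr hm hm0]
  -- A fixed term of the prescribed initial form, with which all other terms are compared.
  obtain ⟨γ, hγ⟩ := MvPolynomial.ne_zero_iff.1 hm0
  have hco : ∀ α, coeff α (restr (expEQ (liftWeight n (D i)) m) f) ≠ 0 →
      coeff α (restr (expEQ (liftWeight n (D i)) m) f) = coeff α f := by
    intro α hα
    rw [coeff_restr] at hα ⊢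
    split_ifs at hα ⊢ with h
    · rfl
    · exact absurd rfl hα
  set g := restr (expEQ (liftWeight n (D i)) m) f with hg
  refine ⟨g.support.image fun α => rowForm i (yPart α) (yPart γ),
    (f.support \ g.support).image fun α => rowForm i (yPart α) (yPart γ), ?_⟩
  ext D'
  simp only [Set.mem_ofPred_eq, Finset.forall_mem_image, sum_rowForm, Finset.mem_sdiff,
    mem_support_iff, ← expWeight_liftWeight, not_not, sub_eq_zero, sub_pos]
  constructor
  · intro h
    obtain ⟨q, hq, hq0⟩ := exists_expWeight_min (liftWeight n (D' i)) h0
    rw [initialForm_eq_restr hq hq0] at h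
    have h1 : ∀ α, coeff α g ≠ 0 → expWeight (liftWeight n (D' i)) α = q := by
      intro α hα
      rw [← h, coeff_restr] at hα
      by_contra hc
      exact hα (if_neg hc)
    refine ⟨fun α hα => by rw [h1 α hα, h1 γ hγ], fun α hα => ?_⟩
    rw [h1 γ hγ]
    refine lt_of_le_of_ne (mem_restrictSupport'.1 hq α hα.1) fun hc => ?_
    have := hα.2
    rw [← h, coeff_restr, if_pos (mem_expEQ.2 hc.symm)] at this
    exact hα.1 this
  · rintro ⟨h1, h2⟩
    have h3 : f ∈ restrictSupport k (expGE (liftWeight n (D' i))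
        (expWeight (liftWeight n (D' i)) γ)) := by
      refine mem_restrictSupport'.2 fun α hα => ?_
      by_cases hαg : coeff α g = 0
      · exact (h2 ⟨hα, hαg⟩).le
      · exact (h1 hαg).ge
    have h4 : restr (expEQ (liftWeight n (D' i)) (expWeight (liftWeight n (D' i)) γ)) f = g := by
      ext α
      rw [coeff_restr, mem_expEQ]
      by_cases hαg : coeff α g = 0
      · rw [hαg]
        split_ifs with h
        · by_contra hα
          exact (h2 ⟨hα, hαg⟩).ne' h
        · rfl
      · rw [if_pos (h1 hαg), hco α hαg]
    rw [initialForm_eq_restr h3 (by rw [h4]; exact hm0), h4]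

theorem IsStrongKhovanskiiBasis.fg {b : Fin d → A} {D : Matrix (Fin n) (Fin d) ℤ}
    (h : IsStrongKhovanskiiBasis k b D) : (totalSectionRing k b D).FG := by
  rw [← h, ← Algebra.map_top]
  exact Subalgebra.FG.map _ Algebra.FiniteType.out

variable {E : Type*} [AddCommGroup E] [Module k E] {m : ℕ}

theorem initialIdeal_eq_of_mem_goodCone {fan : SmoothFan m n} {b : Fin d → SymmetricAlgebra k E}
    {δ : Fin d → ℕ} (hδ : ∀ j, 0 < δ j)
    (hb : ∀ j, b j ∈ (LinearMap.range (SymmetricAlgebra.ι k E)) ^ δ j)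
    {D D' : Matrix (Fin n) (Fin d) ℤ} {F : Finset (MvPolynomial (Fin n ⊕ Fin d) k)}
    (hF : IsGoodGeneratingSet b D F) (hD' : D' ∈ goodCone fan b D F) (i : Fin n) :
    initialIdeal (D i) (relationIdeal k b) = initialIdeal (D' i) (relationIdeal k b) :=
  initialIdeal_eq_of_le hδ (isDegHomogeneous_relationIdeal hb) (hF.initialIdeal_le (hD'.2 i))

/-- The condition of being a diagram, which need not be polyhedral by itself, is implied by the
equalities of initial forms. -/
theorem isPolyhedralCone_goodCone {fan : SmoothFan m n} {b : Fin d → SymmetricAlgebra k E}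
    {δ : Fin d → ℕ} (hδ : ∀ j, 0 < δ j)
    (hb : ∀ j, b j ∈ (LinearMap.range (SymmetricAlgebra.ι k E)) ^ δ j)
    {D : Matrix (Fin n) (Fin d) ℤ} (hD : D ∈ diagrams fan b)
    {F : Finset (MvPolynomial (Fin n ⊕ Fin d) k)} (hF : IsGoodGeneratingSet b D F) :
    IsPolyhedralCone (goodCone fan b D F) := by
  convert IsPolyhedralCone.forall_mem Finset.univ
    (fun i _ => IsPolyhedralCone.forall_mem F fun f _ => isPolyhedralCone_initialForm f D i)
    using 1
  ext D'
  simp only [goodCone, Set.mem_ofPred_eq, Finset.mem_univ, true_implies, and_iff_right_iff_imp]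
  exact fun h => mem_diagrams_of_initialIdeal_eq hδ hb hD fun i =>
    initialIdeal_eq_of_le hδ (isDegHomogeneous_relationIdeal hb) (hF.initialIdeal_le (h i))

end GoodCones

/-! ### Existence of good generating sets through homogenization. -/

section GoodGenerators

variable {k : Type*} [Field k] {n d : ℕ}

theorem restr_congr {τ : Type*} {S T : Set (τ →₀ ℕ)} {p : MvPolynomial τ k}
    (h : ∀ α, coeff α p ≠ 0 → (α ∈ S ↔ α ∈ T)) : restr S p = restr T p := by
  classical
  ext α
  rw [coeff_restr, coeff_restr]
  by_cases h0 : coeff α p = 0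
  · simp [h0]
  · simp [h α h0]

theorem setXZero_eq_restr (i : Fin n) (f : MvPolynomial (Fin n ⊕ Fin d) k) :
    setXZero i f = restr {γ | γ (Sum.inl i) = 0} f := by
  induction f using MvPolynomial.induction_on' with
  | monomial γ c =>
    rw [setXZero, aeval_monomial, MvPolynomial.algebraMap_eq]
    by_cases h : γ (Sum.inl i) = 0
    · rw [restr_monomial_of_mem (by simpa using h), monomial_eq]
      congr 1
      refine Finsupp.prod_congr fun s hs => ?_
      rw [if_neg]
      rintro rfl
      exact Finsupp.mem_support_iff.1 hs h
    · rw [restr_monomial_of_notMem (by simpa using h), Finsupp.prod,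
        Finset.prod_eq_zero (Finsupp.mem_support_iff.2 h), mul_zero]
      rw [if_pos rfl, zero_pow h]
  | add p q hp hq =>
    rw [map_add, ← hp, ← hq]
    exact map_add (aeval _) p q

theorem setXOne_mem_expRows {D : Matrix (Fin n) (Fin d) ℤ} {r : Fin n → ℤ}
    {f : MvPolynomial (Fin n ⊕ Fin d) k} (hf : f ∈ restrictSupport k {γ | multiDeg D γ = r}) :
    setXOne k n d f ∈ restrictSupport k (expRows D r) := by
  rw [f.as_sum, map_sum]
  refine Submodule.sum_mem _ fun γ hγ => ?_
  have h1 := mem_restrictSupport'.1 hf γ (mem_support_iff.1 hγ)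
  rw [setXOne_monomial]
  refine (monomial_mem_restrictSupport k).2 (Or.inl fun i => ?_)
  have h2 : multiDeg D γ i = r i := congrFun h1 i
  simp only [multiDeg] at h2
  omega

theorem homogExp_yPart {D : Matrix (Fin n) (Fin d) ℤ} {r : Fin n → ℤ} {γ : Fin n ⊕ Fin d →₀ ℕ}
    (h : multiDeg D γ = r) : homogExp D r (yPart γ) = γ := by
  ext s
  rcases s with i | j
  · have h2 : multiDeg D γ i = r i := congrFun h i
    simp only [multiDeg] at h2
    rw [homogExp_inl]
    omega
  · rw [← yPart_apply, yPart_homogExp, yPart_apply]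

theorem homog_setXOne {D : Matrix (Fin n) (Fin d) ℤ} {r : Fin n → ℤ}
    {f : MvPolynomial (Fin n ⊕ Fin d) k} (hf : f ∈ restrictSupport k {γ | multiDeg D γ = r}) :
    homog D r (setXOne k n d f) = f := by
  conv_rhs => rw [f.as_sum]
  conv_lhs => rw [f.as_sum, map_sum, map_sum]
  refine Finset.sum_congr rfl fun γ hγ => ?_
  have h1 := mem_restrictSupport'.1 hf γ (mem_support_iff.1 hγ)
  rw [setXOne_monomial, homog_monomial, homogExp_yPart h1]

/-- The exponent of `Xᵢ` is the excess of the weight over the bound, so lowering the bound only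
multiplies by a power of `Xᵢ`. -/
theorem homog_eq_monomial_mul {D : Matrix (Fin n) (Fin d) ℤ} {r r' : Fin n → ℤ} (h : r ≤ r')
    {p : MvPolynomial (Fin d) k} (hp : p ∈ restrictSupport k (expRows D r')) :
    homog D r p = monomial (Finsupp.sumElim
      (Finsupp.equivFunOnFinite.symm fun i => (r' i - r i).toNat) 0) 1 * homog D r' p := by
  rw [homog_apply, homog_apply, Finset.mul_sum]
  refine Finset.sum_congr rfl fun α hα => ?_
  rw [monomial_mul, one_mul]
  refine congrArg (fun γ => monomial γ (coeff α p)) ?_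
  ext s
  rcases s with i | j
  · have h1 : r' i ≤ expWeight (D i) α :=
      mem_restrictSupport'.1 hp α (mem_support_iff.1 hα) i
    have h2 : r i ≤ r' i := h i
    rw [Finsupp.add_apply, homogExp_inl, homogExp_inl]
    simp
    omega
  · simp [← yPart_apply, yPart_add]

theorem exists_minimal_rows (D : Matrix (Fin n) (Fin d) ℤ) {p : MvPolynomial (Fin d) k}
    (hp : p ≠ 0) : ∃ r : Fin n → ℤ, p ∈ restrictSupport k (expRows D r) ∧
      ∀ i, restr (expEQ (D i) (r i)) p ≠ 0 := by
  choose r hr hr0 using fun i => exists_expWeight_min (D i) hp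
  exact ⟨r, mem_restrictSupport'.2 fun α hα i => mem_restrictSupport'.1 (hr i) α hα, hr0⟩

variable {A : Type*} [CommRing A] [Algebra k A]

variable (k) in
/-- The homogenizations of the nonzero elements of the ideal of relations. -/
def homogenizations (b : Fin d → A) (D : Matrix (Fin n) (Fin d) ℤ) :
    Set (MvPolynomial (Fin n ⊕ Fin d) k) :=
  {h | ∃ p ∈ relationIdeal k b, ∃ r : Fin n → ℤ, p ∈ restrictSupport k (expRows D r) ∧
    (∀ i, restr (expEQ (D i) (r i)) p ≠ 0) ∧ h = homog D r p}

theorem mem_expGE_of_mem_expRows {D : Matrix (Fin n) (Fin d) ℤ} {r : Fin n → ℤ}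
    {p : MvPolynomial (Fin d) k} (hp : p ∈ restrictSupport k (expRows D r)) (i : Fin n) :
    p ∈ restrictSupport k (expGE (D i) (r i)) :=
  mem_restrictSupport'.2 fun α hα => mem_restrictSupport'.1 hp α hα i

/-- In a homogenization the exponent of `Xᵢ` is the excess of the weight over `r i`; it vanishes
exactly in the terms of weight `r i`. -/
theorem restr_homog_eq_setXZero {D : Matrix (Fin n) (Fin d) ℤ} {r : Fin n → ℤ}
    {p : MvPolynomial (Fin d) k} (hp : p ∈ restrictSupport k (expRows D r)) (i : Fin n) :
    restr (expEQ (liftWeight n (D i)) (r i)) (homog D r p) = setXZero i (homog D r p) := by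
  rw [setXZero_eq_restr]
  refine restr_congr fun γ hγ => ?_
  obtain ⟨h1, h2⟩ := coeff_homog hγ
  have h3 := mem_restrictSupport'.1 hp _ h1 i
  have h4 : γ (Sum.inl i) = (expWeight (D i) (yPart γ) - r i).toNat := by
    rw [h2, homogExp_inl, yPart_homogExp]
  rw [mem_expEQ, expWeight_liftWeight, Set.mem_ofPred_eq, h4]
  omega

theorem initialForm_homog {D : Matrix (Fin n) (Fin d) ℤ} {r : Fin n → ℤ}
    {p : MvPolynomial (Fin d) k} (hp : p ∈ restrictSupport k (expRows D r)) {i : Fin n}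
    (h : restr (expEQ (D i) (r i)) p ≠ 0) :
    initialForm (liftWeight n (D i)) (homog D r p) = setXZero i (homog D r p) := by
  rw [← restr_homog_eq_setXZero hp]
  refine initialForm_eq_restr (homog_mem_expGE r (mem_expGE_of_mem_expRows hp i)) fun h0 => h ?_
  rw [← setXOne_homog D r p, ← setXOne_restr, h0, map_zero]

/-- Multihomogeneous elements of `𝓘_𝓑` are multiples of homogenizations. -/
theorem exists_homog_of_mem_coxIdeal {b : Fin d → A} {D : Matrix (Fin n) (Fin d) ℤ}
    {f : MvPolynomial (Fin n ⊕ Fin d) k} (hf : f ∈ coxIdeal k b D) (r : Fin n → ℤ)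
    (h0 : restr {γ | multiDeg D γ = r} f ≠ 0) :
    ∃ a : Fin n →₀ ℕ, ∃ p ∈ relationIdeal k b, ∃ r' : Fin n → ℤ,
      p ∈ restrictSupport k (expRows D r') ∧ (∀ i, restr (expEQ (D i) (r' i)) p ≠ 0) ∧
      restr {γ | multiDeg D γ = r} f =
        monomial (Finsupp.sumElim a 0) 1 * homog D r' p := by
  have hp0 : setXOne k n d (restr {γ | multiDeg D γ = r} f) ≠ 0 := by
    intro h
    apply h0
    rw [← homog_setXOne (restr_mem {γ | multiDeg D γ = r} f), h, map_zero]
  obtain ⟨r', hr', hr'0⟩ := exists_minimal_rows D hp0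
  have hr := setXOne_mem_expRows (restr_mem {γ | multiDeg D γ = r} f)
  -- The bounds `r'` are the actual minimal weights of the dehomogenization, so they dominate `r`;
  -- the excess is the monomial in `X` that splits off.
  suffices hle : r ≤ r' by
    have h := homog_eq_monomial_mul hle hr'
    rw [homog_setXOne (restr_mem _ _)] at h
    exact ⟨_, _, mem_coxIdeal_iff.1 hf r, r', hr', hr'0, h⟩
  intro i
  by_contra hlt
  refine hr'0 i (restr_eq_zero hr ?_)
  intro α h1 h2
  have h3 : r i ≤ expWeight (D i) α := h1 i
  rw [mem_expEQ] at h2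
  exact hlt (h2 ▸ h3)

theorem span_homogenizations (b : Fin d → A) (D : Matrix (Fin n) (Fin d) ℤ) :
    Ideal.span (homogenizations k b D) = coxIdeal k b D := by
  refine le_antisymm ?_ fun f hf => ?_
  · rw [Ideal.span_le]
    rintro _ ⟨p, hp, r, hr, -, rfl⟩
    exact homog_mem_coxIdeal hr hp
  · refine mem_of_restr_fiber_mem (multiDeg D) fun r => ?_
    by_cases h0 : restr {γ | multiDeg D γ = r} f = 0
    · rw [h0]
      exact Ideal.zero_mem _
    obtain ⟨a, p, hp, r', hr', hr0, e⟩ := exists_homog_of_mem_coxIdeal hf r h0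
    rw [e]
    exact Ideal.mul_mem_left _ _ (Ideal.subset_span ⟨p, hp, r', hr', hr0, rfl⟩)

/-- The ideal `𝓘_𝓑` has a good generating set. -/
theorem exists_isGoodGeneratingSet (b : Fin d → A) (D : Matrix (Fin n) (Fin d) ℤ) :
    ∃ F : Finset (MvPolynomial (Fin n ⊕ Fin d) k), IsGoodGeneratingSet b D F := by
  -- The finite set is extracted from the homogenizations themselves, so each of its members has the
  -- right initial forms.
  have hfg : (Ideal.span (homogenizations k b D)).FG := IsNoetherian.noetherian _
  obtain ⟨F, hFH, hF⟩ := (Submodule.fg_span_iff_fg_span_finset_subset _).1 hfg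
  have hspan : Ideal.span (F : Set (MvPolynomial (Fin n ⊕ Fin d) k)) = coxIdeal k b D := by
    rw [← span_homogenizations]
    exact hF.symm
  have hinit : ∀ i, ∀ f ∈ F, initialForm (liftWeight n (D i)) f = setXZero i f := by
    intro i f hf
    obtain ⟨p, -, r, hr, hr0, rfl⟩ := hFH hf
    exact initialForm_homog hr (hr0 i)
  refine ⟨F, hspan, fun i => le_antisymm ?_ ?_, hinit⟩
  · refine Ideal.span_mono (Set.image_mono ?_)
    rw [← hspan]
    exact Ideal.subset_span
  · have himage : initialForm (liftWeight n (D i)) ''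
        (F : Set (MvPolynomial (Fin n ⊕ Fin d) k)) = (aeval fun s =>
          if s = Sum.inl i then 0 else X s : MvPolynomial (Fin n ⊕ Fin d) k →ₐ[k] _) ''
        (F : Set (MvPolynomial (Fin n ⊕ Fin d) k)) :=
      Set.image_congr fun f hf => hinit i f hf
    -- On `F` the initial form is the ring homomorphism `Xᵢ = 0`, so the initial forms of `F`
    -- generate the image of all of `𝓘_𝓑` under it.
    rw [himage, ← Ideal.map_span, hspan, initialIdeal, Ideal.span_le]
    rintro _ ⟨f, hf, rfl⟩
    by_cases h0 : f = 0
    · rw [h0, initialForm_zero]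
      exact Ideal.zero_mem _
    obtain ⟨q, hq, hq0⟩ := exists_expWeight_min (liftWeight n (D i)) h0
    rw [initialForm_eq_restr hq hq0]
    refine mem_of_restr_fiber_mem (multiDeg D) fun r => ?_
    rw [restr_comm]
    by_cases h1 : restr {γ | multiDeg D γ = r} f = 0
    · rw [h1, map_zero]
      exact Ideal.zero_mem _
    obtain ⟨a, p, hp, r', hr', hr0, e⟩ := exists_homog_of_mem_coxIdeal hf r h1
    have ea : expWeight (liftWeight n (D i)) (Finsupp.sumElim a 0) = 0 := by
      rw [expWeight_liftWeight, yPart_sumElim, expWeight_zero]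
    have hpq : p ∈ restrictSupport k (expGE (D i) q) := by
      have h2 := setXOne_mem_expGE (restr_mem_of_mem {γ | multiDeg D γ = r} hq)
      have e2 : setXOne k n d (monomial (Finsupp.sumElim a 0) 1) = 1 := by
        rw [setXOne_monomial, yPart_sumElim]
        rfl
      rwa [e, map_mul, e2, one_mul, setXOne_homog] at h2
    rw [e, restr_monomial_mul, ea, sub_zero]
    refine Ideal.mul_mem_left _ _ ?_
    -- The minimal weight of the whole `f` may be smaller than that of the given multidegree
    -- component; then this component does not contribute.
    by_cases hqr : q = r' i
    · rw [hqr, restr_homog_eq_setXZero hr']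
      exact Ideal.mem_map_of_mem _ (homog_mem_coxIdeal hr' hp)
    · have hle : q ≤ r' i := by
        by_contra hlt
        refine hr0 i (restr_eq_zero hpq ?_)
        intro α h1 h2
        simp only [mem_expGE, mem_expEQ] at h1 h2
        omega
      rw [restr_eq_zero (homog_mem_expGE r' (mem_expGE_of_mem_expRows hr' i))]
      · exact Ideal.zero_mem _
      · intro α h1 h2
        simp only [mem_expGE, mem_expEQ] at h1 h2
        omega

end GoodGenerators

/-! ### Multiplicativity of the minimal weight on polynomial rings. -/

section MinWeight

variable {k : Type*} [Field k] {τ : Type*}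

theorem mul_mem_expEQ {w : τ → ℤ} {q r : ℤ} {p g : MvPolynomial τ k}
    (hp : p ∈ restrictSupport k (expEQ w q)) (hg : g ∈ restrictSupport k (expEQ w r)) :
    p * g ∈ restrictSupport k (expEQ w (q + r)) := by
  have h := Submodule.mul_mem_mul hp hg
  rw [← restrictSupport_add] at h
  refine restrictSupport_mono k ?_ h
  rintro _ ⟨α, hα, β, hβ, rfl⟩
  simp only [mem_expEQ, expWeight_add] at *
  omega

theorem sub_restr_mem_expGE_succ {w : τ → ℤ} {q : ℤ} {p : MvPolynomial τ k}
    (hp : p ∈ restrictSupport k (expGE w q)) :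
    p - restr (expEQ w q) p ∈ restrictSupport k (expGE w (q + 1)) :=
  sub_mem_expGE_succ hp (restr_mem_of_mem _ hp) (by rw [restr_restr, Set.inter_self])

/-- The minimal weight is additive on products of polynomials. -/
theorem mul_notMem_expGE_succ {w : τ → ℤ} {q r : ℤ} {p g : MvPolynomial τ k}
    (hp : p ∈ restrictSupport k (expGE w q)) (hp' : p ∉ restrictSupport k (expGE w (q + 1)))
    (hg : g ∈ restrictSupport k (expGE w r)) (hg' : g ∉ restrictSupport k (expGE w (r + 1))) :
    p * g ∉ restrictSupport k (expGE w (q + r + 1)) := by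
  intro h
  have hp1 := sub_restr_mem_expGE_succ hp
  have hg1 := sub_restr_mem_expGE_succ hg
  set p' := restr (expEQ w q) p with hpd
  set g' := restr (expEQ w r) g with hgd
  -- The product of the lowest components is concentrated in weight `q + r`. If it also had larger
  -- weight it would be zero, which the absence of zero divisors excludes.
  have h1 : p' * g' ∈ restrictSupport k (expGE w (q + r + 1)) := by
    have e : p' * g' = p * g - p * (g - g') - (p - p') * g' := by ring
    rw [e]
    refine Submodule.sub_mem _ (Submodule.sub_mem _ h ?_) ?_
    · have := mul_mem_expGE hp hg1
      rwa [← add_assoc] at this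
    · have := mul_mem_expGE hp1 (restr_mem_of_mem (expEQ w r) hg)
      rwa [add_right_comm] at this
  have h2 : p' * g' = 0 := by
    have h3 := mul_mem_expEQ (restr_mem (expEQ w q) p) (restr_mem (expEQ w r) g)
    have h4 := restr_eq_zero (T := expEQ w (q + r)) h1 (by
      intro α h1 h2
      simp only [mem_expGE, mem_expEQ] at *
      omega)
    rwa [restr_eq_self h3] at h4
  rcases mul_eq_zero.1 h2 with h3 | h3
  · rw [h3, sub_zero] at hp1
    exact hp' hp1
  · rw [h3, sub_zero] at hg1
    exact hg' hg1

theorem prod_notMem_expGE_succ {κ : Type*} {w : τ → ℤ} {x : κ → MvPolynomial τ k} {u : κ → ℤ}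
    (hx : ∀ j, x j ∈ restrictSupport k (expGE w (u j)))
    (hx' : ∀ j, x j ∉ restrictSupport k (expGE w (u j + 1))) (α : κ →₀ ℕ) :
    (α.prod fun j e => x j ^ e) ∈ restrictSupport k (expGE w (expWeight u α)) ∧
      (α.prod fun j e => x j ^ e) ∉ restrictSupport k (expGE w (expWeight u α + 1)) := by
  classical
  have hone : (1 : MvPolynomial τ k) ∈ restrictSupport k (expGE w 0) ∧
      (1 : MvPolynomial τ k) ∉ restrictSupport k (expGE w (0 + 1)) := by
    constructor
    · exact (monomial_mem_restrictSupport k).2 (Or.inl (by simp))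
    · intro h
      have := ((monomial_mem_restrictSupport k).1 h).resolve_right one_ne_zero
      simp at this
  induction α using Finsupp.induction_linear with
  | zero => simpa using hone
  | add α β hα hβ =>
    rw [Finsupp.prod_add_index' (by simp) (by intros; rw [pow_add]), expWeight_add]
    exact ⟨mul_mem_expGE hα.1 hβ.1, mul_notMem_expGE_succ hα.1 hα.2 hβ.1 hβ.2⟩
  | single j e =>
    rw [Finsupp.prod_single_index (by simp), expWeight_single]
    induction e with
    | zero => simpa using hone
    | succ e ih =>
      rw [pow_succ, Nat.cast_add_one, add_one_mul]
      exact ⟨mul_mem_expGE ih.1 (hx j), mul_notMem_expGE_succ ih.1 ih.2 (hx j) (hx' j)⟩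

theorem map_mem_weightFiltration {A A' : Type*} [CommRing A] [Algebra k A] [CommRing A']
    [Algebra k A'] (φ : A →ₐ[k] A') {c : τ → A} {u : τ → ℤ} {q : ℤ} {a : A}
    (ha : a ∈ weightFiltration (k := k) c u q) :
    φ a ∈ weightFiltration (k := k) (φ ∘ c) u q := by
  obtain ⟨p, hp, rfl⟩ := mem_weightFiltration.1 ha
  refine mem_weightFiltration.2 ⟨p, hp, ?_⟩
  rw [← AlgHom.comp_apply, comp_aeval]
  rfl

theorem weightFiltration_X (u : τ → ℤ) (q : ℤ) :
    weightFiltration (k := k) (X : τ → MvPolynomial τ k) u q = restrictSupport k (expGE u q) := by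
  ext p
  rw [mem_weightFiltration]
  constructor
  · rintro ⟨g, hg, rfl⟩
    rwa [aeval_X_left_apply]
  · exact fun h => ⟨p, h, aeval_X_left_apply p⟩

end MinWeight

/-! ### The valuation defined by a weight on the linear part. -/

section LinearPart

variable {k : Type*} [Field k] {E : Type*} [AddCommGroup E] [Module k E] {d : ℕ}

/-- Linear functionals on `E` extend to the symmetric algebra and separate the vectors of `E`. -/
theorem symmetricAlgebra_ι_injective : Function.Injective (SymmetricAlgebra.ι k E) := by
  rw [injective_iff_map_eq_zero]
  intro x hx
  rw [← Module.forall_dual_apply_eq_zero_iff k x]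
  intro f
  rw [← SymmetricAlgebra.lift_ι_apply f x, hx, map_zero]

theorem eq_single_of_weight_eq_one {τ : Type*} {δ : τ → ℕ} (hδ : ∀ j, 0 < δ j) {α : τ →₀ ℕ}
    (h : Finsupp.weight δ α = 1) : ∃ j, α = Finsupp.single j 1 ∧ δ j = 1 := by
  classical
  have key : ∀ β : τ →₀ ℕ, β ≠ 0 → ∃ j γ, β = Finsupp.single j 1 + γ := by
    intro β hβ
    obtain ⟨j, hj⟩ := Finsupp.support_nonempty_iff.2 hβ
    refine ⟨j, β - Finsupp.single j 1, (add_tsub_cancel_of_le ?_).symm⟩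
    rw [Finsupp.single_le_iff]
    exact Nat.one_le_iff_ne_zero.2 (Finsupp.mem_support_iff.1 hj)
  obtain ⟨j, γ, rfl⟩ := key α (by
    rintro rfl
    simp at h)
  rw [map_add, Finsupp.weight_single, one_smul] at h
  have hj := hδ j
  have hγ : γ = 0 := by
    by_contra hne
    obtain ⟨j', γ', rfl⟩ := key γ hne
    rw [map_add, Finsupp.weight_single, one_smul] at h
    have := hδ j'
    omega
  exact ⟨j, by rw [hγ, add_zero], by omega⟩

theorem exists_aeval_eq {b : Fin d → SymmetricAlgebra k E} (hb : IsHomogeneousGenerating b)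
    (a : SymmetricAlgebra k E) : ∃ p : MvPolynomial (Fin d) k, aeval b p = a := by
  have h : a ∈ Algebra.adjoin k (Set.range b) := by
    rw [hb.generates]
    trivial
  rw [Algebra.adjoin_range_eq_range_aeval] at h
  exact h

theorem exists_aeval_eq_of_mem_pow {b : Fin d → SymmetricAlgebra k E}
    (hb : IsHomogeneousGenerating b) {δ : Fin d → ℕ}
    (hbδ : ∀ j, b j ∈ (LinearMap.range (SymmetricAlgebra.ι k E)) ^ δ j) {e : ℕ}
    {a : SymmetricAlgebra k E} (ha : a ∈ (LinearMap.range (SymmetricAlgebra.ι k E)) ^ e) :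
    ∃ p ∈ restrictSupport k (expDeg δ e), aeval b p = a := by
  obtain ⟨p, rfl⟩ := exists_aeval_eq hb a
  exact ⟨_, restr_mem (expDeg δ e) p, aeval_restr_of_mem_pow hbδ ha⟩

/-- Since all degrees are positive, a monomial of degree one is a single variable, and that variable
belongs to the linear part. -/
theorem range_ι_le_span_linearPart {b : Fin d → SymmetricAlgebra k E}
    (hb : IsHomogeneousGenerating b) :
    LinearMap.range (SymmetricAlgebra.ι k E) ≤ Submodule.span k (Set.range (linearPart b)) := by
  choose δ hδ hbδ using hb.homogeneous
  intro a ha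
  obtain ⟨p, hp, rfl⟩ := exists_aeval_eq_of_mem_pow hb hbδ (e := 1) (by rwa [pow_one])
  rw [p.as_sum, map_sum]
  refine Submodule.sum_mem _ fun α hα => ?_
  obtain ⟨j, rfl, hj⟩ := eq_single_of_weight_eq_one hδ
    (mem_restrictSupport'.1 hp α (mem_support_iff.1 hα))
  rw [aeval_monomial, Finsupp.prod_single_index (by simp), pow_one, ← Algebra.smul_def]
  refine Submodule.smul_mem _ _ (Submodule.subset_span ⟨⟨j, ?_⟩, rfl⟩)
  have := hbδ j
  rwa [hj, pow_one] at this

/-- The weight filtration of a weight on the linear part is the filtration by minimal weights in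
a polynomial ring. -/
theorem exists_equiv_weightFiltration {b : Fin d → SymmetricAlgebra k E}
    (hb : IsHomogeneousGenerating b) (u : LinearIndex b → ℤ) :
    ∃ (B : Type) (v : B → ℤ) (Φ : SymmetricAlgebra k E ≃ₐ[k] MvPolynomial B k),
      ∀ q a, a ∈ weightFiltration (k := k) (linearPart b) u q ↔
        Φ a ∈ restrictSupport k (expGE v q) := by
  classical
  have hlin : ∀ j, linearPart b j ∈ (LinearMap.range (SymmetricAlgebra.ι k E)) ^
      (fun _ : LinearIndex b => 1) j := fun j => by
    rw [pow_one]
    exact j.2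
  have hI := isDegHomogeneous_relationIdeal hlin
  -- Standard monomials of degree one are single variables. They select from the linear part a basis
  -- of `E` adapted to the weight `u`.
  obtain ⟨S, hS, hind, hsp⟩ := exists_standard_subset
    (initialIdeal u (relationIdeal k (linearPart b))) (expDeg (fun _ => 1) 1)
  have hind' := eq_zero_of_initialIdeal hind
  let B := {j : LinearIndex b // Finsupp.single j 1 ∈ S}
  have hB : ∀ α ∈ S, ∃ j : B, α = Finsupp.single j.1 1 := by
    intro α hα
    obtain ⟨j, rfl, -⟩ := eq_single_of_weight_eq_one (fun _ => one_pos) (hS hα)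
    exact ⟨⟨j, hα⟩, rfl⟩
  -- Each linear generator is a combination of basis members of weight at least its own. Hence the
  -- discarded generators do not enlarge the filtration, which becomes the minimal-weight filtration
  -- in the basis variables.
  have hexp : ∀ j, ∃ s ∈ restrictSupport k (S ∩ expGE u (u j)),
      aeval (linearPart b) s = linearPart b j := by
    intro j
    obtain ⟨s, hs, hsI⟩ := exists_standard_expGE (fun _ => one_pos) hI hS hsp (u j) (p := X j)
      ((monomial_mem_restrictSupport k).2 (Or.inl (by simp [Finsupp.weight_single])))
      (restrictSupport_mono k (expEQ_subset_expGE _ _) (X_mem_expEQ u j))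
    rw [mem_relationIdeal, map_sub, aeval_X, sub_eq_zero] at hsI
    exact ⟨s, hs, hsI.symm⟩
  choose x hx using fun j : B => j.1.2
  have hx' : ∀ j : B, SymmetricAlgebra.ι k E (x j) = linearPart b j.1 := hx
  have hli : LinearIndependent k x := by
    refine LinearIndependent.of_comp (SymmetricAlgebra.ι k E) ?_
    rw [Fintype.linearIndependent_iff]
    intro g hg j
    have h1 : ∑ j : B, monomial (Finsupp.single j.1 1) (g j) ∈
        relationIdeal k (linearPart b) := by
      rw [mem_relationIdeal, map_sum, ← hg]
      refine Finset.sum_congr rfl fun j _ => ?_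
      rw [aeval_monomial, Finsupp.prod_single_index (by simp), pow_one, ← Algebra.smul_def,
        Function.comp_apply, hx']
    have h2 := hind' _ h1 (Submodule.sum_mem _ fun j _ =>
      (monomial_mem_restrictSupport k).2 (Or.inl j.2))
    have h3 := congrArg (coeff (Finsupp.single j.1 1)) h2
    rw [coeff_sum, coeff_zero, Finset.sum_eq_single j] at h3
    · rwa [coeff_monomial, if_pos rfl] at h3
    · intro j' _ hne
      rw [coeff_monomial, if_neg]
      intro he
      exact hne (Subtype.ext (Finsupp.single_left_injective one_ne_zero he))
    · simp
  have hspan : ⊤ ≤ Submodule.span k (Set.range x) := by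
    intro y _
    have h1 : Submodule.span k (Set.range (linearPart b)) ≤
        (Submodule.span k (Set.range x)).map (SymmetricAlgebra.ι k E) := by
      rw [Submodule.span_le]
      rintro _ ⟨j, rfl⟩
      obtain ⟨s, hs, hse⟩ := hexp j
      rw [← hse, s.as_sum, map_sum]
      refine Submodule.sum_mem _ fun α hα => ?_
      obtain ⟨i, rfl⟩ := hB α (mem_restrictSupport'.1 hs α (mem_support_iff.1 hα)).1
      rw [aeval_monomial, Finsupp.prod_single_index (by simp), pow_one, ← Algebra.smul_def]
      exact Submodule.smul_mem _ _ ⟨x i, Submodule.subset_span ⟨i, rfl⟩, hx' i⟩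
    obtain ⟨z, hz, hzy⟩ := h1 (range_ι_le_span_linearPart hb ⟨y, rfl⟩)
    rwa [← symmetricAlgebra_ι_injective hzy]
  let β := Module.Basis.mk hli hspan
  let Φ := SymmetricAlgebra.equivMvPolynomial β
  have hΦ : ∀ j : B, Φ (linearPart b j.1) = X j := by
    intro j
    rw [← hx' j]
    have : β j = x j := Module.Basis.mk_apply hli hspan j
    rw [← this]
    exact SymmetricAlgebra.equivMvPolynomial_ι_apply β j
  refine ⟨B, fun j => u j.1, Φ, fun q a => ⟨fun ha => ?_, fun ha => ?_⟩⟩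
  · have h1 := map_mem_weightFiltration (Φ : SymmetricAlgebra k E →ₐ[k] MvPolynomial B k) ha
    rw [← weightFiltration_X]
    refine weightFiltration_le (fun j => ?_) q h1
    rw [weightFiltration_X]
    obtain ⟨s, hs, hse⟩ := hexp j
    change Φ (linearPart b j) ∈ _
    rw [← hse, s.as_sum, map_sum, map_sum]
    refine Submodule.sum_mem _ fun α hα => ?_
    have h2 := mem_restrictSupport'.1 hs α (mem_support_iff.1 hα)
    obtain ⟨i, rfl⟩ := hB α h2.1
    rw [aeval_monomial, Finsupp.prod_single_index (by simp), pow_one, ← Algebra.smul_def,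
      map_smul, hΦ]
    refine Submodule.smul_mem _ _ ((monomial_mem_restrictSupport k).2 (Or.inl ?_))
    simpa using h2.2
  · rw [← weightFiltration_X] at ha
    have h1 := map_mem_weightFiltration
      (Φ.symm : MvPolynomial B k →ₐ[k] SymmetricAlgebra k E) ha
    have e1 : (Φ.symm : MvPolynomial B k →ₐ[k] SymmetricAlgebra k E) (Φ a) = a :=
      Φ.symm_apply_apply a
    rw [e1] at h1
    refine weightFiltration_le (fun j => ?_) q h1
    have e2 : Φ.symm (X j) = linearPart b j.1 := by
      rw [← hΦ j, Φ.symm_apply_apply]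
    change Φ.symm (X j) ∈ _
    rw [e2]
    exact self_mem_weightFiltration (linearPart b) u j.1

/-- The weight quasivaluation of a weight on the linear part is multiplicative. -/
theorem prod_notMem_weightFiltration {b : Fin d → SymmetricAlgebra k E}
    (hb : IsHomogeneousGenerating b) {u : LinearIndex b → ℤ} {κ : Type*}
    {x : κ → SymmetricAlgebra k E} {v : κ → ℤ}
    (hx : ∀ j, x j ∈ weightFiltration (k := k) (linearPart b) u (v j))
    (hx' : ∀ j, x j ∉ weightFiltration (k := k) (linearPart b) u (v j + 1)) (α : κ →₀ ℕ) :
    (α.prod fun j e => x j ^ e) ∉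
      weightFiltration (k := k) (linearPart b) u (expWeight v α + 1) := by
  obtain ⟨B, w, Φ, hΦ⟩ := exists_equiv_weightFiltration hb u
  simp only [hΦ] at hx hx' ⊢
  have := (prod_notMem_expGE_succ hx hx' α).2
  rw [map_finsuppProd]
  simpa using this

end LinearPart

/-! ### Adjoining generators whose weights do not exceed their values. -/

section Append

variable {k : Type*} [Field k] {A : Type*} [CommRing A] [Algebra k A] {d e : ℕ}

theorem append_comp_castAdd {M : Type*} (b : Fin d → M) (c : Fin e → M) :
    Fin.append b c ∘ Fin.castAdd e = b := by
  funext j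
  simp

theorem append_mem_weightFiltration {b : Fin d → A} {w : Fin d → ℤ} {c : Fin e → A}
    {v : Fin e → ℤ} (hc : ∀ l, c l ∈ weightFiltration (k := k) b w (v l)) (j : Fin (d + e)) :
    Fin.append b c j ∈ weightFiltration (k := k) b w (Fin.append w v j) := by
  induction j using Fin.addCases with
  | left j => simpa using self_mem_weightFiltration b w j
  | right l => simpa using hc l

theorem append_mem_weightFiltration_comp {b : Fin d → A} {w : Fin d → ℤ} {c : Fin e → A}
    {v : Fin e → ℤ} (hc : ∀ l, c l ∈ weightFiltration (k := k) b w (v l)) (j : Fin (d + e)) :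
    Fin.append b c j ∈ weightFiltration (k := k) (Fin.append b c ∘ Fin.castAdd e)
      (Fin.append w v ∘ Fin.castAdd e) (Fin.append w v j) := by
  rw [append_comp_castAdd, append_comp_castAdd]
  exact append_mem_weightFiltration hc j

/-- The new generators already lie in the steps given by their weights, so monomials containing them
bring nothing new. -/
theorem weightFiltration_append {b : Fin d → A} {w : Fin d → ℤ} {c : Fin e → A}
    {v : Fin e → ℤ} (hc : ∀ l, c l ∈ weightFiltration (k := k) b w (v l)) (q : ℤ) :
    weightFiltration (k := k) (Fin.append b c) (Fin.append w v) q = weightFiltration b w q := by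
  rw [weightFiltration_comp_eq (append_mem_weightFiltration_comp hc), append_comp_castAdd,
    append_comp_castAdd]

theorem rename_mem_relationIdeal_append {b : Fin d → A} (c : Fin e → A)
    {p : MvPolynomial (Fin d) k} :
    rename (Fin.castAdd e) p ∈ relationIdeal k (Fin.append b c) ↔ p ∈ relationIdeal k b := by
  rw [rename_mem_relationIdeal, append_comp_castAdd]

theorem rename_mem_initialIdeal_append {I : Ideal (MvPolynomial (Fin d) k)}
    {J : Ideal (MvPolynomial (Fin (d + e)) k)} (hIJ : ∀ p ∈ I, rename (Fin.castAdd e) p ∈ J)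
    {w : Fin d → ℤ} (v : Fin e → ℤ) {p : MvPolynomial (Fin d) k} (hp : p ∈ initialIdeal w I) :
    rename (Fin.castAdd e) p ∈ initialIdeal (Fin.append w v) J := by
  refine rename_mem_initialIdeal hIJ ?_
  rwa [append_comp_castAdd]

theorem weight_mapDomain_castAdd (δ : Fin d → ℕ) (ε : Fin e → ℕ) (α : Fin d →₀ ℕ) :
    Finsupp.weight (Fin.append δ ε) (α.mapDomain (Fin.castAdd e)) = Finsupp.weight δ α := by
  induction α using Finsupp.induction_linear with
  | zero => simp
  | add a b ha hb => rw [Finsupp.mapDomain_add, map_add, map_add, ha, hb]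
  | single j e => simp [Finsupp.weight_single]

theorem rename_mem_expGE_append {w : Fin d → ℤ} (v : Fin e → ℤ) {q : ℤ}
    {p : MvPolynomial (Fin d) k} (hp : p ∈ restrictSupport k (expGE w q)) :
    rename (Fin.castAdd e) p ∈ restrictSupport k (expGE (Fin.append w v) q) := by
  refine rename_mem_expGE ?_
  rwa [append_comp_castAdd]

theorem exists_rename_of_mem {τ κ : Type*} {f : κ → τ} {B : Set (κ →₀ ℕ)}
    {p : MvPolynomial τ k} (hp : p ∈ restrictSupport k (Finsupp.mapDomain f '' B)) :
    ∃ g ∈ restrictSupport k B, rename f g = p := by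
  have h : restrictSupport k (Finsupp.mapDomain f '' B) ≤
      (restrictSupport k B).map (rename f : MvPolynomial κ k →ₐ[k] _).toLinearMap := by
    rw [restrictSupport_eq_span, Submodule.span_le]
    rintro _ ⟨_, ⟨α, hα, rfl⟩, rfl⟩
    exact ⟨monomial α 1, (monomial_mem_restrictSupport k).2 (Or.inl hα), rename_monomial _ _ _⟩
  exact h hp

theorem rename_mem_image {τ κ : Type*} (f : κ → τ) {B : Set (κ →₀ ℕ)} {p : MvPolynomial κ k}
    (hp : p ∈ restrictSupport k B) :
    rename f p ∈ restrictSupport k (Finsupp.mapDomain f '' B) := by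
  refine mem_restrictSupport'.2 fun α hα => ?_
  obtain ⟨u, rfl, hu⟩ := coeff_rename_ne_zero f p α hα
  exact ⟨u, mem_restrictSupport'.1 hp u hu, rfl⟩

theorem totalSectionRing_congr {n : ℕ} {b : Fin d → A} {D : Matrix (Fin n) (Fin d) ℤ} {d' : ℕ}
    {b' : Fin d' → A} {D' : Matrix (Fin n) (Fin d') ℤ}
    (h : ∀ i q, weightFiltration (k := k) b (D i) q = weightFiltration b' (D' i) q) :
    totalSectionRing k b D = totalSectionRing k b' D' := by
  ext x
  change (∀ r i, _ ∈ _) ↔ (∀ r i, _ ∈ _)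
  simp only [h]

end Append

/-! ### Extended rows remain in `Trop_⋆`. -/

section TropicalExtension

variable {k : Type*} [Field k] {E : Type*} [AddCommGroup E] [Module k E] {d e : ℕ}

/-- Some new elements may have degree one and enlarge the linear part; its filtration stays the
same, and multiplicativity of the valuation shows that no monomial in the larger linear part gains
value. -/
theorem append_mem_tropStar {b : Fin d → SymmetricAlgebra k E}
    (hb : IsHomogeneousGenerating b) {w : Fin d → ℤ} (hw : w ∈ tropStar b)
    {c : Fin e → SymmetricAlgebra k E} {v : Fin e → ℤ}
    (hc : ∀ l, c l ∈ weightFiltration (k := k) b w (v l))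
    (hc' : ∀ l, c l ∉ weightFiltration (k := k) b w (v l + 1)) :
    Fin.append w v ∈ tropStar (Fin.append b c) := by
  have hL : ∀ q, weightFiltration (k := k) (linearPart (Fin.append b c))
      (Fin.append w v ∘ Subtype.val) q = weightFiltration b w q := by
    intro q
    refine le_antisymm ?_ ?_
    · rw [← weightFiltration_append hc]
      exact weightFiltration_comp_le (Fin.append b c) (Fin.append w v)
        (Subtype.val : LinearIndex (Fin.append b c) → _) q
    · rw [weightFiltration_linearPart hw]
      refine weightFiltration_le (fun j => ?_) q
      have := self_mem_weightFiltration (k := k) (linearPart (Fin.append b c))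
        (Fin.append w v ∘ Subtype.val) ⟨Fin.castAdd e j.1, by simpa using j.2⟩
      simpa [linearPart] using this
  have h1 := append_mem_weightFiltration hc
  have h2 : ∀ j, Fin.append b c j ∉
      weightFiltration (k := k) b w (Fin.append w v j + 1) := by
    intro j
    induction j using Fin.addCases with
    | left j =>
      rw [Fin.append_left, Fin.append_left, weightFiltration_linearPart hw]
      exact (mem_tropStar_iff.1 hw).2.1 j
    | right l => simpa using hc' l
  refine mem_tropStar_iff.2 ⟨fun j => ?_, fun j => ?_, fun α => ?_⟩
  · rw [hL]
    exact h1 j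
  · rw [hL]
    exact h2 j
  · rw [hL, weightFiltration_linearPart hw]
    have h3 : ∀ j : LinearIndex (Fin.append b c), linearPart (Fin.append b c) j ∈
        weightFiltration (k := k) (linearPart b) (w ∘ Subtype.val)
          (Fin.append w v j.1) := by
      intro j
      rw [← weightFiltration_linearPart hw]
      exact h1 j.1
    have h4 : ∀ j : LinearIndex (Fin.append b c), linearPart (Fin.append b c) j ∉
        weightFiltration (k := k) (linearPart b) (w ∘ Subtype.val)
          (Fin.append w v j.1 + 1) := by
      intro j
      rw [← weightFiltration_linearPart hw]
      exact h2 j.1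
    have h5 := prod_notMem_weightFiltration (v := fun j : LinearIndex (Fin.append b c) =>
      Fin.append w v j.1) hb h3 h4 α
    exact h5

end TropicalExtension

/-! ### Extended diagrams remain adapted to the fan. -/

section AdaptedExtension

variable {k : Type*} [Field k] {d e : ℕ}

/-- Adding variables to the ideal with a standard set of monomials. -/
theorem exists_standard_append {δ : Fin d → ℕ} {ε : Fin e → ℕ}
    {K : Ideal (MvPolynomial (Fin d) k)} {L : Ideal (MvPolynomial (Fin (d + e)) k)}
    (hKL : ∀ p ∈ K, rename (Fin.castAdd e) p ∈ L) (hX : ∀ l, X (Fin.natAdd d l) ∈ L) {m : ℕ}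
    {B : Set (Fin d →₀ ℕ)}
    (hsp : ∀ p ∈ restrictSupport k (expDeg δ m), ∃ s ∈ restrictSupport k B, p - s ∈ K) :
    ∀ p ∈ restrictSupport k (expDeg (Fin.append δ ε) m),
      ∃ s ∈ restrictSupport k (Finsupp.mapDomain (Fin.castAdd e) '' B), p - s ∈ L := by
  have h : restrictSupport k (expDeg (Fin.append δ ε) m) ≤
      restrictSupport k (Finsupp.mapDomain (Fin.castAdd e) '' B) ⊔ L.restrictScalars k := by
    rw [restrictSupport_eq_span, Submodule.span_le]
    rintro _ ⟨α, hα, rfl⟩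
    -- A monomial containing a new variable lies in `L`; any other is a monomial in the old
    -- variables and is reduced modulo `K`.
    by_cases hl : ∃ l : Fin e, α (Fin.natAdd d l) ≠ 0
    · obtain ⟨l, hl⟩ := hl
      refine Submodule.mem_sup_right ?_
      have h1 : Finsupp.single (Fin.natAdd d l) 1 ≤ α := by
        rw [Finsupp.single_le_iff]
        exact Nat.one_le_iff_ne_zero.2 hl
      change monomial α (1 : k) ∈ L
      rw [← tsub_add_cancel_of_le h1, monomial_add_single, pow_one]
      exact Ideal.mul_mem_left _ _ (hX l)
    · push Not at hl
      have hinj : Set.InjOn (Fin.castAdd e : Fin d → Fin (d + e))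
          (Fin.castAdd e ⁻¹' (α.support : Set (Fin (d + e)))) :=
        (Fin.castAdd_injective d e).injOn
      have h1 : (α.comapDomain (Fin.castAdd e) hinj).mapDomain (Fin.castAdd e) = α := by
        refine Finsupp.mapDomain_comapDomain _ (Fin.castAdd_injective d e) α ?_
        intro j hj
        induction j using Fin.addCases with
        | left j => exact ⟨j, rfl⟩
        | right l => exact absurd (hl l) (Finsupp.mem_support_iff.1 hj)
      set γ := α.comapDomain (Fin.castAdd e) hinj with hγ
      obtain ⟨s, hs, hsK⟩ := hsp (monomial γ 1) ((monomial_mem_restrictSupport k).2 (Or.inl (by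
        rw [mem_expDeg, ← weight_mapDomain_castAdd δ ε, h1]
        exact hα)))
      have h2 := hKL _ hsK
      rw [map_sub, rename_monomial, h1] at h2
      have e1 : monomial α (1 : k) = rename (Fin.castAdd e) s +
          (monomial α 1 - rename (Fin.castAdd e) s) := by ring
      change monomial α (1 : k) ∈ restrictSupport k _ ⊔ L.restrictScalars k
      rw [e1]
      exact Submodule.add_mem_sup (rename_mem_image _ hs) h2
  intro p hp
  obtain ⟨s, hs, i, hi, rfl⟩ := Submodule.mem_sup.1 (h hp)
  exact ⟨s, hs, by simpa using hi⟩

variable {E : Type*} [AddCommGroup E] [Module k E] {m n : ℕ}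

theorem append_mem_pow {b : Fin d → SymmetricAlgebra k E} {c : Fin e → SymmetricAlgebra k E}
    {δ : Fin d → ℕ} {ε : Fin e → ℕ}
    (hb : ∀ j, b j ∈ (LinearMap.range (SymmetricAlgebra.ι k E)) ^ δ j)
    (hc : ∀ l, c l ∈ (LinearMap.range (SymmetricAlgebra.ι k E)) ^ ε l) (j : Fin (d + e)) :
    Fin.append b c j ∈ (LinearMap.range (SymmetricAlgebra.ι k E)) ^ Fin.append δ ε j := by
  induction j using Fin.addCases with
  | left j => simpa using hb j
  | right l => simpa using hc l

theorem append_pos {δ : Fin d → ℕ} {ε : Fin e → ℕ} (hδ : ∀ j, 0 < δ j) (hε : ∀ l, 0 < ε l)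
    (j : Fin (d + e)) : 0 < Fin.append δ ε j := by
  induction j using Fin.addCases with
  | left j => simpa using hδ j
  | right l => simpa using hε l

/-- For each cone the maximal face of the old Gröbner fan is extended by very low weights for the
new variables. The new monomial initial ideal is generated by the old one and the new variables, and
it has the same standard monomials. -/
theorem isAdapted_append {fan : SmoothFan m n} {b : Fin d → SymmetricAlgebra k E}
    (hb : IsHomogeneousGenerating b) {D : Matrix (Fin n) (Fin d) ℤ} (hD : IsAdapted fan b D)
    {c : Fin e → SymmetricAlgebra k E} {ε : Fin e → ℕ} (hε : ∀ l, 0 < ε l)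
    (hcε : ∀ l, c l ∈ (LinearMap.range (SymmetricAlgebra.ι k E)) ^ ε l) {v : Fin n → Fin e → ℤ}
    (hc : ∀ i l, c l ∈ weightFiltration (k := k) b (D i) (v i l)) :
    IsAdapted fan (Fin.append b c) (fun i => Fin.append (D i) (v i)) := by
  choose δ hδ hbδ using hb.homogeneous
  have hI := isDegHomogeneous_relationIdeal hbδ
  have hδ' := append_pos hδ hε
  have hI' := isDegHomogeneous_relationIdeal (append_mem_pow hbδ hcε)
  intro S hS
  obtain ⟨w₀, ⟨M, hM⟩, hface⟩ := hD S hS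
  set K := initialIdeal w₀ (relationIdeal k b) with hK
  have hface' : ∀ i ∈ S, initialIdeal w₀ (initialIdeal (D i) (relationIdeal k b)) = K := hface
  choose B hBdeg hBind hBsp using fun m => exists_standard_subset K (expDeg δ m)
  have hBindI : ∀ m, ∀ p ∈ relationIdeal k b, p ∈ restrictSupport k (B m) → p = 0 :=
    fun m => eq_zero_of_initialIdeal (hBind m)
  -- The normal form of `c l` with respect to the standard monomials of the face.
  have hp : ∀ l, ∃ p ∈ restrictSupport k (B (ε l)), aeval b p = c l := by
    intro l
    obtain ⟨q, hq, hqc⟩ := exists_aeval_eq_of_mem_pow hb hbδ (hcε l)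
    obtain ⟨p, hp, hpq⟩ := exists_standard_of_initialIdeal hδ hI (hBdeg _) (hBsp _) q hq
    rw [mem_relationIdeal, map_sub, sub_eq_zero, hqc] at hpq
    exact ⟨p, hp, hpq.symm⟩
  choose p hpB hpc using hp
  -- One normal form satisfies the bounds of all rows in the cone: since `in_{w₀}(in_{wᵢ}(I)) = K`,
  -- the same standard monomials are adapted to each of these rows, and the normal form is unique.
  have hpv : ∀ i ∈ S, ∀ l, p l ∈ restrictSupport k (expGE (D i) (v i l)) := by
    intro i hi l
    obtain ⟨g, hg, hgc⟩ := mem_weightFiltration.1 (hc i l)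
    have hg2 : aeval b (restr (expDeg δ (ε l)) g) = c l := by
      rw [← hgc]
      refine aeval_restr_of_mem_pow hbδ ?_
      rw [hgc]
      exact hcε l
    obtain ⟨s, hs, hsI⟩ := exists_standard_expGE hδ hI (hBdeg (ε l))
      (exists_standard_of_initialIdeal hδ (hI.initialIdeal (D i)) (hBdeg (ε l))
        (w := w₀) (by rw [hface' i hi]; exact hBsp (ε l))) (v i l)
      (restr_mem (expDeg δ (ε l)) g) (restr_mem_of_mem _ hg)
    rw [mem_relationIdeal, map_sub, sub_eq_zero, hg2] at hsI
    have h1 := hBindI (ε l) (p l - s) (by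
      rw [mem_relationIdeal, map_sub, hpc, hsI, sub_self])
      (Submodule.sub_mem _ (hpB l) (restrictSupport_mono k Set.inter_subset_left hs))
    rw [sub_eq_zero] at h1
    rw [h1]
    exact restrictSupport_mono k Set.inter_subset_right hs
  -- The new variable gets a weight strictly below those of its normal form, which makes it the
  -- initial term of their difference.
  have hv₀ : ∀ l, ∃ v₀ : ℤ, p l ∈ restrictSupport k (expGE w₀ (v₀ + 1)) := by
    intro l
    by_cases h0 : p l = 0
    · exact ⟨0, by rw [h0]; exact Submodule.zero_mem _⟩
    · obtain ⟨q, hq, -⟩ := exists_expWeight_min w₀ h0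
      exact ⟨q - 1, by rwa [sub_add_cancel]⟩
  choose v₀ hv₀ using hv₀
  set Î := relationIdeal k (Fin.append b c) with hÎ
  set ŵ₀ := Fin.append w₀ v₀ with hŵ₀
  have hrenI : ∀ g ∈ relationIdeal k b, rename (Fin.castAdd e) g ∈ Î :=
    fun g hg => (rename_mem_relationIdeal_append c).2 hg
  have hzÎ : ∀ l, X (Fin.natAdd d l) - rename (Fin.castAdd e) (p l) ∈ Î := by
    intro l
    rw [hÎ, mem_relationIdeal, map_sub, aeval_X, aeval_rename, append_comp_castAdd, hpc,
      Fin.append_right, sub_self]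
  set M' : Set (Fin (d + e) →₀ ℕ) :=
    Set.range (fun l => Finsupp.single (Fin.natAdd d l) 1) ∪
      Finsupp.mapDomain (Fin.castAdd e) '' M with hM'
  set L : Ideal (MvPolynomial (Fin (d + e)) k) :=
    Ideal.span ((fun α => monomial α (1 : k)) '' M') with hL
  have hXL : ∀ l, X (Fin.natAdd d l) ∈ L := fun l =>
    Ideal.subset_span ⟨_, Or.inl ⟨l, rfl⟩, rfl⟩
  have hKL : ∀ g ∈ K, rename (Fin.castAdd e) g ∈ L := by
    have : K ≤ L.comap (rename (Fin.castAdd e) : MvPolynomial (Fin d) k →ₐ[k] _) := by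
      rw [hM, Ideal.span_le]
      rintro _ ⟨α, hα, rfl⟩
      change rename (Fin.castAdd e) (monomial α (1 : k)) ∈ L
      rw [rename_monomial]
      exact Ideal.subset_span ⟨_, Or.inr ⟨α, hα, rfl⟩, rfl⟩
    exact this
  have hLle : ∀ N : Ideal (MvPolynomial (Fin (d + e)) k),
      (∀ l, X (Fin.natAdd d l) ∈ N) → (∀ g ∈ K, rename (Fin.castAdd e) g ∈ N) → L ≤ N := by
    intro N h1 h2
    rw [hL, Ideal.span_le]
    rintro _ ⟨_, ⟨l, rfl⟩ | ⟨α, hα, rfl⟩, rfl⟩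
    · exact h1 l
    · have := h2 (monomial α 1) (by
        rw [hM]
        exact Ideal.subset_span ⟨α, hα, rfl⟩)
      rwa [rename_monomial] at this
  have hBdeg' : ∀ m, Finsupp.mapDomain (Fin.castAdd e) '' B m ⊆ expDeg (Fin.append δ ε) m := by
    rintro m _ ⟨α, hα, rfl⟩
    rw [mem_expDeg, weight_mapDomain_castAdd]
    exact hBdeg m hα
  have hspL := fun m => exists_standard_append (ε := ε) hKL hXL (hBsp m)
  have hindÎ : ∀ m, ∀ g ∈ Î,
      g ∈ restrictSupport k (Finsupp.mapDomain (Fin.castAdd e) '' B m) → g = 0 := by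
    intro m g hg hgB
    obtain ⟨h, hh, rfl⟩ := exists_rename_of_mem hgB
    rw [hBindI m h ((rename_mem_relationIdeal_append c).1 hg) hh, map_zero]
  have hXmem : ∀ (N : Ideal (MvPolynomial (Fin (d + e)) k)) (l : Fin e)
      (g : MvPolynomial (Fin d) k), g ∈ restrictSupport k (expGE w₀ (v₀ l + 1)) →
      X (Fin.natAdd d l) - rename (Fin.castAdd e) g ∈ N →
      X (Fin.natAdd d l) ∈ initialIdeal ŵ₀ N := by
    intro N l g hg hgN
    have hX : (X (Fin.natAdd d l) : MvPolynomial (Fin (d + e)) k) ∈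
        restrictSupport k (expEQ ŵ₀ (v₀ l)) := by
      have := X_mem_expEQ (k := k) ŵ₀ (Fin.natAdd d l)
      rwa [hŵ₀, Fin.append_right] at this
    have hg' := rename_mem_expGE_append v₀ hg
    have h1 := restr_mem_initialIdeal (w := ŵ₀) (q := v₀ l) hgN (Submodule.sub_mem _
      (restrictSupport_mono k (expEQ_subset_expGE _ _) hX)
      (restrictSupport_mono k (expGE_anti _ (by omega)) hg'))
    rwa [map_sub, restr_eq_self hX, restr_eq_zero hg', sub_zero] at h1
    intro α h1 h2
    simp only [mem_expGE, mem_expEQ, ← hŵ₀] at h1 h2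
    omega
  -- Comparison of `L` with an initial ideal through common standard monomials. Independence modulo
  -- `N` may be derived from spanning: for `N = Î` this is not needed, but for the initial ideal of
  -- `Î` at an extended row it is.
  have hLeq : ∀ N : Ideal (MvPolynomial (Fin (d + e)) k), IsDegHomogeneous (Fin.append δ ε) N →
      L ≤ initialIdeal ŵ₀ N →
      (∀ m, (∀ g ∈ restrictSupport k (expDeg (Fin.append δ ε) m),
        ∃ s ∈ restrictSupport k (Finsupp.mapDomain (Fin.castAdd e) '' B m), g - s ∈ N) →
        ∀ g ∈ N, g ∈ restrictSupport k (Finsupp.mapDomain (Fin.castAdd e) '' B m) → g = 0) →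
      L = initialIdeal ŵ₀ N := by
    intro N hN hLN hind
    refine eq_of_le_of_standard hLN (hN.initialIdeal ŵ₀) fun m => ⟨_, hspL m, ?_⟩
    have hsp : ∀ g ∈ restrictSupport k (expDeg (Fin.append δ ε) m),
        ∃ s ∈ restrictSupport k (Finsupp.mapDomain (Fin.castAdd e) '' B m),
          g - s ∈ initialIdeal ŵ₀ N := by
      intro g hg
      obtain ⟨s, hs, hsL⟩ := hspL m g hg
      exact ⟨s, hs, hLN hsL⟩
    exact initialIdeal_eq_zero_of_span hδ' hN (hBdeg' m) hsp
      (hind m (exists_standard_of_initialIdeal hδ' hN (hBdeg' m) hsp))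
  have hLÎ : L = initialIdeal ŵ₀ Î := by
    refine hLeq Î hI' (hLle _ (fun l => hXmem Î l _ (hv₀ l) (hzÎ l))
      fun g hg => rename_mem_initialIdeal_append hrenI v₀ hg) fun m _ => hindÎ m
  refine ⟨ŵ₀, ⟨M', hLÎ.symm⟩, fun i hi => ?_⟩
  change initialIdeal ŵ₀ (initialIdeal (Fin.append (D i) (v i)) Î) = initialIdeal ŵ₀ Î
  rw [← hLÎ]
  symm
  have hren2 : ∀ g ∈ initialIdeal (D i) (relationIdeal k b),
      rename (Fin.castAdd e) g ∈ initialIdeal (Fin.append (D i) (v i)) Î :=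
    fun g hg => rename_mem_initialIdeal_append hrenI (v i) hg
  refine hLeq _ (hI'.initialIdeal _) (hLle _ (fun l => ?_) fun g hg => ?_) fun m hsp => ?_
  -- The initial form at the extended row of `zₗ - pₗ` keeps the new variable `zₗ`, because `pₗ`
  -- obeys the bound of that row; taking the initial form at `ŵ₀` then leaves `zₗ` alone.
  · refine hXmem _ l (restr (expEQ (D i) (v i l)) (p l)) (restr_mem_of_mem _ (hv₀ l)) ?_
    have hX : (X (Fin.natAdd d l) : MvPolynomial (Fin (d + e)) k) ∈
        restrictSupport k (expEQ (Fin.append (D i) (v i)) (v i l)) := by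
      have := X_mem_expEQ (k := k) (Fin.append (D i) (v i)) (Fin.natAdd d l)
      rwa [Fin.append_right] at this
    have h1 := restr_mem_initialIdeal (w := Fin.append (D i) (v i)) (q := v i l) (hzÎ l)
      (Submodule.sub_mem _ (restrictSupport_mono k (expEQ_subset_expGE _ _) hX)
        (rename_mem_expGE_append (v i) (hpv i hi l)))
    rwa [map_sub, restr_eq_self hX, restr_expEQ_rename, append_comp_castAdd] at h1
  · rw [← hface' i hi] at hg
    exact rename_mem_initialIdeal_append hren2 v₀ hg
  · exact initialIdeal_eq_zero_of_span hδ' hI' (hBdeg' m) hsp (hindÎ m)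

end AdaptedExtension

/-! ### The weight of a redundant generator as a linear form. -/

section ColumnForm

variable {k : Type*} [Field k] {A : Type*} [CommRing A] [Algebra k A] {τ κ : Type*}

/-- An element that is redundant for the filtration has as weight a linear form in the weights of
the others; this form depends only on the initial ideal. -/
theorem exists_weight_eq_expWeight {δ : τ → ℕ} {b : τ → A}
    (hI : IsDegHomogeneous δ (relationIdeal k b)) {w : τ → ℤ} {f : κ → τ}
    (h : ∀ j, b j ∈ weightFiltration (k := k) (b ∘ f) (w ∘ f) (w j)) {j : τ}
    (hj : b j ∉ weightFiltration (k := k) b w (w j + 1)) :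
    ∃ β : κ →₀ ℕ, ∀ w', initialIdeal w (relationIdeal k b) = initialIdeal w' (relationIdeal k b) →
      w' j = expWeight (w' ∘ f) β := by
  obtain ⟨B, hB, hind, hsp⟩ := exists_standard_subfamily f (hI.initialIdeal w)
    (fun j => exists_X_sub_rename_mem_initialIdeal (h j)) (δ j)
  obtain ⟨s, hs, hsK⟩ := hsp (X j) ((monomial_mem_restrictSupport k).2 (Or.inl (by
    simp [Finsupp.weight_single])))
  -- If the normal form were zero, the variable would lie in the initial ideal and its value would
  -- exceed its weight.
  have hs0 : s ≠ 0 := by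
    rintro rfl
    rw [sub_zero] at hsK
    have := monomial_mem_initialIdeal_iff.1 hsK
    exact hj (by simpa using this)
  obtain ⟨α, hα⟩ := ne_zero_iff.1 hs0
  obtain ⟨β, rfl⟩ := (hB (mem_restrictSupport'.1 hs α hα)).2
  refine ⟨β, fun w' hw' => ?_⟩
  -- The ideal is graded by `w'` too, so `X j` is congruent to the part of `s` of `w'`-weight `w'
  -- j`. By independence that part is all of `s`, and any monomial of `s` serves as `β`,
  -- independently of `w'`.
  have h1 := restr_expEQ_mem_initialIdeal (hw' ▸ hsK) (w' j)
  rw [← hw', map_sub, restr_eq_self (X_mem_expEQ w' j)] at h1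
  have h2 := hind (s - restr (expEQ w' (w' j)) s) (by
    have := Ideal.sub_mem _ h1 hsK
    rwa [sub_sub_sub_cancel_left] at this) (Submodule.sub_mem _ hs (restr_mem_of_mem _ hs))
  rw [sub_eq_zero] at h2
  rw [h2, coeff_restr] at hα
  have h3 : expWeight w' (β.mapDomain f) = w' j := by
    by_contra h3
    exact hα (if_neg h3)
  rw [← h3, expWeight_mapDomain]

end ColumnForm

/-! ### Polyhedral cones under linear substitution. -/

section Pullback

variable {n d e : ℕ}

/-- The defining linear forms are composed with a linear map; `pull` is its transpose. -/
theorem IsPolyhedralCone.append_preimage {C : Set (Matrix (Fin n) (Fin (d + e)) ℤ)}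
    (hC : IsPolyhedralCone C) (β : Fin n → Fin e → Fin d → ℤ) :
    IsPolyhedralCone {D : Matrix (Fin n) (Fin d) ℤ |
      (fun i => Fin.append (D i) fun l => ∑ j, β i l j * D i j) ∈ C} := by
  classical
  obtain ⟨P, Q, rfl⟩ := hC
  set pull : Matrix (Fin n) (Fin (d + e)) ℤ → Matrix (Fin n) (Fin d) ℤ := fun p i j =>
    p i (Fin.castAdd e j) + ∑ l, p i (Fin.natAdd d l) * β i l j with hpull
  have key : ∀ (p : Matrix (Fin n) (Fin (d + e)) ℤ) (D : Matrix (Fin n) (Fin d) ℤ),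
      ∑ i, ∑ j, pull p i j * D i j =
        ∑ i, ∑ j, p i j * Fin.append (D i) (fun l => ∑ j, β i l j * D i j) j := by
    intro p D
    refine Finset.sum_congr rfl fun i _ => ?_
    rw [Fin.sum_univ_add]
    simp only [hpull, Fin.append_left, Fin.append_right, add_mul, Finset.sum_add_distrib,
      Finset.sum_mul, Finset.mul_sum]
    congr 1
    rw [Finset.sum_comm]
    exact Finset.sum_congr rfl fun _ _ => Finset.sum_congr rfl fun _ _ => by ring
  refine ⟨P.image pull, Q.image pull, ?_⟩
  ext D
  simp only [Set.mem_ofPred_eq, Finset.forall_mem_image, key]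
  rfl

end Pullback

/-! ### From a finite generating set to a strong Khovanskii basis. -/

section FiniteGeneration

variable {k : Type*} [Field k] {E : Type*} [AddCommGroup E] [Module k E] {m n d e : ℕ}

theorem IsHomogeneousGenerating.append {b : Fin d → SymmetricAlgebra k E}
    (hb : IsHomogeneousGenerating b) {c : Fin e → SymmetricAlgebra k E}
    (hc : ∀ l, ∃ ε : ℕ, 0 < ε ∧ c l ∈ (LinearMap.range (SymmetricAlgebra.ι k E)) ^ ε) :
    IsHomogeneousGenerating (Fin.append b c) := by
  refine ⟨fun j => ?_, ?_⟩
  · induction j using Fin.addCases with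
    | left j => simpa using hb.homogeneous j
    | right l => simpa using hc l
  · rw [eq_top_iff, ← hb.generates]
    refine Algebra.adjoin_mono ?_
    rintro _ ⟨j, rfl⟩
    exact ⟨Fin.castAdd e j, by simp⟩

theorem exists_le_expWeight_of_mem {b : Fin d → SymmetricAlgebra k E} {δ : Fin d → ℕ}
    (hbδ : ∀ j, b j ∈ (LinearMap.range (SymmetricAlgebra.ι k E)) ^ δ j) {w : Fin d → ℤ} {q : ℤ}
    {N : ℕ} {a : SymmetricAlgebra k E} (ha : a ∈ (LinearMap.range (SymmetricAlgebra.ι k E)) ^ N)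
    (ha0 : a ≠ 0) (haq : a ∈ weightFiltration (k := k) b w q) :
    ∃ α ∈ expDeg δ N, q ≤ expWeight w α := by
  obtain ⟨g, hg, rfl⟩ := mem_weightFiltration.1 haq
  rw [← aeval_restr_of_mem_pow hbδ ha] at ha0
  obtain ⟨α, hα⟩ := ne_zero_iff.1 fun h : restr (expDeg δ N) g = 0 =>
    ha0 (by rw [h, map_zero])
  exact ⟨α, mem_restrictSupport'.1 (restr_mem _ _) α hα,
    mem_restrictSupport'.1 (restr_mem_of_mem _ hg) α hα⟩

/-- Every nonzero homogeneous element has a value. -/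
theorem exists_mem_weightFiltration_notMem_succ {b : Fin d → SymmetricAlgebra k E}
    (hb : IsHomogeneousGenerating b) (w : Fin d → ℤ) {N : ℕ} {a : SymmetricAlgebra k E}
    (ha : a ∈ (LinearMap.range (SymmetricAlgebra.ι k E)) ^ N) (ha0 : a ≠ 0) :
    ∃ v : ℤ, a ∈ weightFiltration (k := k) b w v ∧ a ∉ weightFiltration (k := k) b w (v + 1) := by
  choose δ hδ hbδ using hb.homogeneous
  obtain ⟨Q, hQ⟩ := exists_expWeight_lt hδ w N
  obtain ⟨p, hp⟩ := exists_aeval_eq hb a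
  obtain ⟨q, hq, -⟩ := exists_expWeight_min w (p := p) (by
    rintro rfl
    exact ha0 (by rw [← hp, map_zero]))
  -- A nonzero homogeneous element has a representing monomial of its own degree in each step that
  -- contains it, so the weights of that degree bound the value.
  obtain ⟨v, hv, hmax⟩ := Int.exists_greatest_of_bdd
    (P := fun q => a ∈ weightFiltration (k := k) b w q)
    ⟨Q, fun z hz => by
      obtain ⟨α, hα, hz⟩ := exists_le_expWeight_of_mem hbδ ha ha0 hz
      exact hz.trans (hQ α hα).le⟩ ⟨q, mem_weightFiltration.2 ⟨p, hq, hp⟩⟩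
  refine ⟨v, hv, fun h => ?_⟩
  have := hmax _ h
  omega

theorem mem_weightFiltration_component {b : Fin d → SymmetricAlgebra k E} {δ : Fin d → ℕ}
    (hbδ : ∀ j, b j ∈ (LinearMap.range (SymmetricAlgebra.ι k E)) ^ δ j) {w : Fin d → ℤ} {q : ℤ}
    {a : SymmetricAlgebra k E} (ha : a ∈ weightFiltration (k := k) b w q) (N : ℕ) :
    (gradingHom k E a).coeff N ∈ weightFiltration (k := k) b w q := by
  obtain ⟨g, hg, rfl⟩ := mem_weightFiltration.1 ha
  rw [coeff_gradingHom_aeval hbδ]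
  exact mem_weightFiltration.2 ⟨_, restr_mem_of_mem _ hg, rfl⟩

/-- A finitely generated total section ring has a strong Khovanskii basis that extends `b`. -/
theorem exists_isStrongKhovanskiiBasis_append {b : Fin d → SymmetricAlgebra k E}
    (hb : IsHomogeneousGenerating b) {D : Matrix (Fin n) (Fin d) ℤ}
    (hfg : (totalSectionRing k b D).FG) :
    ∃ (e : ℕ) (c : Fin e → SymmetricAlgebra k E) (ε : Fin e → ℕ), (∀ l, 0 < ε l) ∧
      (∀ l, c l ≠ 0) ∧ (∀ l, c l ∈ (LinearMap.range (SymmetricAlgebra.ι k E)) ^ ε l) ∧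
      ∀ v : Fin n → Fin e → ℤ, (∀ i l, c l ∈ weightFiltration (k := k) b (D i) (v i l)) →
        (∀ i l, c l ∉ weightFiltration (k := k) b (D i) (v i l + 1)) →
        IsStrongKhovanskiiBasis k (Fin.append b c) fun i => Fin.append (D i) (v i) := by
  classical
  choose δ hδ hbδ using hb.homogeneous
  obtain ⟨S, hS⟩ := hfg
  have hcomp : ∀ (a : SymmetricAlgebra k E) (N : ℕ),
      (gradingHom k E a).coeff N ∈ (LinearMap.range (SymmetricAlgebra.ι k E)) ^ N := by
    intro a N
    obtain ⟨p, rfl⟩ := exists_aeval_eq hb a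
    rw [coeff_gradingHom_aeval hbδ]
    exact aeval_mem_pow_range hbδ (restr_mem _ _)
  -- The nonzero components of positive degree of all coefficients of the generators. Components of
  -- degree zero are scalars and need no new generator.
  set T : Finset (SymmetricAlgebra k E) := S.biUnion fun x => x.coeff.support.biUnion fun r =>
    ((gradingHom k E (x.coeff r)).support.erase 0).image (gradingHom k E (x.coeff r)).coeff with hT
  have hTmem : ∀ a ∈ T, a ≠ 0 ∧ ∃ ε : ℕ, 0 < ε ∧
      a ∈ (LinearMap.range (SymmetricAlgebra.ι k E)) ^ ε := by
    intro a ha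
    simp only [hT, Finset.mem_biUnion, Finset.mem_image, Finset.mem_erase] at ha
    obtain ⟨x, -, r, -, N, ⟨hN, hN'⟩, rfl⟩ := ha
    exact ⟨Polynomial.mem_support_iff.1 hN', N, Nat.pos_of_ne_zero hN, hcomp _ _⟩
  choose ε hε hcε using fun l : Fin T.card => (hTmem _ (T.equivFin.symm l).2).2
  refine ⟨T.card, fun l => T.equivFin.symm l, ε, hε,
    fun l => (hTmem _ (T.equivFin.symm l).2).1, hcε, fun v hv hv' => ?_⟩
  set c : Fin T.card → SymmetricAlgebra k E := fun l => T.equivFin.symm l with hc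
  set D₁ : Matrix (Fin n) (Fin (d + T.card)) ℤ := fun i => Fin.append (D i) (v i) with hD₁
  refine le_antisymm (coxPresentation_range_le _ _) ?_
  -- Appending elements leaves the total section ring unchanged, so it suffices to reach its old
  -- generators.
  rw [← totalSectionRing_congr (k := k) (b := b) (D := D) fun i q =>
    (weightFiltration_append (hv i) q).symm, ← hS]
  refine Algebra.adjoin_le fun x hx => ?_
  have hxT : x ∈ totalSectionRing k b D := hS ▸ Algebra.subset_adjoin hx
  have hsingle : ∀ (r : Fin n → ℤ) (p : MvPolynomial (Fin (d + T.card)) k),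
      p ∈ restrictSupport k (expRows D₁ r) →
      AddMonoidAlgebra.single r (aeval (Fin.append b c) p) ∈
        (coxPresentation k (Fin.append b c) D₁).range :=
    fun r p hp => ⟨_, coxPresentation_homog _ hp⟩
  have hr : ∀ r, AddMonoidAlgebra.single r (x.coeff r) ∈
      (coxPresentation k (Fin.append b c) D₁).range := by
    intro r
    by_cases hxr : x.coeff r = 0
    · rw [hxr, AddMonoidAlgebra.single_zero]
      exact Subalgebra.zero_mem _
    obtain ⟨p, hp⟩ := exists_aeval_eq hb (x.coeff r)
    let φ : SymmetricAlgebra k E →ₗ[k] AddMonoidAlgebra (SymmetricAlgebra k E) (Fin n → ℤ) :=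
      { toFun := AddMonoidAlgebra.single r
        map_add' := fun a a' => AddMonoidAlgebra.single_add r a a'
        map_smul' := fun a a' => (AddMonoidAlgebra.smul_single a r a').symm }
    have hφ := map_mem_of_restr_fiber_mem (Finsupp.weight δ)
      (φ ∘ₗ (aeval b : MvPolynomial (Fin d) k →ₐ[k] SymmetricAlgebra k E).toLinearMap)
      (Z := (coxPresentation k (Fin.append b c) D₁).range.toSubmodule) (p := p) ?_
    · change AddMonoidAlgebra.single r (aeval b p) ∈ _ at hφ
      rwa [hp] at hφ
    intro N
    change AddMonoidAlgebra.single r (aeval b (restr (expDeg δ N) p)) ∈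
      (coxPresentation k (Fin.append b c) D₁).range
    rw [← coeff_gradingHom_aeval hbδ, hp]
    by_cases h0 : (gradingHom k E (x.coeff r)).coeff N = 0
    · rw [h0, AddMonoidAlgebra.single_zero]
      exact Subalgebra.zero_mem _
    have hw := fun i => mem_weightFiltration_component hbδ (hxT r i) N
    rcases Nat.eq_zero_or_pos N with rfl | hN
    · have h1 := hcomp (x.coeff r) 0
      -- The only exponent of degree zero is `0`, of weight `0`. Hence a nonzero scalar occurs only
      -- with `r ≤ 0`, where it is obtained from the variables `Xᵢ`.
      have h2 : ∀ i, r i ≤ 0 := by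
        intro i
        obtain ⟨α, hα, hαr⟩ := exists_le_expWeight_of_mem hbδ h1 h0 (hw i)
        have : α = 0 := by
          ext j
          have h3 : Finsupp.weight δ α = 0 := hα
          by_contra hj
          have := Finsupp.le_weight δ (hδ j).ne' α
          simp only [Finsupp.coe_zero, Pi.zero_apply] at hj
          omega
        rwa [this, expWeight_zero] at hαr
      rw [pow_zero, Submodule.mem_one] at h1
      obtain ⟨t, ht⟩ := h1
      rw [← ht]
      have := hsingle r (C t) ((monomial_mem_restrictSupport k).2 (Or.inl fun i => by
        rw [expWeight_zero]
        exact h2 i))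
      rwa [aeval_C] at this
    · have hmem : (gradingHom k E (x.coeff r)).coeff N ∈ T := by
        simp only [hT, Finset.mem_biUnion, Finset.mem_image, Finset.mem_erase]
        exact ⟨x, hx, r, Finsupp.mem_support_iff.2 hxr, N,
          ⟨hN.ne', Polynomial.mem_support_iff.2 h0⟩, rfl⟩
      obtain ⟨l, hl⟩ : ∃ l, c l = (gradingHom k E (x.coeff r)).coeff N :=
        ⟨T.equivFin ⟨_, hmem⟩, by simp [hc]⟩
      rw [← hl] at hw ⊢
      -- Since `v i l` is the exact value of `c l`, it is at least `r i`, so the homogenized new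
      -- variable maps to this component times `t^r`.
      have := hsingle r (X (Fin.natAdd d l)) ((monomial_mem_restrictSupport k).2
        (Or.inl fun i => by
          have h1 : D₁ i (Fin.natAdd d l) = v i l := Fin.append_right _ _ _
          rw [expWeight_single, h1, Nat.cast_one, one_mul]
          by_contra hlt
          exact hv' i l (weightFiltration_anti b (D i) (by omega) (hw i))))
      rwa [aeval_X, Fin.append_right] at this
  have hx2 : x = ∑ r ∈ x.coeff.support, AddMonoidAlgebra.single r (x.coeff r) := by
    ext r
    simp [AddMonoidAlgebra.coeff_sum, Finsupp.single_apply]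
  rw [hx2]
  exact Subalgebra.sum_mem _ fun r _ => hr r

end FiniteGeneration

/-! ### Projecting good cones of extended families. -/

section Locus

variable {k : Type*} [Field k] {E : Type*} [AddCommGroup E] [Module k E] {m n d e : ℕ}

/-- The restriction of a diagram in a good cone of an extension of `b`. -/
theorem restriction_mem_of_mem_goodCone {fan : SmoothFan m n} {b : Fin d → SymmetricAlgebra k E}
    {δ : Fin d → ℕ} (hδ : ∀ j, 0 < δ j)
    (hbδ : ∀ j, b j ∈ (LinearMap.range (SymmetricAlgebra.ι k E)) ^ δ j)
    {c : Fin e → SymmetricAlgebra k E} {ε : Fin e → ℕ} (hε : ∀ l, 0 < ε l)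
    (hcε : ∀ l, c l ∈ (LinearMap.range (SymmetricAlgebra.ι k E)) ^ ε l)
    {D : Matrix (Fin n) (Fin d) ℤ} (hD : D ∈ diagrams fan b) {v : Fin n → Fin e → ℤ}
    (hc : ∀ i l, c l ∈ weightFiltration (k := k) b (D i) (v i l))
    {F : Finset (MvPolynomial (Fin n ⊕ Fin (d + e)) k)}
    (hF : IsGoodGeneratingSet (Fin.append b c) (fun i => Fin.append (D i) (v i)) F)
    {D' : Matrix (Fin n) (Fin (d + e)) ℤ}
    (hD' : D' ∈ goodCone fan (Fin.append b c) (fun i => Fin.append (D i) (v i)) F) :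
    (fun i j => D' i (Fin.castAdd e j)) ∈ diagrams fan b ∧
      totalSectionRing k b (fun i j => D' i (Fin.castAdd e j)) =
        totalSectionRing k (Fin.append b c) D' := by
  have hin := initialIdeal_eq_of_mem_goodCone (append_pos hδ hε) (append_mem_pow hbδ hcε) hF hD'
  have hI' := isDegHomogeneous_relationIdeal (append_mem_pow hbδ hcε)
  have h1 := fun i => append_mem_weightFiltration_comp (hc i)
  -- Redundancy of the new generators is preserved over the whole cone. Thus they can be eliminated
  -- from the initial ideals of `D'` as well, and the filtrations of `D'` are those of its old
  -- columns.
  have h2 := fun i => mem_weightFiltration_comp_of_initialIdeal_eq (append_pos hδ hε) hI'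
    (hin i) (h1 i)
  have hren : ∀ p ∈ relationIdeal k b,
      rename (Fin.castAdd e) p ∈ relationIdeal k (Fin.append b c) :=
    fun p hp => (rename_mem_relationIdeal_append c).2 hp
  refine ⟨mem_diagrams_of_initialIdeal_eq hδ hbδ hD fun i => ?_, totalSectionRing_congr fun i q => ?_⟩
  · have hi := hin i
    refine le_antisymm (fun p hp => ?_) (fun p hp => ?_)
    · have := rename_mem_initialIdeal_append hren (v i) hp
      rw [hi] at this
      have := mem_initialIdeal_of_rename_mem (h2 i) this
      rwa [append_comp_castAdd] at this
    · have := rename_mem_initialIdeal (w := D' i) hren hp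
      rw [← hi] at this
      have := mem_initialIdeal_of_rename_mem (h1 i) this
      rwa [append_comp_castAdd, append_comp_castAdd] at this
  · have := weightFiltration_comp_eq (h2 i) q
    rw [append_comp_castAdd] at this
    exact this.symm

/-- On the cone the new columns are fixed linear functions of the old ones. The projection therefore
has a linear inverse on the cone, and the image is the preimage of the cone under that linear map.
-/
theorem isPolyhedralCone_image_goodCone {fan : SmoothFan m n} {b : Fin d → SymmetricAlgebra k E}
    {δ : Fin d → ℕ} (hδ : ∀ j, 0 < δ j)
    (hbδ : ∀ j, b j ∈ (LinearMap.range (SymmetricAlgebra.ι k E)) ^ δ j)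
    {c : Fin e → SymmetricAlgebra k E} {ε : Fin e → ℕ} (hε : ∀ l, 0 < ε l)
    (hcε : ∀ l, c l ∈ (LinearMap.range (SymmetricAlgebra.ι k E)) ^ ε l)
    {D : Matrix (Fin n) (Fin d) ℤ} {v : Fin n → Fin e → ℤ}
    (hc : ∀ i l, c l ∈ weightFiltration (k := k) b (D i) (v i l))
    (hc' : ∀ i l, c l ∉ weightFiltration (k := k) b (D i) (v i l + 1))
    (hD : (fun i => Fin.append (D i) (v i)) ∈ diagrams fan (Fin.append b c))
    {F : Finset (MvPolynomial (Fin n ⊕ Fin (d + e)) k)}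
    (hF : IsGoodGeneratingSet (Fin.append b c) (fun i => Fin.append (D i) (v i)) F) :
    IsPolyhedralCone ((fun (D' : Matrix (Fin n) (Fin (d + e)) ℤ) i j =>
      D' i (Fin.castAdd e j)) ''
        goodCone fan (Fin.append b c) (fun i => Fin.append (D i) (v i)) F) := by
  have hδ' := append_pos hδ hε
  have hbδ' := append_mem_pow hbδ hcε
  have hI' := isDegHomogeneous_relationIdeal hbδ'
  have hβ : ∀ i l, ∃ β : Fin d →₀ ℕ, ∀ w', initialIdeal (Fin.append (D i) (v i))
      (relationIdeal k (Fin.append b c)) = initialIdeal w' (relationIdeal k (Fin.append b c)) →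
      w' (Fin.natAdd d l) = expWeight (w' ∘ Fin.castAdd e) β := by
    intro i l
    refine exists_weight_eq_expWeight hI' (append_mem_weightFiltration_comp (hc i)) ?_
    rw [Fin.append_right, Fin.append_right, weightFiltration_append (hc i)]
    exact hc' i l
  choose β hβ using hβ
  have key : ∀ D' ∈ goodCone fan (Fin.append b c) (fun i => Fin.append (D i) (v i)) F,
      (fun i => Fin.append (fun j => D' i (Fin.castAdd e j))
        fun l => ∑ j, (β i l j : ℤ) * D' i (Fin.castAdd e j)) = D' := by
    intro D' hD'
    funext i j
    induction j using Fin.addCases with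
    | left j => rw [Fin.append_left]
    | right l =>
      rw [Fin.append_right, hβ i l _ (initialIdeal_eq_of_mem_goodCone hδ' hbδ' hF hD' i),
        expWeight_eq_sum]
      rfl
  convert (isPolyhedralCone_goodCone hδ' hbδ' hD hF).append_preimage
    (fun i l j => (β i l j : ℤ)) using 1
  ext D'
  constructor
  · rintro ⟨D₁, hD₁, rfl⟩
    have h := Set.mem_of_eq_of_mem (key D₁ hD₁) hD₁
    exact h
  · intro h
    exact ⟨_, h, by
      funext i j
      exact Fin.append_left _ _ _⟩

end Locus

/-! ### Assembly of the two assertions. -/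

theorem mainTheorem11 {k : Type*} [Field k] {E : Type*} [AddCommGroup E] [Module k E]
    [FiniteDimensional k E] {m n d : ℕ} (fan : SmoothFan m n)
    (b : Fin d → SymmetricAlgebra k E) (hb : IsHomogeneousGenerating b) :
    (∀ D ∈ diagrams fan b, (totalSectionRing k b D).FG → IsStrongKhovanskiiBasis k b D →
      ∀ F : Finset (MvPolynomial (Fin n ⊕ Fin d) k), IsGoodGeneratingSet b D F →
        D ∈ goodCone fan b D F ∧ IsPolyhedralCone (goodCone fan b D F) ∧
        ∀ D' ∈ goodCone fan b D F, (totalSectionRing k b D').FG) ∧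
    (∃ 𝒞 : Set (Set (Matrix (Fin n) (Fin d) ℤ)), ⋃₀ 𝒞 = fgLocus fan b ∧
      ∀ C ∈ 𝒞, IsPolyhedralCone C ∧
        ∃ (e : ℕ) (c : Fin e → SymmetricAlgebra k E) (D : Matrix (Fin n) (Fin (d + e)) ℤ)
          (F : Finset (MvPolynomial (Fin n ⊕ Fin (d + e)) k)),
          IsHomogeneousGenerating (Fin.append b c) ∧
          D ∈ diagrams fan (Fin.append b c) ∧
          (totalSectionRing k (Fin.append b c) D).FG ∧
          IsStrongKhovanskiiBasis k (Fin.append b c) D ∧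
          IsGoodGeneratingSet (Fin.append b c) D F ∧
          C = (fun D' i j => D' i (Fin.castAdd e j)) ''
            goodCone fan (Fin.append b c) D F ∧
          ∀ D' ∈ goodCone fan (Fin.append b c) D F,
            totalSectionRing k b (fun i j => D' i (Fin.castAdd e j)) =
              totalSectionRing k (Fin.append b c) D') := by
  refine ⟨fun D hD _ hK F hF => ?_, ?_⟩
  · choose δ hδ hbδ using hb.homogeneous
    exact ⟨⟨hD, fun _ _ _ => rfl⟩, isPolyhedralCone_goodCone hδ hbδ hD hF, fun D' hD' =>
      (hK.of_initialIdeal_eq hδ (isDegHomogeneous_relationIdeal hbδ)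
        (initialIdeal_eq_of_mem_goodCone hδ hbδ hF hD')).fg⟩
  -- Each diagram in the locus receives a cone that contains it and stays inside the locus; the
  -- family of all these cones has the locus as its union.
  · have key : ∀ D : fgLocus fan b, ∃ C : Set (Matrix (Fin n) (Fin d) ℤ),
        D.1 ∈ C ∧ C ⊆ fgLocus fan b ∧ IsPolyhedralCone C ∧
        ∃ (e : ℕ) (c : Fin e → SymmetricAlgebra k E) (D : Matrix (Fin n) (Fin (d + e)) ℤ)
          (F : Finset (MvPolynomial (Fin n ⊕ Fin (d + e)) k)),
          IsHomogeneousGenerating (Fin.append b c) ∧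
          D ∈ diagrams fan (Fin.append b c) ∧
          (totalSectionRing k (Fin.append b c) D).FG ∧
          IsStrongKhovanskiiBasis k (Fin.append b c) D ∧
          IsGoodGeneratingSet (Fin.append b c) D F ∧
          C = (fun D' i j => D' i (Fin.castAdd e j)) ''
            goodCone fan (Fin.append b c) D F ∧
          ∀ D' ∈ goodCone fan (Fin.append b c) D F,
            totalSectionRing k b (fun i j => D' i (Fin.castAdd e j)) =
              totalSectionRing k (Fin.append b c) D' := by
      rintro ⟨D, hD, hfg⟩
      obtain ⟨e, c, ε, hε, hc0, hcε, hK⟩ := exists_isStrongKhovanskiiBasis_append hb hfg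
      -- The entries of the new columns are the exact values of the new generators: lower entries
      -- could violate `Trop_⋆` and the generation property, higher ones would change the
      -- filtrations.
      choose v hc hc' using fun i l =>
        exists_mem_weightFiltration_notMem_succ hb (D i) (hcε l) (hc0 l)
      specialize hK v hc hc'
      have hD₁ : (fun i => Fin.append (D i) (v i)) ∈ diagrams fan (Fin.append b c) :=
        ⟨fun i => append_mem_tropStar hb (hD.1 i) (hc i) (hc' i),
          isAdapted_append hb hD.2 hε hcε hc⟩
      obtain ⟨F, hF⟩ := exists_isGoodGeneratingSet (k := k) (Fin.append b c)
        (fun i => Fin.append (D i) (v i))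
      choose δ hδ hbδ using hb.homogeneous
      have hres : ∀ D' ∈ goodCone fan (Fin.append b c) (fun i => Fin.append (D i) (v i)) F, _ :=
        fun D' hD' => restriction_mem_of_mem_goodCone hδ hbδ hε hcε hD hc hF hD'
      refine ⟨(fun D' i j => D' i (Fin.castAdd e j)) ''
          goodCone fan (Fin.append b c) (fun i => Fin.append (D i) (v i)) F,
        ⟨fun i => Fin.append (D i) (v i), ⟨hD₁, fun _ _ _ => rfl⟩, ?_⟩, ?_,
        isPolyhedralCone_image_goodCone hδ hbδ hε hcε hc hc' hD₁ hF, e, c, _, F,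
        hb.append fun l => ⟨ε l, hε l, hcε l⟩, hD₁, hK.fg, hK, hF, rfl, fun D' hD' =>
        (hres D' hD').2⟩
      · funext i j
        exact Fin.append_left _ _ _
      · rintro _ ⟨D', hD', rfl⟩
        refine ⟨(hres D' hD').1, ?_⟩
        change (totalSectionRing k b fun i j => D' i (Fin.castAdd e j)).FG
        rw [(hres D' hD').2]
        exact (hK.of_initialIdeal_eq (append_pos hδ hε)
          (isDegHomogeneous_relationIdeal (append_mem_pow hbδ hcε))
          (initialIdeal_eq_of_mem_goodCone (append_pos hδ hε) (append_mem_pow hbδ hcε) hF hD')).fg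
    choose C hCmem hCsub hC using key
    refine ⟨Set.range C, ?_, ?_⟩
    · refine Set.Subset.antisymm (Set.sUnion_subset ?_) fun D hD => ⟨C ⟨D, hD⟩, ⟨_, rfl⟩, hCmem _⟩
      rintro _ ⟨D, rfl⟩
      exact hCsub D
    · rintro _ ⟨D, rfl⟩
      exact hC D
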